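/- **Theorem (Conformal pseudo-differential).** All manifolds are smooth and 4-dimensional, and all metrics $g_{ab}$ are smooth pseudo-Riemannian metrics (of any signature) with Levi-Civita connection $\nabla$. Conventions: $\nabla_a\nabla_b\omega_c-\nabla_b\nabla_a\omega_c=R_{abc}{}^d\omega_d$, $R_{ac}=R_{abc}{}^b$, $L_{ab}=\tfrac12(R_{ab}-\tfrac16Rg_{ab})$, $C_{abc}{}^d=R_{abc}{}^d-2L^d{}_{[b}g_{a]c}-2\delta^d{}_{[b}L_{a]c}$, where square brackets denote antisymmetrization with the factor $\tfrac12$. Only metrics whose Weyl scalar $C\cdot C=C_{abcd}C^{abcd}$ vanishes nowhere are considered, and for these one puts $$\Lambda_d=\frac{8\,C_d{}^{amp}\nabla_{[m}L_{p]a}}{C\cdot C}.$$ A *metric concomitant* $K$ of type $(p,q)$ assigns to every such $(\mathcal M,g)$ a smooth tensor field $K(g)=K^{a_1\dots a_p}{}_{b_1\dots b_q}$ on $\mathcal M$ that depends on the metric only, i.e. $\varphi^*K(h)=K(g)$ for every local diffeomorphism $\varphi:\mathcal M\to\mathcal N$ with $\varphi^*h=g$. It is *conformally covariant of weight* $s\in\mathbb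 Z$ on $\mathcal M$ if, for all such metrics $g,\tilde g$ on $\mathcal M$ and every smooth function $\Theta>0$ with $g_{ab}=\Theta^2\tilde g_{ab}$, the tensor fields $K=K(g)$ and $\tilde K=K(\tilde g)$ satisfy $\tilde K=\Theta^sK$. Let $(p,q)\neq(0,0)$, $s\in\mathbb Z$, $r=p+q$, and let $K$ be a metric concomitant of type $(p,q)$. Define its conformal pseudo-differential, of type $(p,q+1)$, by $$D_a^{s,(p,q)}K^{a_1\dots a_p}{}_{b_1\dots b_q}=\nabla_aK^{a_1\dots a_p}{}_{b_1\dots b_q}+\sum_{j=1}^p\bar M^{a_j}{}_{ac}\,K^{a_1\dots a_{j-1}c\,a_{j+1}\dots a_p}{}_{b_1\dots b_q}+\sum_{j=1}^qM^{c}{}_{ab_j}\,K^{a_1\dots a_p}{}_{b_1\dots b_{j-1}c\,b_{j+1}\dots b_q},$$ $$M^c{}_{ba}=\frac{s+r}{r}\Lambda_b\delta_a{}^c+\Lambda_a\delta_b{}^c-g_{ab}g^{cd}\Lambda_d,\qquad \bar M^c{}_{ba}=\frac{s-r}{r}\Lambda_b\delta_a{}^c-\Lambda_a\delta_b{}^c+g_{ab}g^{cd}\Lambda_d.$$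 Then $D^{s,(p,q)}K$ is again a metric concomitant, and on every manifold $\mathcal M$ on which $K$ is conformally covariant of weight $s$, so is $D^{s,(p,q)}K$: $$\widetilde D_a^{s,(p,q)}\tilde K^{a_1\dots a_p}{}_{b_1\dots b_q}=\Theta^s\,D_a^{s,(p,q)}K^{a_1\dots a_p}{}_{b_1\dots b_q},$$ where $\widetilde D$ is the operator $D$ built from $\tilde g$. -/

import Mathlib

open scoped Manifold ContDiff

universe u

noncomputable section

namespace ConformalConcomitant

/-- The model space of a 4-dimensional manifold. -/
abbrev E4 : Type := EuclideanSpace ℝ (Fin 4)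

/-! ### Coordinate expressions

`G : E4 → Matrix (Fin 4) (Fin 4) ℝ` stands for the components `g_ab` of a pseudo-Riemannian metric
in a coordinate system, as functions of the coordinates. A family
`T : E4 → (Fin p → Fin 4) → (Fin q → Fin 4) → ℝ` stands for the components
`T^{A 0 … A (p-1)}_{B 0 … B (q-1)}` of a tensor field of type `(p, q)`. -/

/-- The Kronecker delta. -/
def delta (a b : Fin 4) : ℝ := if a = b then 1 else 0

/-- The partial derivative `∂_a f` at the point `z`. -/
def pderiv (a : Fin 4) (f : E4 → ℝ) (z : E4) : ℝ :=
  fderiv ℝ f z (EuclideanSpace.single a 1)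

/-- The contravariant metric `g^{ab}`. -/
def invMetric (G : E4 → Matrix (Fin 4) (Fin 4) ℝ) (z : E4) (a b : Fin 4) : ℝ := (G z)⁻¹ a b

/-- The Christoffel symbol `Γ^c_{ab}` of the Levi-Civita connection. -/
def christoffel (G : E4 → Matrix (Fin 4) (Fin 4) ℝ) (z : E4) (c a b : Fin 4) : ℝ :=
  (1 / 2) * ∑ d, invMetric G z c d *
    (pderiv a (fun y => G y d b) z + pderiv b (fun y => G y d a) z - pderiv d (fun y => G y a b) z)

/-- The covariant derivative `∇_a T^{A}_{B}` with respect to the Levi-Civita connection. -/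
def covDeriv (G : E4 → Matrix (Fin 4) (Fin 4) ℝ) {p q : ℕ}
    (T : E4 → (Fin p → Fin 4) → (Fin q → Fin 4) → ℝ) (z : E4) (a : Fin 4)
    (A : Fin p → Fin 4) (B : Fin q → Fin 4) : ℝ :=
  pderiv a (fun y => T y A B) z
    + ∑ j : Fin p, ∑ c, christoffel G z (A j) a c * T z (Function.update A j c) B
    - ∑ j : Fin q, ∑ c, christoffel G z c a (B j) * T z A (Function.update B j c)

/-- The Riemann tensor `R_{abc}{}^d`, with the sign convention
`∇_a ∇_b ω_c - ∇_b ∇_a ω_c = R_{abc}{}^d ω_d`. -/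
def riemann (G : E4 → Matrix (Fin 4) (Fin 4) ℝ) (z : E4) (a b c d : Fin 4) : ℝ :=
  pderiv b (fun y => christoffel G y d a c) z - pderiv a (fun y => christoffel G y d b c) z
    + ∑ e, (christoffel G z e a c * christoffel G z d b e
      - christoffel G z e b c * christoffel G z d a e)

/-- The Ricci tensor `R_{ac} = R_{abc}{}^b`. -/
def ricci (G : E4 → Matrix (Fin 4) (Fin 4) ℝ) (z : E4) (a c : Fin 4) : ℝ :=
  ∑ b, riemann G z a b c b

/-- The scalar curvature `R = g^{ab} R_{ab}`. -/
def scalarCurv (G : E4 → Matrix (Fin 4) (Fin 4) ℝ) (z : E4) : ℝ :=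
  ∑ a, ∑ b, invMetric G z a b * ricci G z a b

/-- The Schouten tensor `L_{ab} = (R_{ab} - R g_{ab} / 6) / 2`. -/
def schouten (G : E4 → Matrix (Fin 4) (Fin 4) ℝ) (z : E4) (a b : Fin 4) : ℝ :=
  (1 / 2) * (ricci G z a b - (1 / 6) * scalarCurv G z * G z a b)

/-- The Schouten tensor with its first index raised, `L^d{}_b = g^{de} L_{eb}`. -/
def schoutenUp (G : E4 → Matrix (Fin 4) (Fin 4) ℝ) (z : E4) (d b : Fin 4) : ℝ :=
  ∑ e, invMetric G z d e * schouten G z e b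

/-- The Weyl tensor
`C_{abc}{}^d = R_{abc}{}^d - 2 L^d{}_{[b} g_{a]c} - 2 δ^d{}_{[b} L_{a]c}`. -/
def weyl (G : E4 → Matrix (Fin 4) (Fin 4) ℝ) (z : E4) (a b c d : Fin 4) : ℝ :=
  riemann G z a b c d
    - (schoutenUp G z d b * G z a c - schoutenUp G z d a * G z b c)
    - (delta d b * schouten G z a c - delta d a * schouten G z b c)

/-- The covariant Weyl tensor `C_{abcd} = C_{abc}{}^e g_{ed}`. -/
def weylDown (G : E4 → Matrix (Fin 4) (Fin 4) ℝ) (z : E4) (a b c d : Fin 4) : ℝ :=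
  ∑ e, weyl G z a b c e * G z e d

/-- The Weyl tensor with its last three indices raised, `C_d{}^{amp}`. -/
def weylUp (G : E4 → Matrix (Fin 4) (Fin 4) ℝ) (z : E4) (d a m p : Fin 4) : ℝ :=
  ∑ a', ∑ m', ∑ p', weylDown G z d a' m' p' *
    invMetric G z a' a * invMetric G z m' m * invMetric G z p' p

/-- The Weyl scalar `C · C = C_{abcd} C^{abcd}`. -/
def weylSq (G : E4 → Matrix (Fin 4) (Fin 4) ℝ) (z : E4) : ℝ :=
  ∑ a, ∑ b, ∑ c, ∑ d, weylDown G z a b c d * ∑ e, invMetric G z a e * weylUp G z e b c d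

/-- The antisymmetrised derivative of the Schouten tensor,
`∇_{[m} L_{p]a} = (∇_m L_{pa} - ∇_p L_{ma}) / 2`. -/
def schoutenCurl (G : E4 → Matrix (Fin 4) (Fin 4) ℝ) (z : E4) (m p a : Fin 4) : ℝ :=
  (1 / 2) *
    (covDeriv G (p := 0) (q := 2) (fun y _ B => schouten G y (B 0) (B 1)) z m ![] ![p, a]
      - covDeriv G (p := 0) (q := 2) (fun y _ B => schouten G y (B 0) (B 1)) z p ![] ![m, a])

/-- The covector `Λ_d = 8 C_d{}^{amp} ∇_{[m} L_{p]a} / (C · C)`. -/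
def lam (G : E4 → Matrix (Fin 4) (Fin 4) ℝ) (z : E4) (d : Fin 4) : ℝ :=
  8 * (∑ a, ∑ m, ∑ p, weylUp G z d a m p * schoutenCurl G z m p a) / weylSq G z

/-- The contravariant form `g^{cd} Λ_d` of `Λ`. -/
def lamUp (G : E4 → Matrix (Fin 4) (Fin 4) ℝ) (z : E4) (c : Fin 4) : ℝ :=
  ∑ d, invMetric G z c d * lam G z d

/-- `M^c{}_{ba}(Λ, g, r, s) = ((s + r) / r) Λ_b δ_a^c + Λ_a δ_b^c - g_{ab} g^{cd} Λ_d`. -/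
def coeffM (G : E4 → Matrix (Fin 4) (Fin 4) ℝ) (r : ℕ) (s : ℤ) (z : E4) (c b a : Fin 4) : ℝ :=
  (((s : ℝ) + r) / r) * lam G z b * delta a c + lam G z a * delta b c - G z a b * lamUp G z c

/-- `M̄^c{}_{ba}(Λ, g, r, s) = ((s - r) / r) Λ_b δ_a^c - Λ_a δ_b^c + g_{ab} g^{cd} Λ_d`. -/
def coeffMbar (G : E4 → Matrix (Fin 4) (Fin 4) ℝ) (r : ℕ) (s : ℤ) (z : E4) (c b a : Fin 4) : ℝ :=
  (((s : ℝ) - r) / r) * lam G z b * delta a c - lam G z a * delta b c + G z a b * lamUp G z c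

/-- The components of the conformal pseudo-differential of a tensor field of type `(p, q)`,
`D_a K^{A}_{B} = ∇_a K^{A}_{B} + ∑_j M̄^{A j}{}_{ac} K^{… c …}_{B} + ∑_j M^c{}_{a (B j)} K^{A}_{… c …}`,
where `M` and `M̄` are taken for the rank `r = p + q` of `K`. -/
def pseudoDiffComponents (G : E4 → Matrix (Fin 4) (Fin 4) ℝ) {p q : ℕ} (s : ℤ)
    (T : E4 → (Fin p → Fin 4) → (Fin q → Fin 4) → ℝ) (z : E4) (a : Fin 4)
    (A : Fin p → Fin 4) (B : Fin q → Fin 4) : ℝ :=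
  covDeriv G T z a A B
    + ∑ j : Fin p, ∑ c, coeffMbar G (p + q) s z (A j) a c * T z (Function.update A j c) B
    + ∑ j : Fin q, ∑ c, coeffM G (p + q) s z c a (B j) * T z A (Function.update B j c)

/-! ### Tensor fields and metrics on a 4-dimensional manifold -/

section Manifold

variable {M : Type u} [TopologicalSpace M] [ChartedSpace E4 M]

/-- Tensors of type `(p, q)` (`p` times contravariant, `q` times covariant) at `x`. -/
abbrev TensorAt (p q : ℕ) (x : M) : Type :=
  MultilinearMap ℝ (fun _ : Fin p => Module.Dual ℝ (TangentSpace (𝓡 4) x))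
    (MultilinearMap ℝ (fun _ : Fin q => TangentSpace (𝓡 4) x) ℝ)

/-- The derivative at `x` of a chart `e` around `x`. -/
def chartDeriv (e : OpenPartialHomeomorph M E4) (x : M) : TangentSpace (𝓡 4) x →L[ℝ] E4 :=
  mfderiv (𝓡 4) (𝓡 4) e x

/-- The coordinate vector `∂_i` at `x` of a chart `e` around `x`. -/
def coordVector (e : OpenPartialHomeomorph M E4) (x : M) (i : Fin 4) : TangentSpace (𝓡 4) x :=
  (chartDeriv e x).inverse (EuclideanSpace.single i 1)

/-- The coordinate covector `dx^i` at `x` of a chart `e` around `x`. -/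
def coordCovector (e : OpenPartialHomeomorph M E4) (x : M) (i : Fin 4) :
    Module.Dual ℝ (TangentSpace (𝓡 4) x) :=
  ((EuclideanSpace.proj i : E4 →L[ℝ] ℝ) ∘L chartDeriv e x).toLinearMap

/-- The components of a tensor field in a chart, as functions of the coordinates. -/
def components {p q : ℕ} (e : OpenPartialHomeomorph M E4) (K : (x : M) → TensorAt p q x)
    (z : E4) (A : Fin p → Fin 4) (B : Fin q → Fin 4) : ℝ :=
  K (e.symm z) (fun i => coordCovector e (e.symm z) (A i))
    (fun j => coordVector e (e.symm z) (B j))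

/-- The tensor `∂_{A 0} ⊗ … ⊗ ∂_{A (p-1)} ⊗ dx^{B 0} ⊗ … ⊗ dx^{B (q-1)}` at `x`. -/
def basisTensor {p q : ℕ} (e : OpenPartialHomeomorph M E4) (x : M)
    (A : Fin p → Fin 4) (B : Fin q → Fin 4) : TensorAt p q x :=
  ((MultilinearMap.mkPiAlgebra ℝ (Fin p) ℝ).compLinearMap
    (fun i => Module.Dual.eval ℝ (TangentSpace (𝓡 4) x) (coordVector e x (A i)))).smulRight
    ((MultilinearMap.mkPiAlgebra ℝ (Fin q) ℝ).compLinearMap (fun j => coordCovector e x (B j)))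

/-- The tensor at `x` with given components in the chart `e`. -/
def ofComponents {p q : ℕ} (e : OpenPartialHomeomorph M E4) (x : M)
    (t : (Fin p → Fin 4) → (Fin q → Fin 4) → ℝ) : TensorAt p q x :=
  ∑ A, ∑ B, t A B • basisTensor e x A B

/-- Smoothness of a tensor field: its components in every chart of the atlas are smooth. -/
def IsSmoothTensorField {p q : ℕ} (K : (x : M) → TensorAt p q x) : Prop :=
  ∀ e ∈ atlas E4 M, ∀ (A : Fin p → Fin 4) (B : Fin q → Fin 4),
    ContDiffOn ℝ ∞ (fun z => components e K z A B) e.target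

/-- The components `g_ab` in a chart of a field of bilinear forms. -/
def bilinComponents (g : (x : M) → LinearMap.BilinForm ℝ (TangentSpace (𝓡 4) x))
    (e : OpenPartialHomeomorph M E4) (z : E4) : Matrix (Fin 4) (Fin 4) ℝ :=
  Matrix.of fun a b => g (e.symm z) (coordVector e (e.symm z) a) (coordVector e (e.symm z) b)

variable (M) in
/-- A smooth pseudo-Riemannian metric, of any signature, on a 4-dimensional manifold. -/
structure PseudoRiemannianMetric where
  /-- The bilinear form on each tangent space. -/
  form : (x : M) → LinearMap.BilinForm ℝ (TangentSpace (𝓡 4) x)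
  symm : ∀ (x : M) (v w : TangentSpace (𝓡 4) x), form x v w = form x w v
  nondegenerate : ∀ x : M, (form x).Nondegenerate
  smooth : ∀ e ∈ atlas E4 M, ∀ a b : Fin 4,
    ContDiffOn ℝ ∞ (fun z => bilinComponents form e z a b) e.target

/-- The components `g_ab` of a metric in a chart, as functions of the coordinates. -/
def PseudoRiemannianMetric.components (g : PseudoRiemannianMetric M)
    (e : OpenPartialHomeomorph M E4) : E4 → Matrix (Fin 4) (Fin 4) ℝ :=
  bilinComponents g.form e

/-- The Weyl scalar `C · C` as a function on the manifold. -/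
def PseudoRiemannianMetric.weylScalar (g : PseudoRiemannianMetric M) (x : M) : ℝ :=
  weylSq (g.components (chartAt E4 x)) (chartAt E4 x x)

variable (M) in
/-- A pseudo-Riemannian metric whose Weyl scalar vanishes nowhere. -/
structure NondegenerateMetric extends PseudoRiemannianMetric M where
  weylScalar_ne_zero : ∀ x : M, toPseudoRiemannianMetric.weylScalar x ≠ 0

/-- The conformal pseudo-differential `D_a^{s,(p,q)} K` of a tensor field `K` of type `(p, q)` on
`(M, g)`, a tensor field of type `(p, q + 1)`; the index `a` is the first covariant one. -/
def pseudoDiff (g : NondegenerateMetric M) {p q : ℕ} (s : ℤ) (K : (x : M) → TensorAt p q x) :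
    (x : M) → TensorAt p (q + 1) x := fun x =>
  ofComponents (chartAt E4 x) x fun A B =>
    pseudoDiffComponents (g.components (chartAt E4 x)) s (components (chartAt E4 x) K)
      (chartAt E4 x x) (B 0) A (fun j => B j.succ)

end Manifold

/-! ### Metric concomitants -/

/-- An assignment of a tensor field of type `(p, q)` to every 4-dimensional pseudo-Riemannian
manifold with nowhere vanishing Weyl scalar. -/
abbrev TensorAssignment (p q : ℕ) : Type (u + 1) :=
  (M : Type u) → [TopologicalSpace M] → [ChartedSpace E4 M] → [IsManifold (𝓡 4) ∞ M] →
    [T2Space M] → [SecondCountableTopology M] → NondegenerateMetric M → (x : M) → TensorAt p q x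

/-- `K` is a metric concomitant: its values are smooth tensor fields, and they are determined by
the metric alone, that is, a local isometry `φ : (M, g) → (N, h)` pulls `K(h)` back to `K(g)`.
(Inclusions of open sets and changes of coordinates are local isometries.) -/
structure IsMetricConcomitant {p q : ℕ} (K : TensorAssignment.{u} p q) : Prop where
  smooth : ∀ (M : Type u) [TopologicalSpace M] [ChartedSpace E4 M] [IsManifold (𝓡 4) ∞ M]
    [T2Space M] [SecondCountableTopology M] (g : NondegenerateMetric M),
    IsSmoothTensorField (K M g)
  natural : ∀ (M N : Type u)
    [TopologicalSpace M] [ChartedSpace E4 M] [IsManifold (𝓡 4) ∞ M]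
    [T2Space M] [SecondCountableTopology M]
    [TopologicalSpace N] [ChartedSpace E4 N] [IsManifold (𝓡 4) ∞ N]
    [T2Space N] [SecondCountableTopology N]
    (g : NondegenerateMetric M) (h : NondegenerateMetric N) (φ : M → N),
    IsLocalDiffeomorph (𝓡 4) (𝓡 4) ∞ φ →
    (∀ (x : M) (v w : TangentSpace (𝓡 4) x),
      g.form x v w = h.form (φ x) (mfderiv (𝓡 4) (𝓡 4) φ x v) (mfderiv (𝓡 4) (𝓡 4) φ x w)) →
    ∀ (x : M) (α : Fin p → Module.Dual ℝ (TangentSpace (𝓡 4) (φ x)))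
      (Y : Fin q → TangentSpace (𝓡 4) x),
      K M g x (fun i => α i ∘ₗ (mfderiv (𝓡 4) (𝓡 4) φ x).toLinearMap) Y =
        K N h (φ x) α (fun j => mfderiv (𝓡 4) (𝓡 4) φ x (Y j))

/-- `K` is conformally covariant of weight `s` on the manifold `M`: whenever `g = Θ² g̃` for a
positive smooth function `Θ`, one has `K(g̃) = Θ^s K(g)`. -/
def IsConformallyCovariant {p q : ℕ} (K : TensorAssignment.{u} p q) (s : ℤ)
    (M : Type u) [TopologicalSpace M] [ChartedSpace E4 M] [IsManifold (𝓡 4) ∞ M]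
    [T2Space M] [SecondCountableTopology M] : Prop :=
  ∀ (g g' : NondegenerateMetric M) (Θ : M → ℝ),
    ContMDiff (𝓡 4) 𝓘(ℝ, ℝ) ∞ Θ → (∀ x, 0 < Θ x) →
    (∀ (x : M) (v w : TangentSpace (𝓡 4) x), g.form x v w = Θ x ^ 2 * g'.form x v w) →
    ∀ x : M, K M g' x = Θ x ^ s • K M g x

/-- The conformal pseudo-differential `D^{s,(p,q)} K` of an assignment `K`, with
`(D K)(g) = D_g (K(g))`. -/
def pseudoDiffOf {p q : ℕ} (s : ℤ) (K : TensorAssignment.{u} p q) :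
    TensorAssignment.{u} p (q + 1) :=
  fun M _ _ _ _ _ g => pseudoDiff g s (K M g)

end ConformalConcomitant

end

open ConformalConcomitant

/-! The coefficients of `D` conceal a Weyl connection. Write (s ± r)/r = s/r ± 1. The terms with s/r
come once from each of the r index slots and add up to s Λ_a K. What remains replaces the
Christoffel symbols by Γ^c_{ab} - Λ_a δ_b^c - Λ_b δ_a^c + g_{ab} Λ^c. So D K is the derivative of K
for the connection `weylConn`, plus s Λ_a K (`ConformalConcomitant.pseudoDiffComponents_eq`); here r
≠ 0 is needed.

Covariance follows from one fact: if g' = e^{2ψ} g, then Λ' = Λ + dψ (`IsConformalOn.lam_eq`). The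
shift by dψ is exactly what cancels the change of the Christoffel symbols, so `weylConn` depends
only on the conformal class. If K' = e^{-sψ} K, differentiating the factor yields -s dψ K', which
the change of s Λ absorbs. The hypothesis g = Θ² g̃ is the case ψ = -log Θ with g̃ as the rescaled
metric.

The law for Λ has two sources. Under rescaling the Weyl tensor with lowered indices is multiplied by
e^{2ψ}, while the antisymmetrised derivative of the Schouten tensor changes by -½ C contracted with
grad ψ (`IsConformalOn.cot_eq`). The numerator of Λ therefore acquires a term quadratic in C, and in
dimension four such a contraction is pure trace: C_{da}{}^{mp} C_{mp}{}^{fa} = ¼ δ_d^f C·C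
(`quadratic_identity`). The factor 8 in Λ normalises the resulting ⅛ (C·C) dψ.

That D K is again a concomitant is naturality. In coordinates a local isometry φ intertwines the
Christoffel symbols up to the second derivative of φ, and all curvature tensors exactly. Hence Λ is
a covector and `weylConn` transforms as a connection, and a Leibniz computation over arbitrarily
many index slots (`slot_deriv`) shows that its derivative is tensorial. Applied to the identity map
between two charts, the same statement gives independence of the chart, and with it smoothness: at
each point `pseudoDiff` is defined through the preferred chart of that point. -/

noncomputable section

set_option maxSynthPendingDepth 4

namespace ConformalConcomitant

/-! ### Bundled forms of arrays -/

/-- The standard basis vectors of the model space. -/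
abbrev bv (i : Fin 4) : E4 := EuclideanSpace.single i (1 : ℝ)

lemma bv_apply (i j : Fin 4) : bv i j = if j = i then (1 : ℝ) else 0 := by
  simp [bv]

lemma sum_bv (v : E4) : ∑ i, v i • bv i = v := by
  ext j
  simp [Pi.single_apply]

/-- Curvature expressions are kept as plain functions of vectors, linear in each slot. This reduces
identities between them to basis vectors, one slot at a time, and so links them to index arrays. -/
lemma isLinearMap_ext {F : Type*} [AddCommGroup F] [Module ℝ F] {f g : E4 → F}
    (hf : IsLinearMap ℝ f) (hg : IsLinearMap ℝ g) (h : ∀ i, f (bv i) = g (bv i)) (v : E4) :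
    f v = g v := by
  have : hf.mk' f = hg.mk' g := by
    refine (EuclideanSpace.basisFun (Fin 4) ℝ).toBasis.ext fun i => ?_
    simpa using h i
  exact congrArg (fun l => l v) this

lemma IsLinearMap.sum_smul {F : Type*} [AddCommGroup F] [Module ℝ F] {f : E4 → F}
    (hf : IsLinearMap ℝ f) (v : E4) : f v = ∑ i, v i • f (bv i) := by
  conv_lhs => rw [← sum_bv v]
  have := map_sum (hf.mk' f) (fun i => v i • bv i) Finset.univ
  simp only [map_smul, IsLinearMap.mk'_apply] at this
  exact this

/-- The linear form with given components. -/
def linForm (X : Fin 4 → ℝ) : E4 →L[ℝ] ℝ := ∑ d, X d • EuclideanSpace.proj d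

/-- The bilinear form with given components. -/
def bilin (X : Fin 4 → Fin 4 → ℝ) : E4 →L[ℝ] E4 →L[ℝ] ℝ :=
  ∑ a, ∑ b, X a b • (EuclideanSpace.proj a : E4 →L[ℝ] ℝ).smulRight
    (EuclideanSpace.proj b : E4 →L[ℝ] ℝ)

/-- The vector valued bilinear map with given components. -/
def bilinVec (X : Fin 4 → Fin 4 → Fin 4 → ℝ) : E4 →L[ℝ] E4 →L[ℝ] E4 :=
  ∑ c, ∑ a, ∑ b, X c a b • (EuclideanSpace.proj a : E4 →L[ℝ] ℝ).smulRight
    ((EuclideanSpace.proj b : E4 →L[ℝ] ℝ).smulRight (bv c))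

lemma linForm_apply (X : Fin 4 → ℝ) (u : E4) : linForm X u = ∑ d, X d * u d := by
  simp [linForm]

lemma linForm_bv (X : Fin 4 → ℝ) (d : Fin 4) : linForm X (bv d) = X d := by
  simp [linForm_apply]

lemma bilin_apply (X : Fin 4 → Fin 4 → ℝ) (u v : E4) :
    bilin X u v = ∑ a, ∑ b, X a b * (u a * v b) := by
  simp [bilin]

lemma bilin_bv (X : Fin 4 → Fin 4 → ℝ) (a b : Fin 4) : bilin X (bv a) (bv b) = X a b := by
  simp [bilin_apply]

lemma bilinVec_apply (X : Fin 4 → Fin 4 → Fin 4 → ℝ) (u v : E4) (c : Fin 4) :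
    bilinVec X u v c = ∑ a, ∑ b, X c a b * (u a * v b) := by
  simp [bilinVec, Pi.single_apply]

lemma bilinVec_bv (X : Fin 4 → Fin 4 → Fin 4 → ℝ) (a b c : Fin 4) :
    bilinVec X (bv a) (bv b) c = X c a b := by
  simp [bilinVec_apply]

lemma bilin_eq {X : Fin 4 → Fin 4 → ℝ} {B : E4 → E4 → ℝ}
    (h₁ : ∀ v, IsLinearMap ℝ fun u => B u v) (h₂ : ∀ u, IsLinearMap ℝ (B u))
    (h : ∀ a b, X a b = B (bv a) (bv b)) (u v : E4) : bilin X u v = B u v := by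
  refine isLinearMap_ext (f := fun u => bilin X u v) ?_ (h₁ v) (fun a => ?_) u
  · constructor <;> intros <;> simp
  · refine isLinearMap_ext (f := fun v => bilin X (bv a) v) ?_ (h₂ _) (fun b => ?_) v
    · constructor <;> intros <;> simp
    · simp only [bilin_bv, h]

/-! ### Smoothness and derivative rules on open sets of the model space. -/

section Smooth

variable {U : Set E4}

lemma contDiffOn_bilin {X : E4 → Fin 4 → Fin 4 → ℝ}
    (h : ∀ a b, ContDiffOn ℝ ∞ (fun z => X z a b) U) :
    ContDiffOn ℝ ∞ (fun z => bilin (X z)) U :=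
  ContDiffOn.sum fun a _ => ContDiffOn.sum fun b _ => (h a b).smul contDiffOn_const

lemma contDiffOn_bilinVec {X : E4 → Fin 4 → Fin 4 → Fin 4 → ℝ}
    (h : ∀ c a b, ContDiffOn ℝ ∞ (fun z => X z c a b) U) :
    ContDiffOn ℝ ∞ (fun z => bilinVec (X z)) U :=
  ContDiffOn.sum fun c _ => ContDiffOn.sum fun a _ => ContDiffOn.sum fun b _ =>
    (h c a b).smul contDiffOn_const

lemma ContDiffOn.differentiableAt_of_isOpen {F : Type*} [NormedAddCommGroup F] [NormedSpace ℝ F]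
    {f : E4 → F} (h : ContDiffOn ℝ ∞ f U) (hU : IsOpen U) {z : E4} (hz : z ∈ U) :
    DifferentiableAt ℝ f z :=
  (h.contDiffAt (hU.mem_nhds hz)).differentiableAt (by simp)

lemma contDiffOn_fderiv {F : Type*} [NormedAddCommGroup F] [NormedSpace ℝ F]
    {f : E4 → F} (h : ContDiffOn ℝ ∞ f U) (hU : IsOpen U) : ContDiffOn ℝ ∞ (fderiv ℝ f) U :=
  h.fderiv_of_isOpen hU (by simp)

lemma contDiffOn_pderiv {f : E4 → ℝ} (h : ContDiffOn ℝ ∞ f U) (hU : IsOpen U) (a : Fin 4) :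
    ContDiffOn ℝ ∞ (fun z => pderiv a f z) U :=
  (contDiffOn_fderiv h hU).clm_apply contDiffOn_const

/-- With vector-valued `f` this also serves for third derivatives: taking `f` to be a first
derivative exchanges the two outermost directions. -/
lemma fderiv_fderiv_comm {F : Type*} [NormedAddCommGroup F] [NormedSpace ℝ F]
    {f : E4 → F} (h : ContDiffOn ℝ ∞ f U) (hU : IsOpen U) {z : E4} (hz : z ∈ U) (u v : E4) :
    fderiv ℝ (fderiv ℝ f) z u v = fderiv ℝ (fderiv ℝ f) z v u :=
  (h.contDiffAt (hU.mem_nhds hz)).isSymmSndFDerivAt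
    (by simp only [minSmoothness_of_isRCLikeNormedField]; exact WithTop.coe_le_coe.2 le_top) u v

lemma pderiv_congr {f g : E4 → ℝ} (hU : IsOpen U) (h : ∀ y ∈ U, f y = g y) {z : E4} (hz : z ∈ U)
    (a : Fin 4) : pderiv a f z = pderiv a g z := by
  unfold pderiv
  rw [Filter.EventuallyEq.fderiv_eq (Filter.eventuallyEq_of_mem (hU.mem_nhds hz) h)]

lemma fderiv_congr_of_isOpen {F : Type*} [NormedAddCommGroup F] [NormedSpace ℝ F] {f g : E4 → F}
    (hU : IsOpen U) (h : ∀ y ∈ U, f y = g y) {z : E4} (hz : z ∈ U) :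
    fderiv ℝ f z = fderiv ℝ g z :=
  Filter.EventuallyEq.fderiv_eq (Filter.eventuallyEq_of_mem (hU.mem_nhds hz) h)

end Smooth

lemma fderiv_clm_apply₁ {F H : Type*} [NormedAddCommGroup F] [NormedSpace ℝ F]
    [NormedAddCommGroup H] [NormedSpace ℝ H] {c : E4 → F →L[ℝ] H} {u : E4 → F} {z : E4}
    (hc : DifferentiableAt ℝ c z) (hu : DifferentiableAt ℝ u z) (w : E4) :
    fderiv ℝ (fun y => c y (u y)) z w = c z (fderiv ℝ u z w) + fderiv ℝ c z w (u z) := by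
  rw [fderiv_clm_apply hc hu]
  simp

lemma fderiv_clm_apply₂ {F F' H : Type*} [NormedAddCommGroup F] [NormedSpace ℝ F]
    [NormedAddCommGroup F'] [NormedSpace ℝ F'] [NormedAddCommGroup H] [NormedSpace ℝ H]
    {c : E4 → F →L[ℝ] F' →L[ℝ] H} {u : E4 → F} {v : E4 → F'} {z : E4}
    (hc : DifferentiableAt ℝ c z) (hu : DifferentiableAt ℝ u z) (hv : DifferentiableAt ℝ v z)
    (w : E4) :
    fderiv ℝ (fun y => c y (u y) (v y)) z w =
      fderiv ℝ c z w (u z) (v z) + c z (fderiv ℝ u z w) (v z) + c z (u z) (fderiv ℝ v z w) := by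
  rw [fderiv_clm_apply₁ (c := fun y => c y (u y)) (hc.clm_apply hu) hv,
    fderiv_clm_apply₁ hc hu]
  simp only [add_apply]
  abel

lemma fderiv_clm_const₂ {F F' H : Type*} [NormedAddCommGroup F] [NormedSpace ℝ F]
    [NormedAddCommGroup F'] [NormedSpace ℝ F'] [NormedAddCommGroup H] [NormedSpace ℝ H]
    {c : E4 → F →L[ℝ] F' →L[ℝ] H} {z : E4} (hc : DifferentiableAt ℝ c z) (u : F) (v : F')
    (w : E4) : fderiv ℝ (fun y => c y u v) z w = fderiv ℝ c z w u v := by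
  rw [fderiv_clm_apply₂ hc (differentiableAt_const u) (differentiableAt_const v)]
  simp

/-! ### Metrics on open sets of the model space -/

/-- `G` is the component matrix of a smooth pseudo-Riemannian metric on the open set `U`. -/
structure IsMetricOn (G : E4 → Matrix (Fin 4) (Fin 4) ℝ) (U : Set E4) : Prop where
  isOpen : IsOpen U
  symm : ∀ z ∈ U, ∀ a b, G z a b = G z b a
  det : ∀ z ∈ U, IsUnit (G z).det
  smooth : ∀ a b, ContDiffOn ℝ ∞ (fun z => G z a b) U

/-- The metric as a bilinear form. -/
def met (G : E4 → Matrix (Fin 4) (Fin 4) ℝ) (z : E4) : E4 →L[ℝ] E4 →L[ℝ] ℝ :=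
  bilin fun a b => G z a b

/-- The Christoffel symbols as a bilinear map. -/
def chr (G : E4 → Matrix (Fin 4) (Fin 4) ℝ) (z : E4) : E4 →L[ℝ] E4 →L[ℝ] E4 :=
  bilinVec (christoffel G z)

/-- The curvature `R_{abc}{}^d u^a v^b w^c`. -/
def curv (G : E4 → Matrix (Fin 4) (Fin 4) ℝ) (z u v w : E4) : E4 :=
  fderiv ℝ (chr G) z v u w - fderiv ℝ (chr G) z u v w + chr G z v (chr G z u w)
    - chr G z u (chr G z v w)

/-! ### Smoothness of the inverse metric, the connection, the curvature tensors and Λ. -/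

namespace IsMetricOn

variable {G : E4 → Matrix (Fin 4) (Fin 4) ℝ} {U : Set E4} (h : IsMetricOn G U)
include h

lemma smooth_det : ContDiffOn ℝ ∞ (fun z => (G z).det) U := by
  simp only [Matrix.det_apply]
  refine ContDiffOn.sum fun σ _ => ContDiffOn.const_smul _ (contDiffOn_prod fun i _ => h.smooth _ _)

lemma smooth_inv (a b : Fin 4) : ContDiffOn ℝ ∞ (fun z => invMetric G z a b) U := by
  have : ∀ z ∈ U, invMetric G z a b = ((G z).det)⁻¹ * (G z).adjugate a b := by
    intro z hz
    simp [invMetric, Matrix.inv_def, Ring.inverse_eq_inv']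
  refine ContDiffOn.congr ?_ this
  refine (h.smooth_det.inv fun z hz => (h.det z hz).ne_zero).mul ?_
  simp only [Matrix.adjugate_apply, Matrix.det_apply]
  refine ContDiffOn.sum fun σ _ => ContDiffOn.const_smul _ (contDiffOn_prod fun i _ => ?_)
  -- An adjugate entry is the determinant of the matrix with row `b` replaced by a constant basis
  -- row, so each factor is a constant or a metric coefficient.
  by_cases hb : σ i = b
  · simp only [hb, Matrix.updateRow_self]
    exact contDiffOn_const
  · simp only [Matrix.updateRow_ne hb]
    exact h.smooth _ _

lemma smooth_christoffel (c a b : Fin 4) :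
    ContDiffOn ℝ ∞ (fun z => christoffel G z c a b) U := by
  unfold christoffel
  refine contDiffOn_const.mul (ContDiffOn.sum fun d _ => (h.smooth_inv _ _).mul ?_)
  exact ((contDiffOn_pderiv (h.smooth _ _) h.isOpen _).add
    (contDiffOn_pderiv (h.smooth _ _) h.isOpen _)).sub
    (contDiffOn_pderiv (h.smooth _ _) h.isOpen _)

lemma smooth_riemann (a b c d : Fin 4) :
    ContDiffOn ℝ ∞ (fun z => riemann G z a b c d) U := by
  unfold riemann
  refine ((contDiffOn_pderiv (h.smooth_christoffel _ _ _) h.isOpen _).sub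
    (contDiffOn_pderiv (h.smooth_christoffel _ _ _) h.isOpen _)).add
    (ContDiffOn.sum fun e _ => ?_)
  exact ((h.smooth_christoffel _ _ _).mul (h.smooth_christoffel _ _ _)).sub
    ((h.smooth_christoffel _ _ _).mul (h.smooth_christoffel _ _ _))

lemma smooth_ricci (a b : Fin 4) : ContDiffOn ℝ ∞ (fun z => ricci G z a b) U :=
  ContDiffOn.sum fun _ _ => h.smooth_riemann _ _ _ _

lemma smooth_scalarCurv : ContDiffOn ℝ ∞ (fun z => scalarCurv G z) U :=
  ContDiffOn.sum fun _ _ => ContDiffOn.sum fun _ _ => (h.smooth_inv _ _).mul (h.smooth_ricci _ _)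

lemma smooth_schouten (a b : Fin 4) : ContDiffOn ℝ ∞ (fun z => schouten G z a b) U :=
  contDiffOn_const.mul ((h.smooth_ricci _ _).sub
    ((contDiffOn_const.mul h.smooth_scalarCurv).mul (h.smooth _ _)))

lemma smooth_schoutenUp (a b : Fin 4) : ContDiffOn ℝ ∞ (fun z => schoutenUp G z a b) U :=
  ContDiffOn.sum fun _ _ => (h.smooth_inv _ _).mul (h.smooth_schouten _ _)

lemma smooth_weyl (a b c d : Fin 4) : ContDiffOn ℝ ∞ (fun z => weyl G z a b c d) U :=
  ((h.smooth_riemann _ _ _ _).sub (((h.smooth_schoutenUp _ _).mul (h.smooth _ _)).sub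
    ((h.smooth_schoutenUp _ _).mul (h.smooth _ _)))).sub
    ((contDiffOn_const.mul (h.smooth_schouten _ _)).sub
      (contDiffOn_const.mul (h.smooth_schouten _ _)))

lemma smooth_weylDown (a b c d : Fin 4) : ContDiffOn ℝ ∞ (fun z => weylDown G z a b c d) U :=
  ContDiffOn.sum fun _ _ => (h.smooth_weyl _ _ _ _).mul (h.smooth _ _)

lemma smooth_weylUp (a b c d : Fin 4) : ContDiffOn ℝ ∞ (fun z => weylUp G z a b c d) U :=
  ContDiffOn.sum fun _ _ => ContDiffOn.sum fun _ _ => ContDiffOn.sum fun _ _ =>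
    (((h.smooth_weylDown _ _ _ _).mul (h.smooth_inv _ _)).mul (h.smooth_inv _ _)).mul
      (h.smooth_inv _ _)

lemma smooth_weylSq : ContDiffOn ℝ ∞ (fun z => weylSq G z) U :=
  ContDiffOn.sum fun _ _ => ContDiffOn.sum fun _ _ => ContDiffOn.sum fun _ _ =>
    ContDiffOn.sum fun _ _ => (h.smooth_weylDown _ _ _ _).mul
      (ContDiffOn.sum fun _ _ => (h.smooth_inv _ _).mul (h.smooth_weylUp _ _ _ _))

lemma smooth_covDeriv {p q : ℕ} {T : E4 → (Fin p → Fin 4) → (Fin q → Fin 4) → ℝ}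
    (hT : ∀ A B, ContDiffOn ℝ ∞ (fun z => T z A B) U) (a : Fin 4) (A : Fin p → Fin 4)
    (B : Fin q → Fin 4) : ContDiffOn ℝ ∞ (fun z => covDeriv G T z a A B) U :=
  ((contDiffOn_pderiv (hT _ _) h.isOpen _).add
    (ContDiffOn.sum fun _ _ => ContDiffOn.sum fun _ _ =>
      (h.smooth_christoffel _ _ _).mul (hT _ _))).sub
    (ContDiffOn.sum fun _ _ => ContDiffOn.sum fun _ _ =>
      (h.smooth_christoffel _ _ _).mul (hT _ _))

lemma smooth_schoutenCurl (m p a : Fin 4) :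
    ContDiffOn ℝ ∞ (fun z => schoutenCurl G z m p a) U :=
  contDiffOn_const.mul
    ((h.smooth_covDeriv (fun _ _ => h.smooth_schouten _ _) _ _ _).sub
      (h.smooth_covDeriv (fun _ _ => h.smooth_schouten _ _) _ _ _))

lemma smooth_lam (hW : ∀ z ∈ U, weylSq G z ≠ 0) (d : Fin 4) :
    ContDiffOn ℝ ∞ (fun z => lam G z d) U :=
  (contDiffOn_const.mul (ContDiffOn.sum fun _ _ => ContDiffOn.sum fun _ _ =>
    ContDiffOn.sum fun _ _ => (h.smooth_weylUp _ _ _ _).mul (h.smooth_schoutenCurl _ _ _))).div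
    h.smooth_weylSq hW

lemma smooth_met : ContDiffOn ℝ ∞ (met G) U := contDiffOn_bilin fun _ _ => h.smooth _ _

lemma smooth_chr : ContDiffOn ℝ ∞ (chr G) U :=
  contDiffOn_bilinVec fun _ _ _ => h.smooth_christoffel _ _ _

end IsMetricOn

/-! ### The Levi-Civita connection and the symmetries of its curvature -/

lemma met_bv (G : E4 → Matrix (Fin 4) (Fin 4) ℝ) (z : E4) (a b : Fin 4) :
    met G z (bv a) (bv b) = G z a b := bilin_bv _ _ _

lemma chr_bv (G : E4 → Matrix (Fin 4) (Fin 4) ℝ) (z : E4) (a b c : Fin 4) :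
    chr G z (bv a) (bv b) c = christoffel G z c a b := bilinVec_bv _ _ _ _

namespace IsMetricOn

variable {G : E4 → Matrix (Fin 4) (Fin 4) ℝ} {U : Set E4} (h : IsMetricOn G U)
  {z : E4} (hz : z ∈ U)
include h hz

lemma diff_met : DifferentiableAt ℝ (met G) z :=
  ContDiffOn.differentiableAt_of_isOpen h.smooth_met h.isOpen hz

lemma diff_chr : DifferentiableAt ℝ (chr G) z :=
  ContDiffOn.differentiableAt_of_isOpen h.smooth_chr h.isOpen hz

lemma met_symm (u v : E4) : met G z u v = met G z v u := by
  simp only [met, bilin_apply]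
  rw [Finset.sum_comm]
  refine Finset.sum_congr rfl fun a _ => Finset.sum_congr rfl fun b _ => ?_
  rw [h.symm z hz a b]
  ring

lemma sum_inv_mul (a b : Fin 4) :
    ∑ c, invMetric G z a c * G z c b = if a = b then 1 else 0 := by
  have := Matrix.nonsing_inv_mul (G z) (h.det z hz)
  have := congrFun (congrFun this a) b
  rwa [Matrix.mul_apply, Matrix.one_apply] at this

lemma sum_mul_inv (a b : Fin 4) :
    ∑ c, G z a c * invMetric G z c b = if a = b then 1 else 0 := by
  have := Matrix.mul_nonsing_inv (G z) (h.det z hz)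
  have := congrFun (congrFun this a) b
  rwa [Matrix.mul_apply, Matrix.one_apply] at this

lemma inv_symm (a b : Fin 4) : invMetric G z a b = invMetric G z b a := by
  have h1 : (G z).transpose = G z := by
    ext i j
    exact h.symm z hz j i
  have := Matrix.transpose_nonsing_inv (G z)
  rw [h1] at this
  exact (congrFun (congrFun this b) a)

lemma met_nondeg {x : E4} (hx : ∀ w, met G z x w = 0) : x = 0 := by
  ext a
  have h1 : ∀ b, ∑ c, x c * G z c b = 0 := by
    intro b
    have := hx (bv b)
    simpa [met, bilin_apply, mul_comm] using this
  calc x a = ∑ c, x c * (if c = a then 1 else 0) := by simp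
    _ = ∑ c, x c * ∑ b, G z c b * invMetric G z b a := by simp only [h.sum_mul_inv hz]
    _ = ∑ b, (∑ c, x c * G z c b) * invMetric G z b a := by
      simp only [Finset.mul_sum, Finset.sum_mul]
      rw [Finset.sum_comm]
      simp only [mul_assoc]
    _ = 0 := by simp [h1]

/-- Vector identities are proved below by pairing with an arbitrary vector, which keeps the inverse
metric out of the computations. -/
lemma met_ext {x y : E4} (hx : ∀ w, met G z x w = met G z y w) : x = y := by
  rw [← sub_eq_zero]
  refine h.met_nondeg hz fun w => ?_
  rw [map_sub, sub_apply, hx, sub_self]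

lemma met_inv_sum (X : Fin 4 → ℝ) (w : E4) :
    met G z (∑ c, (∑ d, invMetric G z c d * X d) • bv c) w = ∑ d, X d * w d := by
  refine isLinearMap_ext (f := fun w => met G z (∑ c, (∑ d, invMetric G z c d * X d) • bv c) w)
    (g := fun w => ∑ d, X d * w d) ?_ ?_ (fun b => ?_) w
  · constructor <;> intros <;> simp only [map_add, map_smul]
  · constructor <;> intros <;> simp [mul_add, Finset.sum_add_distrib, Finset.mul_sum, mul_left_comm]
  · simp only [map_sum, map_smul, sum_apply, smul_apply, met_bv, smul_eq_mul, Finset.sum_mul]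
    rw [Finset.sum_comm]
    have : ∀ d, ∑ c, invMetric G z c d * X d * G z c b = X d * if d = b then 1 else 0 := by
      intro d
      rw [← h.sum_inv_mul hz, Finset.mul_sum]
      refine Finset.sum_congr rfl fun c _ => ?_
      rw [h.inv_symm hz c d]
      ring
    simp only [this, bv_apply]

lemma pderiv_met (a b c : Fin 4) :
    pderiv a (fun y => G y b c) z = fderiv ℝ (met G) z (bv a) (bv b) (bv c) := by
  rw [← fderiv_clm_const₂ (h.diff_met hz)]
  simp only [met_bv, pderiv]

/-- The inverse metric in the Christoffel symbols cancels when the upper index is lowered. This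
characterises `chr` and is the form in which it is used from here on. -/
lemma koszul (u v w : E4) :
    met G z (chr G z u v) w = 1 / 2 * (fderiv ℝ (met G) z u w v + fderiv ℝ (met G) z v w u
      - fderiv ℝ (met G) z w u v) := by
  refine isLinearMap_ext (f := fun u => met G z (chr G z u v) w)
    (g := fun u => 1 / 2 * (fderiv ℝ (met G) z u w v + fderiv ℝ (met G) z v w u
      - fderiv ℝ (met G) z w u v)) ?_ ?_ (fun a => ?_) u
  iterate 2 constructor <;> intros <;> simp <;> ring
  refine isLinearMap_ext (f := fun v => met G z (chr G z (bv a) v) w)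
    (g := fun v => 1 / 2 * (fderiv ℝ (met G) z (bv a) w v + fderiv ℝ (met G) z v w (bv a)
      - fderiv ℝ (met G) z w (bv a) v)) ?_ ?_ (fun b => ?_) v
  iterate 2 constructor <;> intros <;> simp <;> ring
  have : chr G z (bv a) (bv b) = ∑ c, (∑ d, invMetric G z c d * (1 / 2 *
      (pderiv a (fun y => G y d b) z + pderiv b (fun y => G y d a) z
        - pderiv d (fun y => G y a b) z))) • bv c := by
    rw [← sum_bv (chr G z (bv a) (bv b))]
    refine Finset.sum_congr rfl fun c _ => ?_
    rw [chr_bv, christoffel, Finset.mul_sum]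
    congr 1
    exact Finset.sum_congr rfl fun d _ => by ring
  simp only [this, h.met_inv_sum hz, h.pderiv_met hz]
  refine (IsLinearMap.sum_smul (f := fun w => 1 / 2 * (fderiv ℝ (met G) z (bv a) w (bv b)
    + fderiv ℝ (met G) z (bv b) w (bv a)
      - fderiv ℝ (met G) z w (bv a) (bv b))) ?_ w).trans ?_ |>.symm
  · constructor <;> intros <;> simp <;> ring
  · exact Finset.sum_congr rfl fun d _ => by rw [smul_eq_mul]; ring

lemma fderiv_met_symm (w u v : E4) :
    fderiv ℝ (met G) z w u v = fderiv ℝ (met G) z w v u := by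
  rw [← fderiv_clm_const₂ (h.diff_met hz), ← fderiv_clm_const₂ (h.diff_met hz),
    fderiv_congr_of_isOpen h.isOpen (fun y hy => h.met_symm hy u v) hz]

lemma chr_symm (u v : E4) : chr G z u v = chr G z v u := by
  refine h.met_ext hz fun w => ?_
  rw [h.koszul hz, h.koszul hz, h.fderiv_met_symm hz w u v]
  ring

lemma compat (w u v : E4) :
    fderiv ℝ (met G) z w u v = met G z (chr G z w u) v + met G z u (chr G z w v) := by
  rw [h.met_symm hz u, h.koszul hz, h.koszul hz, h.fderiv_met_symm hz w u v,
    h.fderiv_met_symm hz u w v, h.fderiv_met_symm hz v w u]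
  ring

lemma fderiv_chr_symm (w u v : E4) :
    fderiv ℝ (chr G) z w u v = fderiv ℝ (chr G) z w v u := by
  rw [← fderiv_clm_const₂ (h.diff_chr hz), ← fderiv_clm_const₂ (h.diff_chr hz),
    fderiv_congr_of_isOpen h.isOpen (fun y hy => h.chr_symm hy u v) hz]

/-- The convention fixes the curvature through its action on covectors, so `curv` is the negative of
the usual R(u,v)w. -/
lemma riemann_eq (a b c d : Fin 4) :
    riemann G z a b c d = curv G z (bv a) (bv b) (bv c) d := by
  have hp : ∀ i j k l : Fin 4, pderiv i (fun y => christoffel G y j k l) z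
      = fderiv ℝ (chr G) z (bv i) (bv k) (bv l) j := by
    intro i j k l
    have h1 : pderiv i (fun y => christoffel G y j k l) z
        = fderiv ℝ (fun y => (EuclideanSpace.proj j : E4 →L[ℝ] ℝ) (chr G y (bv k) (bv l))) z
          (bv i) := by
      simp [pderiv, ← chr_bv]
    rw [h1, fderiv_clm_apply₁ (differentiableAt_const _)
      ((((h.diff_chr hz).clm_apply (differentiableAt_const _)).clm_apply
        (differentiableAt_const _))), fderiv_clm_const₂ (h.diff_chr hz)]
    simp
  have hc : ∀ a b c d : Fin 4, chr G z (bv b) (chr G z (bv a) (bv c)) d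
      = ∑ e, christoffel G z e a c * christoffel G z d b e := by
    intro a b c d
    conv_lhs => rw [← sum_bv (chr G z (bv a) (bv c))]
    simp only [map_sum, map_smul, chr_bv, WithLp.ofLp_sum, Finset.sum_apply,
      smul_eq_mul, WithLp.ofLp_smul, Pi.smul_apply]
  simp only [riemann, curv, PiLp.sub_apply, PiLp.add_apply, hp, hc, Finset.sum_sub_distrib]
  ring

omit h hz in
lemma _root_.ConformalConcomitant.curv_antisymm (u v w : E4) :
    curv G z u v w = - curv G z v u w := by
  simp only [curv]
  abel

lemma bianchi (u v w : E4) : curv G z u v w + curv G z v w u + curv G z w u v = 0 := by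
  simp only [curv, h.fderiv_chr_symm hz v u w, h.fderiv_chr_symm hz u v w,
    h.fderiv_chr_symm hz w v u, h.chr_symm hz v w, h.chr_symm hz u w, h.chr_symm hz u v]
  abel

/-- Differentiating metric compatibility once more expresses the second derivative of the metric by
Christoffel terms. Its symmetry in the two directions leaves precisely this identity. -/
lemma met_curv_antisymm (u v w x : E4) :
    met G z (curv G z u v w) x = - met G z w (curv G z u v x) := by
  have key : ∀ t s : E4, fderiv ℝ (fderiv ℝ (met G)) z t s w x
      = met G z (chr G z t (chr G z s w)) x + met G z (chr G z s w) (chr G z t x)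
        + met G z (fderiv ℝ (chr G) z t s w) x
        + (met G z (chr G z t w) (chr G z s x) + met G z w (chr G z t (chr G z s x))
        + met G z w (fderiv ℝ (chr G) z t s x)) := by
    intro t s
    have d2 : DifferentiableAt ℝ (fderiv ℝ (met G)) z :=
      ContDiffOn.differentiableAt_of_isOpen (contDiffOn_fderiv h.smooth_met h.isOpen) h.isOpen hz
    have dc : ∀ s w : E4, DifferentiableAt ℝ (fun y => chr G y s w) z := fun s w =>
      ((h.diff_chr hz).clm_apply (differentiableAt_const _)).clm_apply (differentiableAt_const _)
    have e1 : fderiv ℝ (fun y => fderiv ℝ (met G) y s w x) z t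
        = fderiv ℝ (fderiv ℝ (met G)) z t s w x := by
      rw [fderiv_clm_const₂ (d2.clm_apply (differentiableAt_const s)),
        fderiv_clm_apply₁ d2 (differentiableAt_const s)]
      simp
    rw [← e1, fderiv_congr_of_isOpen h.isOpen (fun y hy => h.compat hy s w x) hz]
    rw [fderiv_fun_add (((h.diff_met hz).clm_apply (dc _ _)).clm_apply (differentiableAt_const _))
      (((h.diff_met hz).clm_apply (differentiableAt_const _)).clm_apply (dc _ _)), add_apply,
      fderiv_clm_apply₂ (h.diff_met hz) (dc _ _) (differentiableAt_const _),
      fderiv_clm_apply₂ (h.diff_met hz) (differentiableAt_const _) (dc _ _),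
      fderiv_clm_const₂ (h.diff_chr hz), fderiv_clm_const₂ (h.diff_chr hz),
      h.compat hz, h.compat hz]
    simp
  have hs := fderiv_fderiv_comm h.smooth_met h.isOpen hz u v
  have hs' : fderiv ℝ (fderiv ℝ (met G)) z u v w x = fderiv ℝ (fderiv ℝ (met G)) z v u w x := by
    rw [hs]
  rw [key, key] at hs'
  simp only [curv, map_sub, map_add, sub_apply, add_apply]
  linarith

/-- The classical argument: four Bianchi identities, one for each cyclic rotation of the arguments,
combine with the two antisymmetries. -/
lemma curv_pair_symm (u v w x : E4) :
    met G z (curv G z u v w) x = met G z (curv G z w x u) v := by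
  have B : ∀ u v w x, met G z (curv G z u v w) x + met G z (curv G z v w u) x
      + met G z (curv G z w u v) x = 0 := by
    intro u v w x
    rw [← add_apply, ← add_apply, ← map_add, ← map_add, h.bianchi hz]
    simp
  have A : ∀ u v w x, met G z (curv G z u v w) x = - met G z (curv G z v u w) x := by
    intro u v w x
    rw [curv_antisymm]
    simp
  have M : ∀ u v w x, met G z (curv G z u v w) x = - met G z (curv G z u v x) w := by
    intro u v w x
    rw [h.met_curv_antisymm hz, h.met_symm hz]
  have b1 := B u v w x
  have b2 := B v w x u
  have b3 := B w x u v
  have b4 := B x u v w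
  have := M u v w x
  have := M v w u x
  have := M w x v u
  have := M x u w v
  have := M u w x v
  have := A u w v x
  have := M x v w u
  have := A x v u w
  linarith

omit h hz in
lemma _root_.ConformalConcomitant.curv_linear₁ (v w : E4) :
    IsLinearMap ℝ (fun u => curv G z u v w) := by
  constructor <;> intros <;> simp only [curv, map_add, map_smul, add_apply, smul_apply, smul_sub,
    smul_add]
  all_goals abel

omit h hz in
lemma _root_.ConformalConcomitant.curv_linear₂ (u w : E4) :
    IsLinearMap ℝ (fun v => curv G z u v w) := by
  constructor <;> intros <;> simp only [curv, map_add, map_smul, add_apply, smul_apply, smul_sub,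
    smul_add]
  all_goals abel

omit h hz in
lemma _root_.ConformalConcomitant.curv_linear₃ (u v : E4) :
    IsLinearMap ℝ (fun w => curv G z u v w) := by
  constructor <;> intros <;> simp only [curv, map_add, map_smul, smul_sub, smul_add]
  all_goals abel

end IsMetricOn

/-! ### Contractions and the curvature tensors as multilinear functions -/

variable (G : E4 → Matrix (Fin 4) (Fin 4) ℝ) (z : E4)

/-- The contraction of a bilinear form with the contravariant metric. -/
def contr (B : E4 → E4 → ℝ) : ℝ := ∑ a, ∑ b, invMetric G z a b * B (bv a) (bv b)

/-- The Ricci tensor as a bilinear form. -/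
def ric (u w : E4) : ℝ := contr G z fun x y => met G z (curv G z u x w) y

/-- The Schouten tensor as a bilinear form. -/
def sch (z : E4) : E4 →L[ℝ] E4 →L[ℝ] ℝ := bilin fun a b => schouten G z a b

/-- The covariant Weyl tensor as a quadrilinear form. -/
def weylForm (u v w x : E4) : ℝ :=
  met G z (curv G z u v w) x - (sch G z x v * met G z u w - sch G z x u * met G z v w)
    - (met G z v x * sch G z u w - met G z u x * sch G z v w)

/-- The antisymmetrised derivative of the Schouten tensor as a trilinear form. -/
def cot (u v w : E4) : ℝ :=
  1 / 2 * (fderiv ℝ (sch G) z u v w - fderiv ℝ (sch G) z v u w - sch G z v (chr G z u w)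
    + sch G z u (chr G z v w))

/-- The contraction `C_d{}^{amp} ∇_{[m} L_{p]a} u^d`. -/
def lamNum (u : E4) : ℝ :=
  contr G z fun a a' => contr G z fun m m' => contr G z fun p p' =>
    weylForm G z u a m p * cot G z m' p' a'

variable {G z}

lemma contr_isLinearMap {B : E4 → E4 → E4 → ℝ} (hB : ∀ a b, IsLinearMap ℝ fun u => B u a b) :
    IsLinearMap ℝ fun u => contr G z (B u) := by
  constructor <;> intros
  · simp only [contr, (hB _ _).map_add, mul_add, Finset.sum_add_distrib]
  · simp only [contr, (hB _ _).map_smul, smul_eq_mul, Finset.mul_sum, mul_left_comm]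

lemma contr_add (B B' : E4 → E4 → ℝ) :
    contr G z (fun u v => B u v + B' u v) = contr G z B + contr G z B' := by
  simp only [contr, mul_add, Finset.sum_add_distrib]

lemma contr_sub (B B' : E4 → E4 → ℝ) :
    contr G z (fun u v => B u v - B' u v) = contr G z B - contr G z B' := by
  simp only [contr, mul_sub, Finset.sum_sub_distrib]

lemma contr_mul (c : ℝ) (B : E4 → E4 → ℝ) :
    contr G z (fun u v => c * B u v) = c * contr G z B := by
  simp only [contr, Finset.mul_sum, mul_left_comm]

lemma sum_move₂ {α : Type*} [Fintype α] (F : α → α → α → ℝ) :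
    ∑ a, ∑ b, ∑ c, F a b c = ∑ c, ∑ a, ∑ b, F a b c := by
  conv_rhs => rw [Finset.sum_comm]
  exact Finset.sum_congr rfl fun a _ => Finset.sum_comm

lemma sum_move₃ {α : Type*} [Fintype α] (F : α → α → α → α → ℝ) :
    ∑ a, ∑ b, ∑ c, ∑ d, F a b c d = ∑ d, ∑ a, ∑ b, ∑ c, F a b c d := by
  conv_rhs => rw [Finset.sum_comm]
  exact Finset.sum_congr rfl fun a _ => sum_move₂ _

lemma weylForm_linear₁ (v w x : E4) : IsLinearMap ℝ fun u => weylForm G z u v w x := by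
  constructor <;> intros <;> simp only [weylForm, curv_linear₁ .. |>.map_add,
    curv_linear₁ .. |>.map_smul, map_add, map_smul, add_apply, smul_apply, smul_eq_mul] <;> ring

lemma weylForm_linear₂ (u w x : E4) : IsLinearMap ℝ fun v => weylForm G z u v w x := by
  constructor <;> intros <;> simp only [weylForm, curv_linear₂ .. |>.map_add,
    curv_linear₂ .. |>.map_smul, map_add, map_smul, add_apply, smul_apply, smul_eq_mul] <;> ring

lemma weylForm_linear₃ (u v x : E4) : IsLinearMap ℝ fun w => weylForm G z u v w x := by
  constructor <;> intros <;> simp only [weylForm, curv_linear₃ .. |>.map_add,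
    curv_linear₃ .. |>.map_smul, map_add, map_smul, add_apply, smul_apply, smul_eq_mul] <;> ring

lemma weylForm_linear₄ (u v w : E4) : IsLinearMap ℝ fun x => weylForm G z u v w x := by
  constructor <;> intros <;> simp only [weylForm, map_add, map_smul, add_apply, smul_apply,
    smul_eq_mul] <;> ring

lemma cot_linear₁ (v w : E4) : IsLinearMap ℝ fun u => cot G z u v w := by
  constructor <;> intros <;> simp only [cot, map_add, map_smul, add_apply, smul_apply,
    smul_eq_mul] <;> ring

lemma cot_linear₂ (u w : E4) : IsLinearMap ℝ fun v => cot G z u v w := by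
  constructor <;> intros <;> simp only [cot, map_add, map_smul, add_apply, smul_apply,
    smul_eq_mul] <;> ring

lemma cot_linear₃ (u v : E4) : IsLinearMap ℝ fun w => cot G z u v w := by
  constructor <;> intros <;> simp only [cot, map_add, map_smul, smul_eq_mul] <;> ring

lemma ric_linear₁ (w : E4) : IsLinearMap ℝ fun u => ric G z u w := by
  refine contr_isLinearMap fun a b => ?_
  constructor <;> intros <;> simp only [curv_linear₁ .. |>.map_add,
    curv_linear₁ .. |>.map_smul, map_add, map_smul, add_apply, smul_apply]

lemma ric_linear₂ (u : E4) : IsLinearMap ℝ fun w => ric G z u w := by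
  refine contr_isLinearMap fun a b => ?_
  constructor <;> intros <;> simp only [curv_linear₃ .. |>.map_add,
    curv_linear₃ .. |>.map_smul, map_add, map_smul, add_apply, smul_apply]

/-! ### Index expressions identified with multilinear forms. -/

namespace IsMetricOn

variable {U : Set E4} (h : IsMetricOn G U) (hz : z ∈ U)
include h hz

/-- Lowering and then raising an index changes nothing. This turns the trace of an endomorphism, as
in the Ricci tensor, into a metric contraction of a bilinear form. -/
lemma apply_eq (x : E4) (b : Fin 4) : x b = ∑ l, invMetric G z b l * met G z x (bv l) := by
  have h1 : ∀ l, met G z x (bv l) = ∑ k, x k * G z k l := by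
    intro l
    conv_lhs => rw [← sum_bv x]
    simp only [map_sum, map_smul, sum_apply, smul_apply, met_bv, smul_eq_mul]
  simp only [h1, Finset.mul_sum]
  rw [Finset.sum_comm]
  have : ∀ k, ∑ l, invMetric G z b l * (x k * G z k l) = x k * if b = k then 1 else 0 := by
    intro k
    rw [← h.sum_inv_mul hz, Finset.mul_sum]
    refine Finset.sum_congr rfl fun l _ => ?_
    rw [h.symm z hz k l]
    ring
  simp [this]

lemma ricci_eq (a c : Fin 4) : ricci G z a c = ric G z (bv a) (bv c) := by
  unfold ricci ric contr
  refine Finset.sum_congr rfl fun b _ => ?_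
  rw [h.riemann_eq hz, h.apply_eq hz]

lemma scalarCurv_eq : scalarCurv G z = contr G z (ric G z) := by
  simp only [scalarCurv, contr, h.ricci_eq hz]

lemma sch_eq (u v : E4) :
    sch G z u v = 1 / 2 * (ric G z u v - 1 / 6 * contr G z (ric G z) * met G z u v) := by
  refine bilin_eq (B := fun u v => 1 / 2 * (ric G z u v
    - 1 / 6 * contr G z (ric G z) * met G z u v)) ?_ ?_ ?_ u v
  · intro v
    constructor <;> intros <;> simp only [ric_linear₁ .. |>.map_add, ric_linear₁ .. |>.map_smul,
      map_add, map_smul, add_apply, smul_apply, smul_eq_mul] <;> ring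
  · intro v
    constructor <;> intros <;> simp only [ric_linear₂ .. |>.map_add, ric_linear₂ .. |>.map_smul,
      map_add, map_smul, smul_eq_mul] <;> ring
  · intro a b
    rw [schouten, h.ricci_eq hz, h.scalarCurv_eq hz, met_bv]

lemma contr_swap (B : E4 → E4 → ℝ) : contr G z B = contr G z fun x y => B y x := by
  unfold contr
  rw [Finset.sum_comm]
  refine Finset.sum_congr rfl fun a _ => Finset.sum_congr rfl fun b _ => ?_
  rw [h.inv_symm hz]

lemma ric_symm (u v : E4) : ric G z u v = ric G z v u := by
  unfold ric
  rw [h.contr_swap hz]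
  congr 1
  funext x y
  rw [h.curv_pair_symm hz]

lemma sch_symm (u v : E4) : sch G z u v = sch G z v u := by
  rw [h.sch_eq hz, h.sch_eq hz, h.ric_symm hz, h.met_symm hz]

lemma weylDown_eq (a b c d : Fin 4) :
    weylDown G z a b c d = weylForm G z (bv a) (bv b) (bv c) (bv d) := by
  have h1 : ∑ e, riemann G z a b c e * G z e d
      = met G z (curv G z (bv a) (bv b) (bv c)) (bv d) := by
    conv_rhs => rw [← sum_bv (curv G z (bv a) (bv b) (bv c))]
    simp only [map_sum, map_smul, sum_apply, smul_apply, met_bv, smul_eq_mul, h.riemann_eq hz]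
  have h2 : ∀ b, ∑ e, schoutenUp G z e b * G z e d = schouten G z d b := by
    intro b
    simp only [schoutenUp, Finset.sum_mul]
    rw [Finset.sum_comm]
    have : ∀ k, ∑ e, invMetric G z e k * schouten G z k b * G z e d
        = schouten G z k b * if k = d then 1 else 0 := by
      intro k
      rw [← h.sum_inv_mul hz, Finset.mul_sum]
      refine Finset.sum_congr rfl fun l _ => ?_
      rw [h.inv_symm hz]
      ring
    simp [this]
  have h3 : ∀ b, ∑ e, delta e b * G z e d = G z b d := by
    intro b
    simp [delta]
  have : weylDown G z a b c d = ∑ e, riemann G z a b c e * G z e d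
      - ((∑ e, schoutenUp G z e b * G z e d) * G z a c
        - (∑ e, schoutenUp G z e a * G z e d) * G z b c)
      - ((∑ e, delta e b * G z e d) * schouten G z a c
        - (∑ e, delta e a * G z e d) * schouten G z b c) := by
    simp only [weylDown, weyl, Finset.sum_mul, ← Finset.sum_sub_distrib]
    exact Finset.sum_congr rfl fun e _ => by ring
  rw [this, h1, h2, h2, h3, h3, weylForm]
  simp only [met_bv, sch, bilin_bv]

omit hz in
lemma smooth_sch : ContDiffOn ℝ ∞ (sch G) U := contDiffOn_bilin fun _ _ => h.smooth_schouten _ _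

lemma diff_sch : DifferentiableAt ℝ (sch G) z :=
  ContDiffOn.differentiableAt_of_isOpen h.smooth_sch h.isOpen hz

lemma pderiv_schouten (a b c : Fin 4) :
    pderiv a (fun y => schouten G y b c) z = fderiv ℝ (sch G) z (bv a) (bv b) (bv c) := by
  rw [← fderiv_clm_const₂ (h.diff_sch hz)]
  simp only [sch, bilin_bv, pderiv]

lemma schoutenCurl_eq (m p a : Fin 4) :
    schoutenCurl G z m p a = cot G z (bv m) (bv p) (bv a) := by
  have h1 : ∀ m p a : Fin 4,
      covDeriv G (p := 0) (q := 2) (fun y _ B => schouten G y (B 0) (B 1)) z m ![] ![p, a]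
      = fderiv ℝ (sch G) z (bv m) (bv p) (bv a) - sch G z (chr G z (bv m) (bv p)) (bv a)
        - sch G z (bv p) (chr G z (bv m) (bv a)) := by
    intro m p a
    have e1 : ∀ x w : E4, sch G z x w = ∑ c, x c * sch G z (bv c) w := by
      intro x w
      conv_lhs => rw [← sum_bv x]
      simp
    have e2 : ∀ x w : E4, sch G z w x = ∑ c, x c * sch G z w (bv c) := by
      intro x w
      conv_lhs => rw [← sum_bv x]
      simp
    rw [e1 (chr G z (bv m) (bv p)), e2 (chr G z (bv m) (bv a)), ← h.pderiv_schouten hz]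
    simp only [covDeriv, Finset.univ_eq_empty, Finset.sum_empty, add_zero, Fin.sum_univ_two,
      Matrix.cons_val_zero, Matrix.cons_val_one, chr_bv, sch, bilin_bv]
    simp [sub_sub]
  -- Antisymmetrising in m and p cancels L(Γ(m,p), a), because the connection is torsion free; `cot`
  -- therefore contains no such term.
  rw [schoutenCurl, h1, h1, cot, h.chr_symm hz (bv p) (bv m)]
  ring

lemma lam_eq (d : Fin 4) : lam G z d = 8 * lamNum G z (bv d) / weylSq G z := by
  unfold lam lamNum contr
  congr 2
  simp only [weylUp, h.schoutenCurl_eq hz, h.weylDown_eq hz, Finset.mul_sum, Finset.sum_mul]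
  rw [sum_move₃]
  refine Finset.sum_congr rfl fun a _ => Finset.sum_congr rfl fun a' _ => ?_
  rw [sum_move₂]
  refine Finset.sum_congr rfl fun m _ => Finset.sum_congr rfl fun m' _ => ?_
  rw [Finset.sum_comm]
  exact Finset.sum_congr rfl fun p _ => Finset.sum_congr rfl fun p' _ => by ring

lemma weylSq_eq : weylSq G z = contr G z fun a a' => contr G z fun b b' => contr G z fun c c' =>
    contr G z fun d d' => weylForm G z a b c d * weylForm G z a' b' c' d' := by
  unfold weylSq contr
  simp only [weylUp, h.weylDown_eq hz, Finset.mul_sum]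
  refine Finset.sum_congr rfl fun a _ => ?_
  rw [sum_move₃]
  refine Finset.sum_congr rfl fun a' _ => Finset.sum_congr rfl fun b _ => ?_
  rw [sum_move₂]
  refine Finset.sum_congr rfl fun b' _ => Finset.sum_congr rfl fun c _ => ?_
  rw [Finset.sum_comm]
  refine Finset.sum_congr rfl fun c' _ => Finset.sum_congr rfl fun d _ =>
    Finset.sum_congr rfl fun d' _ => ?_
  rw [h.inv_symm hz b b', h.inv_symm hz c c', h.inv_symm hz d d']
  ring

end IsMetricOn

/-- Contraction is invariant under linear isometries. -/
lemma contr_isometry {G G' : E4 → Matrix (Fin 4) (Fin 4) ℝ} {y z : E4}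
    (hG' : IsUnit (G' y).det) {J : E4 →L[ℝ] E4}
    (hJ : ∀ u v, met G' y u v = met G z (J u) (J v)) {B : E4 → E4 → ℝ}
    (h₁ : ∀ v, IsLinearMap ℝ fun u => B u v) (h₂ : ∀ u, IsLinearMap ℝ (B u)) :
    contr G' y (fun u v => B (J u) (J v)) = contr G z B := by
  let P : Matrix (Fin 4) (Fin 4) ℝ := Matrix.of fun k a => J (bv a) k
  have exp : ∀ C : E4 → E4 → ℝ, (∀ v, IsLinearMap ℝ fun u => C u v) → (∀ u, IsLinearMap ℝ (C u)) →
      ∀ a b, C (J (bv a)) (J (bv b)) = ∑ k, ∑ l, P k a * (P l b * C (bv k) (bv l)) := by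
    intro C c₁ c₂ a b
    rw [IsLinearMap.sum_smul (c₁ _)]
    refine Finset.sum_congr rfl fun k _ => ?_
    rw [IsLinearMap.sum_smul (c₂ _), smul_eq_mul, Finset.mul_sum]
    rfl
  have hGP : G' y = P.transpose * G z * P := by
    ext a b
    rw [← met_bv G' y a b, hJ, exp (fun u v => met G z u v)]
    · simp only [Matrix.mul_apply, Finset.sum_mul, Matrix.transpose_apply, met_bv]
      rw [Finset.sum_comm]
      exact Finset.sum_congr rfl fun k _ => Finset.sum_congr rfl fun l _ => by ring
    · intro v; constructor <;> intros <;> simp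
    · intro v; constructor <;> intros <;> simp
  -- Nondegeneracy of the pulled back metric forces J to be invertible, so G' = Pᵀ G P can be
  -- inverted to P G'⁻¹ Pᵀ = G⁻¹.
  have hP : IsUnit P.det := by
    rw [hGP, Matrix.det_mul] at hG'
    exact isUnit_of_mul_isUnit_right hG'
  have hPt : IsUnit P.transpose.det := by rwa [Matrix.det_transpose]
  have hinv : P * (G' y)⁻¹ * P.transpose = (G z)⁻¹ := by
    rw [hGP, Matrix.mul_inv_rev, Matrix.mul_inv_rev, ← Matrix.mul_assoc,
      Matrix.mul_nonsing_inv _ hP,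
      Matrix.one_mul, Matrix.mul_assoc, Matrix.nonsing_inv_mul _ hPt, Matrix.mul_one]
  have hinv' : ∀ k l, invMetric G z k l = ∑ a, ∑ b, invMetric G' y a b * (P k a * P l b) := by
    intro k l
    rw [invMetric, ← hinv]
    simp only [Matrix.mul_apply, Finset.sum_mul, Matrix.transpose_apply, invMetric]
    rw [Finset.sum_comm]
    exact Finset.sum_congr rfl fun k _ => Finset.sum_congr rfl fun l _ => by ring
  simp only [contr, hinv', exp B h₁ h₂, Finset.mul_sum, Finset.sum_mul]
  rw [sum_move₃]
  conv_lhs => enter [2, l]; rw [sum_move₂]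
  rw [Finset.sum_comm]
  exact Finset.sum_congr rfl fun k _ => Finset.sum_congr rfl fun l _ =>
    Finset.sum_congr rfl fun a _ => Finset.sum_congr rfl fun b _ => by ring

/-! ### Behaviour under local isometries -/

/-- `φ` is a smooth map from `U'` to `U` that pulls the metric `G` back to `G'`. -/
structure IsIsometryOn (φ : E4 → E4) (G' : E4 → Matrix (Fin 4) (Fin 4) ℝ) (U' : Set E4)
    (G : E4 → Matrix (Fin 4) (Fin 4) ℝ) (U : Set E4) : Prop where
  source : IsMetricOn G' U'
  target : IsMetricOn G U
  smooth : ContDiffOn ℝ ∞ φ U'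
  mapsTo : Set.MapsTo φ U' U
  met_eq : ∀ y ∈ U', ∀ u v, met G' y u v = met G (φ y) (fderiv ℝ φ y u) (fderiv ℝ φ y v)

namespace IsIsometryOn

variable {φ : E4 → E4} {G G' : E4 → Matrix (Fin 4) (Fin 4) ℝ} {U U' : Set E4}
  (h : IsIsometryOn φ G' U' G U) {y : E4} (hy : y ∈ U')
include h

lemma smooth_fderiv : ContDiffOn ℝ ∞ (fderiv ℝ φ) U' :=
  contDiffOn_fderiv h.smooth h.source.isOpen

include hy

lemma diff : DifferentiableAt ℝ φ y :=
  ContDiffOn.differentiableAt_of_isOpen h.smooth h.source.isOpen hy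

lemma diff_fderiv : DifferentiableAt ℝ (fderiv ℝ φ) y :=
  ContDiffOn.differentiableAt_of_isOpen h.smooth_fderiv h.source.isOpen hy

lemma diff_fderiv₂ : DifferentiableAt ℝ (fderiv ℝ (fderiv ℝ φ)) y :=
  ContDiffOn.differentiableAt_of_isOpen
    (contDiffOn_fderiv h.smooth_fderiv h.source.isOpen) h.source.isOpen hy

/-- A vector killed by dφ is orthogonal to everything for the pulled back metric, which is
nondegenerate. Invertibility of dφ is thus a consequence of the isometry equation. -/
lemma fderiv_injective : Function.Injective (fderiv ℝ φ y) := by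
  intro u v huv
  refine h.source.met_ext hy fun w => ?_
  rw [h.met_eq y hy, h.met_eq y hy, huv]

lemma fderiv_surjective : Function.Surjective (fderiv ℝ φ y) :=
  (LinearMap.injective_iff_surjective (f := (fderiv ℝ φ y).toLinearMap)).1 (h.fderiv_injective hy)

lemma fderiv_fderiv_symm (u v : E4) :
    fderiv ℝ (fderiv ℝ φ) y u v = fderiv ℝ (fderiv ℝ φ) y v u :=
  fderiv_fderiv_comm h.smooth h.source.isOpen hy u v

/-- The chain rule for a pulled back bilinear form. -/
lemma fderiv_pullback {F : Type*} [NormedAddCommGroup F] [NormedSpace ℝ F]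
    {X : E4 → E4 →L[ℝ] E4 →L[ℝ] F} (hX : DifferentiableAt ℝ X (φ y)) (w u v : E4) :
    fderiv ℝ (fun y => X (φ y) (fderiv ℝ φ y u) (fderiv ℝ φ y v)) y w
      = fderiv ℝ X (φ y) (fderiv ℝ φ y w) (fderiv ℝ φ y u) (fderiv ℝ φ y v)
        + X (φ y) (fderiv ℝ (fderiv ℝ φ) y w u) (fderiv ℝ φ y v)
        + X (φ y) (fderiv ℝ φ y u) (fderiv ℝ (fderiv ℝ φ) y w v) := by
  have d1 : ∀ u, DifferentiableAt ℝ (fun y => fderiv ℝ φ y u) y := fun u =>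
    (h.diff_fderiv hy).clm_apply (differentiableAt_const u)
  have d2 : ∀ u, fderiv ℝ (fun y => fderiv ℝ φ y u) y w = fderiv ℝ (fderiv ℝ φ) y w u := by
    intro u
    rw [fderiv_clm_apply₁ (h.diff_fderiv hy) (differentiableAt_const u)]
    simp
  rw [fderiv_clm_apply₂ (c := fun y => X (φ y)) (hX.comp y (h.diff hy)) (d1 u) (d1 v), d2, d2,
    fderiv_fun_comp y hX (h.diff hy)]
  rfl

/-- The transformation law of the Christoffel symbols. -/
lemma fderiv_chr (u v : E4) :
    fderiv ℝ φ y (chr G' y u v) = chr G (φ y) (fderiv ℝ φ y u) (fderiv ℝ φ y v)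
      + fderiv ℝ (fderiv ℝ φ) y u v := by
  have hφ := h.mapsTo hy
  -- Differentiate the isometry equation. In the Koszul combination of these formulas the second
  -- derivatives of φ cancel in pairs, apart from the one in direction (u, v).
  have key : ∀ w u v, fderiv ℝ (met G') y w u v
      = fderiv ℝ (met G) (φ y) (fderiv ℝ φ y w) (fderiv ℝ φ y u) (fderiv ℝ φ y v)
        + met G (φ y) (fderiv ℝ (fderiv ℝ φ) y w u) (fderiv ℝ φ y v)
        + met G (φ y) (fderiv ℝ φ y u) (fderiv ℝ (fderiv ℝ φ) y w v) := by
    intro w u v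
    rw [← h.fderiv_pullback hy (h.target.diff_met hφ), ← fderiv_clm_const₂ (h.source.diff_met hy),
      fderiv_congr_of_isOpen h.source.isOpen (fun y hy => h.met_eq y hy u v) hy]
  refine h.target.met_ext hφ fun x => ?_
  obtain ⟨w, rfl⟩ := h.fderiv_surjective hy x
  rw [← h.met_eq y hy, map_add, add_apply, h.source.koszul hy, h.target.koszul hφ, key, key, key,
    h.target.met_symm hφ (fderiv ℝ φ y w) (fderiv ℝ (fderiv ℝ φ) y u v),
    h.target.met_symm hφ (fderiv ℝ φ y w) (fderiv ℝ (fderiv ℝ φ) y v u),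
    h.target.met_symm hφ (fderiv ℝ φ y u) (fderiv ℝ (fderiv ℝ φ) y w v),
    h.fderiv_fderiv_symm hy v u, h.fderiv_fderiv_symm hy w u, h.fderiv_fderiv_symm hy w v]
  ring

/-- The curvature is natural. -/
lemma fderiv_curv (u v w : E4) :
    fderiv ℝ φ y (curv G' y u v w)
      = curv G (φ y) (fderiv ℝ φ y u) (fderiv ℝ φ y v) (fderiv ℝ φ y w) := by
  have hφ := h.mapsTo hy
  have key : ∀ w u v, fderiv ℝ φ y (fderiv ℝ (chr G') y w u v)
      = fderiv ℝ (chr G) (φ y) (fderiv ℝ φ y w) (fderiv ℝ φ y u) (fderiv ℝ φ y v)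
        + chr G (φ y) (fderiv ℝ (fderiv ℝ φ) y w u) (fderiv ℝ φ y v)
        + chr G (φ y) (fderiv ℝ φ y u) (fderiv ℝ (fderiv ℝ φ) y w v)
        + fderiv ℝ (fderiv ℝ (fderiv ℝ φ)) y w u v
        - fderiv ℝ (fderiv ℝ φ) y w (chr G' y u v) := by
    intro w u v
    have dc : DifferentiableAt ℝ (fun y => chr G' y u v) y :=
      ((h.source.diff_chr hy).clm_apply (differentiableAt_const _)).clm_apply
        (differentiableAt_const _)
    have e1 := fderiv_clm_apply₁ (h.diff_fderiv hy) dc w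
    rw [fderiv_congr_of_isOpen h.source.isOpen (fun y hy => h.fderiv_chr hy u v) hy,
      fderiv_clm_const₂ (h.source.diff_chr hy)] at e1
    rw [eq_sub_iff_add_eq, ← e1, ← h.fderiv_pullback hy (h.target.diff_chr hφ),
      ← fderiv_clm_const₂ (h.diff_fderiv₂ hy), ← add_apply, ← fderiv_fun_add]
    · exact ((((h.target.diff_chr hφ).comp y (h.diff hy)).clm_apply
        ((h.diff_fderiv hy).clm_apply (differentiableAt_const _)))).clm_apply
        ((h.diff_fderiv hy).clm_apply (differentiableAt_const _))
    · exact ((h.diff_fderiv₂ hy).clm_apply (differentiableAt_const _)).clm_apply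
        (differentiableAt_const _)
  -- Differentiating the law for the Christoffel symbols brings in third derivatives of φ; their
  -- symmetry in u and v removes them from the curvature.
  have hs : fderiv ℝ (fderiv ℝ (fderiv ℝ φ)) y u v w =
      fderiv ℝ (fderiv ℝ (fderiv ℝ φ)) y v u w := by
    rw [fderiv_fderiv_comm h.smooth_fderiv h.source.isOpen hy u v]
  simp only [curv, map_sub, map_add, key, h.fderiv_chr hy, hs, h.fderiv_fderiv_symm hy v u]
  abel

lemma met_curv (u v w x : E4) : met G' y (curv G' y u v w) x
    = met G (φ y) (curv G (φ y) (fderiv ℝ φ y u) (fderiv ℝ φ y v) (fderiv ℝ φ y w))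
      (fderiv ℝ φ y x) := by
  rw [h.met_eq y hy, h.fderiv_curv hy]

lemma contr_eq {B : E4 → E4 → ℝ} (h₁ : ∀ v, IsLinearMap ℝ fun u => B u v)
    (h₂ : ∀ u, IsLinearMap ℝ (B u)) :
    contr G' y (fun u v => B (fderiv ℝ φ y u) (fderiv ℝ φ y v)) = contr G (φ y) B :=
  contr_isometry (h.source.det y hy) (h.met_eq y hy) h₁ h₂

lemma ric_eq (u w : E4) : ric G' y u w = ric G (φ y) (fderiv ℝ φ y u) (fderiv ℝ φ y w) := by
  unfold ric
  simp only [h.met_curv hy]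
  refine h.contr_eq hy (B := fun x z => met G (φ y) (curv G (φ y) (fderiv ℝ φ y u) x
    (fderiv ℝ φ y w)) z) ?_ ?_
  · intro v
    constructor <;> intros <;> simp only [curv_linear₂ .. |>.map_add,
      curv_linear₂ .. |>.map_smul, map_add, map_smul, add_apply, smul_apply]
  · intro v
    constructor <;> intros <;> simp only [map_add, map_smul]

lemma sch_eq (u w : E4) : sch G' y u w = sch G (φ y) (fderiv ℝ φ y u) (fderiv ℝ φ y w) := by
  have hφ := h.mapsTo hy
  rw [h.source.sch_eq hy, h.target.sch_eq hφ, h.ric_eq hy, h.met_eq y hy]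
  have : contr G' y (ric G' y) = contr G (φ y) (ric G (φ y)) := by
    rw [← h.contr_eq hy ric_linear₁ ric_linear₂]
    congr 1
    funext u v
    exact h.ric_eq hy u v
  rw [this]

lemma weylForm_eq (u v w x : E4) : weylForm G' y u v w x
    = weylForm G (φ y) (fderiv ℝ φ y u) (fderiv ℝ φ y v) (fderiv ℝ φ y w) (fderiv ℝ φ y x) := by
  simp only [weylForm, h.met_curv hy, h.sch_eq hy, h.met_eq y hy]

lemma cot_eq (u v w : E4) : cot G' y u v w
    = cot G (φ y) (fderiv ℝ φ y u) (fderiv ℝ φ y v) (fderiv ℝ φ y w) := by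
  have hφ := h.mapsTo hy
  have key : ∀ w u v, fderiv ℝ (sch G') y w u v
      = fderiv ℝ (sch G) (φ y) (fderiv ℝ φ y w) (fderiv ℝ φ y u) (fderiv ℝ φ y v)
        + sch G (φ y) (fderiv ℝ (fderiv ℝ φ) y w u) (fderiv ℝ φ y v)
        + sch G (φ y) (fderiv ℝ φ y u) (fderiv ℝ (fderiv ℝ φ) y w v) := by
    intro w u v
    rw [← h.fderiv_pullback hy (h.target.diff_sch hφ), ← fderiv_clm_const₂ (h.source.diff_sch hy),
      fderiv_congr_of_isOpen h.source.isOpen (fun y hy => h.sch_eq hy u v) hy]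
  simp only [cot, key, h.sch_eq hy, h.fderiv_chr hy, map_add, h.fderiv_fderiv_symm hy v u]
  ring

lemma lamNum_eq (u : E4) : lamNum G' y u = lamNum G (φ y) (fderiv ℝ φ y u) := by
  unfold lamNum
  simp only [h.weylForm_eq hy, h.cot_eq hy]
  -- Invariance of contractions is applied to one index pair at a time, from the innermost outwards;
  -- each application needs bilinearity in that pair only.
  have l3 : ∀ u a m a' m', contr G' y (fun p p' => weylForm G (φ y) u a m (fderiv ℝ φ y p)
      * cot G (φ y) m' (fderiv ℝ φ y p') a')
      = contr G (φ y) (fun p p' => weylForm G (φ y) u a m p * cot G (φ y) m' p' a') := by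
    intro u a m a' m'
    refine h.contr_eq hy (B := fun p p' => weylForm G (φ y) u a m p * cot G (φ y) m' p' a') ?_ ?_
    · intro v
      constructor <;> intros <;> simp only [(weylForm_linear₄ _ _ _).map_add,
        (weylForm_linear₄ _ _ _).map_smul, smul_eq_mul] <;> ring
    · intro v
      constructor <;> intros <;> simp only [(cot_linear₂ _ _).map_add,
        (cot_linear₂ _ _).map_smul, smul_eq_mul] <;> ring
  simp only [l3]
  have l2 : ∀ u a a', contr G' y (fun m m' => contr G (φ y)
        (fun p p' => weylForm G (φ y) u a (fderiv ℝ φ y m) p * cot G (φ y) (fderiv ℝ φ y m') p' a'))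
      = contr G (φ y) (fun m m' => contr G (φ y)
        (fun p p' => weylForm G (φ y) u a m p * cot G (φ y) m' p' a')) := by
    intro u a a'
    refine h.contr_eq hy (B := fun m m' => contr G (φ y)
      (fun p p' => weylForm G (φ y) u a m p * cot G (φ y) m' p' a')) ?_ ?_
    · intro v
      refine contr_isLinearMap fun _ _ => ?_
      constructor <;> intros <;> simp only [(weylForm_linear₃ _ _ _).map_add,
        (weylForm_linear₃ _ _ _).map_smul, smul_eq_mul] <;> ring
    · intro v
      refine contr_isLinearMap fun _ _ => ?_
      constructor <;> intros <;> simp only [(cot_linear₁ _ _).map_add,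
        (cot_linear₁ _ _).map_smul, smul_eq_mul] <;> ring
  simp only [l2]
  refine h.contr_eq hy (B := fun a a' => contr G (φ y) fun m m' => contr G (φ y)
      (fun p p' => weylForm G (φ y) (fderiv ℝ φ y u) a m p * cot G (φ y) m' p' a')) ?_ ?_
  · intro v
    refine contr_isLinearMap fun _ _ => contr_isLinearMap fun _ _ => ?_
    constructor <;> intros <;> simp only [(weylForm_linear₂ _ _ _).map_add,
      (weylForm_linear₂ _ _ _).map_smul, smul_eq_mul] <;> ring
  · intro v
    refine contr_isLinearMap fun _ _ => contr_isLinearMap fun _ _ => ?_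
    constructor <;> intros <;> simp only [(cot_linear₃ _ _).map_add,
      (cot_linear₃ _ _).map_smul, smul_eq_mul] <;> ring

lemma weylSq_eq : weylSq G' y = weylSq G (φ y) := by
  have hφ := h.mapsTo hy
  rw [h.source.weylSq_eq hy, h.target.weylSq_eq hφ]
  simp only [h.weylForm_eq hy]
  have l4 : ∀ a b c a' b' c', contr G' y (fun p p' => weylForm G (φ y) a b c (fderiv ℝ φ y p)
      * weylForm G (φ y) a' b' c' (fderiv ℝ φ y p'))
      = contr G (φ y) (fun p p' => weylForm G (φ y) a b c p * weylForm G (φ y) a' b' c' p') := by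
    intro a b c a' b' c'
    refine h.contr_eq hy
      (B := fun p p' => weylForm G (φ y) a b c p * weylForm G (φ y) a' b' c' p') ?_ ?_ <;>
    · intro v
      constructor <;> intros <;> simp only [(weylForm_linear₄ _ _ _).map_add,
        (weylForm_linear₄ _ _ _).map_smul, smul_eq_mul] <;> ring
  simp only [l4]
  have l3 : ∀ a b a' b', contr G' y (fun c c' => contr G (φ y) fun p p' =>
      weylForm G (φ y) a b (fderiv ℝ φ y c) p * weylForm G (φ y) a' b' (fderiv ℝ φ y c') p')
      = contr G (φ y) (fun c c' => contr G (φ y) fun p p' =>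
        weylForm G (φ y) a b c p * weylForm G (φ y) a' b' c' p') := by
    intro a b a' b'
    refine h.contr_eq hy (B := fun c c' => contr G (φ y) fun p p' =>
        weylForm G (φ y) a b c p * weylForm G (φ y) a' b' c' p') ?_ ?_ <;>
    · intro v
      refine contr_isLinearMap fun _ _ => ?_
      constructor <;> intros <;> simp only [(weylForm_linear₃ _ _ _).map_add,
        (weylForm_linear₃ _ _ _).map_smul, smul_eq_mul] <;> ring
  simp only [l3]
  have l2 : ∀ a a', contr G' y (fun b b' => contr G (φ y) fun c c' => contr G (φ y) fun p p' =>
      weylForm G (φ y) a (fderiv ℝ φ y b) c p * weylForm G (φ y) a' (fderiv ℝ φ y b') c' p')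
      = contr G (φ y) (fun b b' => contr G (φ y) fun c c' => contr G (φ y) fun p p' =>
        weylForm G (φ y) a b c p * weylForm G (φ y) a' b' c' p') := by
    intro a a'
    refine h.contr_eq hy (B := fun b b' => contr G (φ y) fun c c' => contr G (φ y) fun p p' =>
        weylForm G (φ y) a b c p * weylForm G (φ y) a' b' c' p') ?_ ?_ <;>
    · intro v
      refine contr_isLinearMap fun _ _ => contr_isLinearMap fun _ _ => ?_
      constructor <;> intros <;> simp only [(weylForm_linear₂ _ _ _).map_add,
        (weylForm_linear₂ _ _ _).map_smul, smul_eq_mul] <;> ring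
  simp only [l2]
  refine h.contr_eq hy (B := fun a a' => contr G (φ y) fun b b' => contr G (φ y) fun c c' =>
      contr G (φ y) fun p p' =>
        weylForm G (φ y) a b c p * weylForm G (φ y) a' b' c' p') ?_ ?_ <;>
  · intro v
    refine contr_isLinearMap fun _ _ => contr_isLinearMap fun _ _ => contr_isLinearMap fun _ _ => ?_
    constructor <;> intros <;> simp only [(weylForm_linear₁ _ _ _).map_add,
      (weylForm_linear₁ _ _ _).map_smul, smul_eq_mul] <;> ring

end IsIsometryOn

/-! ### A quadratic identity in dimension four -/

/-- The four-dimensional identity `X_{da}{}^{mp} X_{mp}{}^{fa} = ¼ δ_d^f X_{ab}{}^{mp}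
X_{mp}{}^{ab}`
for trace-free `X` that is antisymmetric in both pairs of indices. -/
lemma quadratic_identity (X : Fin 4 → Fin 4 → Fin 4 → Fin 4 → ℝ)
    (h₁ : ∀ a b c d, X a b c d = - X b a c d) (h₂ : ∀ a b c d, X a b c d = - X a b d c)
    (h₃ : ∀ a c, ∑ b, X a b c b = 0) (d f : Fin 4) :
    ∑ a, ∑ m, ∑ p, X d a m p * X m p f a
      = if d = f then 1 / 4 * ∑ a, ∑ b, ∑ m, ∑ p, X a b m p * X m p a b else 0 := by
  have z₁ : ∀ a c d, X a a c d = 0 := fun a c d => by linarith [h₁ a a c d]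
  have z₂ : ∀ a b c, X a b c c = 0 := fun a b c => by linarith [h₂ a b c c]
  have a10 := h₁ 1 0
  have a20 := h₁ 2 0
  have a30 := h₁ 3 0
  have a21 := h₁ 2 1
  have a31 := h₁ 3 1
  have a32 := h₁ 3 2
  have b10 := fun a b => h₂ a b 1 0
  have b20 := fun a b => h₂ a b 2 0
  have b30 := fun a b => h₂ a b 3 0
  have b21 := fun a b => h₂ a b 2 1
  have b31 := fun a b => h₂ a b 3 1
  have b32 := fun a b => h₂ a b 3 2
  have t : ∀ a c, X a 0 c 0 + X a 1 c 1 + X a 2 c 2 + X a 3 c 3 = 0 := by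
    intro a c
    rw [← h₃ a c, Fin.sum_univ_four]
  clear h₁ h₂ h₃
  have t01 := t 0 1
  have t02 := t 0 2
  have t03 := t 0 3
  have t10 := t 1 0
  have t12 := t 1 2
  have t13 := t 1 3
  have t20 := t 2 0
  have t21 := t 2 1
  have t23 := t 2 3
  have t30 := t 3 0
  have t31 := t 3 1
  have t32 := t 3 2
  have t00 := t 0 0
  have t11 := t 1 1
  have t22 := t 2 2
  have t33 := t 3 3
  simp only [z₁, z₂, a10, a20, a30, a21, a31, a32, b10, b20, b30, b21, b31, b32]
    at t00 t01 t02 t03 t10 t11 t12 t13 t20 t21 t22 t23 t30 t31 t32 t33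
  -- The sixteen trace equations are solved here. They say that the entry at index pairs (P, Q)
  -- equals, up to sign, the entry at the complementary pairs (Qᶜ, Pᶜ), together with one relation
  -- X₀₁₀₁ + X₀₂₀₂ + X₀₃₀₃ = 0. After substitution the claim is a polynomial identity in the free
  -- entries.
  have e01 : X 0 3 1 3 = - X 0 2 1 2 := by linarith
  have e02 : X 0 3 2 3 = X 0 1 1 2 := by linarith
  have e03 : X 0 2 2 3 = - X 0 1 1 3 := by linarith
  have e10 : X 1 3 0 3 = - X 1 2 0 2 := by linarith
  have e12 : X 1 3 2 3 = - X 0 1 0 2 := by linarith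
  have e13 : X 1 2 2 3 = X 0 1 0 3 := by linarith
  have e20 : X 2 3 0 3 = X 1 2 0 1 := by linarith
  have e21 : X 2 3 1 3 = - X 0 2 0 1 := by linarith
  have e23 : X 1 2 1 3 = - X 0 2 0 3 := by linarith
  have e30 : X 2 3 0 2 = - X 1 3 0 1 := by linarith
  have e31 : X 2 3 1 2 = X 0 3 0 1 := by linarith
  have e32 : X 1 3 1 2 = - X 0 3 0 2 := by linarith
  have e00 : X 0 3 0 3 = - X 0 1 0 1 - X 0 2 0 2 := by linarith
  have e11 : X 1 2 1 2 = - X 0 1 0 1 - X 0 2 0 2 := by linarith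
  have e22 : X 1 3 1 3 = X 0 2 0 2 := by linarith
  have e33 : X 2 3 2 3 = X 0 1 0 1 := by linarith
  clear t t00 t01 t02 t03 t10 t11 t12 t13 t20 t21 t22 t23 t30 t31 t32 t33
  -- Comparing the full trace with the (0,0) entry alone identifies the factor ¼; the case check
  -- below then covers all sixteen entries.
  have hT : ∑ a, ∑ b, ∑ m, ∑ p, X a b m p * X m p a b
      = 4 * (∑ a, ∑ m, ∑ p, X 0 a m p * X m p 0 a) := by
    simp only [Fin.sum_univ_four, z₁, z₂, a10, a20, a30, a21, a31, a32, b10, b20, b30, b21, b31,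
      b32, e00, e01, e02, e03, e10, e11, e12, e13, e20, e21, e22, e23, e30, e31, e32, e33]
    ring
  rw [hT]
  fin_cases d <;> fin_cases f <;>
  · simp only [Fin.zero_eta, Fin.mk_one, Fin.reduceFinMk, Fin.isValue, Fin.reduceEq, if_true,
      if_false, Fin.sum_univ_four, z₁, z₂, a10, a20, a30, a21, a31, a32, b10, b20, b30, b21, b31,
      b32,
      e00, e01, e02, e03, e10, e11, e12, e13, e20, e21, e22, e23, e30, e31, e32, e33]
    ring

/-! ### Behaviour under conformal rescaling -/

/-- The vector metrically dual to a linear form. -/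
def sharp (G : E4 → Matrix (Fin 4) (Fin 4) ℝ) (z : E4) (α : E4 →L[ℝ] ℝ) : E4 :=
  ∑ c, (∑ d, invMetric G z c d * α (bv d)) • bv c

namespace IsMetricOn

variable {G : E4 → Matrix (Fin 4) (Fin 4) ℝ} {U : Set E4} (h : IsMetricOn G U) {z : E4}

include h in
lemma smooth_sharp {α : E4 → E4 →L[ℝ] ℝ} (hα : ContDiffOn ℝ ∞ α U) :
    ContDiffOn ℝ ∞ (fun z => sharp G z (α z)) U :=
  ContDiffOn.sum fun c _ => (ContDiffOn.sum fun d _ =>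
    (h.smooth_inv c d).mul (hα.clm_apply contDiffOn_const)).smul contDiffOn_const

variable (hz : z ∈ U)
include h hz

lemma met_sharp (α : E4 →L[ℝ] ℝ) (w : E4) : met G z (sharp G z α) w = α w := by
  rw [sharp, h.met_inv_sum hz]
  conv_rhs => rw [← sum_bv w]
  simp [mul_comm]

lemma contr_met_right (f : E4 → ℝ) (hf : IsLinearMap ℝ f) (v : E4) :
    contr G z (fun x y => f x * met G z v y) = f v := by
  rw [IsLinearMap.sum_smul hf v, contr]
  refine Finset.sum_congr rfl fun a _ => ?_
  rw [h.apply_eq hz, smul_eq_mul, Finset.sum_mul]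
  exact Finset.sum_congr rfl fun b _ => by ring

lemma contr_met : contr G z (fun x y => met G z x y) = 4 := by
  unfold contr
  simp only [← h.apply_eq hz, bv_apply]
  simp

end IsMetricOn

/-- `G' = e^{2ψ} G` on `U`. -/
structure IsConformalOn (ψ : E4 → ℝ) (G' G : E4 → Matrix (Fin 4) (Fin 4) ℝ) (U : Set E4) :
    Prop where
  source : IsMetricOn G' U
  target : IsMetricOn G U
  smooth : ContDiffOn ℝ ∞ ψ U
  met_eq : ∀ y ∈ U, ∀ u v, met G' y u v = Real.exp (2 * ψ y) * met G y u v

/-- The covariant Hessian of `ψ`. -/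
def hess (ψ : E4 → ℝ) (G : E4 → Matrix (Fin 4) (Fin 4) ℝ) (z u v : E4) : ℝ :=
  fderiv ℝ (fderiv ℝ ψ) z u v - fderiv ℝ ψ z (chr G z u v)

/-- The gradient of `ψ`. -/
abbrev grad (ψ : E4 → ℝ) (G : E4 → Matrix (Fin 4) (Fin 4) ℝ) (z : E4) : E4 :=
  sharp G z (fderiv ℝ ψ z)

/-- The covariant derivative of the gradient of `ψ`. -/
def nablaGrad (ψ : E4 → ℝ) (G : E4 → Matrix (Fin 4) (Fin 4) ℝ) (z u : E4) : E4 :=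
  fderiv ℝ (grad ψ G) z u + chr G z u (grad ψ G z)

/-- The change of the Schouten tensor under a conformal change of the metric. -/
def schoutenChange (ψ : E4 → ℝ) (G : E4 → Matrix (Fin 4) (Fin 4) ℝ) (z u v : E4) : ℝ :=
  - hess ψ G z u v + fderiv ℝ ψ z u * fderiv ℝ ψ z v
    - 1 / 2 * fderiv ℝ ψ z (grad ψ G z) * met G z u v

/-- The change of the Schouten tensor, as an endomorphism. -/
def schoutenChangeVec (ψ : E4 → ℝ) (G : E4 → Matrix (Fin 4) (Fin 4) ℝ) (z u : E4) : E4 :=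
  - nablaGrad ψ G z u + fderiv ℝ ψ z u • grad ψ G z
    - (1 / 2 * fderiv ℝ ψ z (grad ψ G z)) • u

namespace IsConformalOn

variable {ψ : E4 → ℝ} {G G' : E4 → Matrix (Fin 4) (Fin 4) ℝ} {U : Set E4}
  (h : IsConformalOn ψ G' G U) {z : E4} (hz : z ∈ U)
include h

lemma smooth_fderiv : ContDiffOn ℝ ∞ (fderiv ℝ ψ) U := contDiffOn_fderiv h.smooth h.target.isOpen

lemma smooth_grad : ContDiffOn ℝ ∞ (grad ψ G) U := h.target.smooth_sharp h.smooth_fderiv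

include hz

lemma diff : DifferentiableAt ℝ ψ z :=
  ContDiffOn.differentiableAt_of_isOpen h.smooth h.target.isOpen hz

lemma diff_fderiv : DifferentiableAt ℝ (fderiv ℝ ψ) z :=
  ContDiffOn.differentiableAt_of_isOpen h.smooth_fderiv h.target.isOpen hz

lemma diff_fderiv₂ : DifferentiableAt ℝ (fderiv ℝ (fderiv ℝ ψ)) z :=
  ContDiffOn.differentiableAt_of_isOpen
    (contDiffOn_fderiv h.smooth_fderiv h.target.isOpen) h.target.isOpen hz

lemma diff_grad : DifferentiableAt ℝ (grad ψ G) z :=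
  ContDiffOn.differentiableAt_of_isOpen h.smooth_grad h.target.isOpen hz

lemma met_grad (w : E4) : met G z (grad ψ G z) w = fderiv ℝ ψ z w := h.target.met_sharp hz _ w

lemma hess_symm (u v : E4) : hess ψ G z u v = hess ψ G z v u := by
  rw [hess, hess, fderiv_fderiv_comm h.smooth h.target.isOpen hz, h.target.chr_symm hz]

/-- Differentiate g(grad ψ, v) = dψ(v) with v constant and use metric compatibility. -/
lemma met_nablaGrad (u v : E4) : met G z (nablaGrad ψ G z u) v = hess ψ G z u v := by
  have e : fderiv ℝ (fun y => met G y (grad ψ G y) v) z u = fderiv ℝ (fderiv ℝ ψ) z u v := by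
    rw [fderiv_congr_of_isOpen h.target.isOpen (fun y hy => h.met_grad hy v) hz,
      fderiv_clm_apply₁ (h.diff_fderiv hz) (differentiableAt_const v)]
    simp
  rw [fderiv_clm_apply₂ (h.target.diff_met hz) (h.diff_grad hz) (differentiableAt_const v),
    h.target.compat hz] at e
  simp only [fderiv_fun_const, Pi.zero_apply, zero_apply, map_zero, add_zero, h.met_grad hz] at e
  rw [hess, nablaGrad, map_add, add_apply]
  linarith

lemma met_schoutenChangeVec (u v : E4) :
    met G z (schoutenChangeVec ψ G z u) v = schoutenChange ψ G z u v := by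
  simp only [schoutenChangeVec, schoutenChange, map_sub, map_add, map_neg, map_smul, sub_apply,
    add_apply, neg_apply, smul_apply, smul_eq_mul, h.met_nablaGrad hz, h.met_grad hz]

lemma schoutenChange_symm (u v : E4) :
    schoutenChange ψ G z u v = schoutenChange ψ G z v u := by
  rw [schoutenChange, schoutenChange, h.hess_symm hz, h.target.met_symm hz]
  ring

lemma fderiv_met (w u v : E4) : fderiv ℝ (met G') z w u v
    = Real.exp (2 * ψ z) * (2 * fderiv ℝ ψ z w * met G z u v + fderiv ℝ (met G) z w u v) := by
  rw [← fderiv_clm_const₂ (h.source.diff_met hz),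
    fderiv_congr_of_isOpen h.target.isOpen (fun y hy => h.met_eq y hy u v) hz]
  have d1 : HasFDerivAt (fun y => Real.exp (2 * ψ y))
      (Real.exp (2 * ψ z) • ((2 : ℝ) • fderiv ℝ ψ z)) z :=
    ((h.diff hz).hasFDerivAt.const_mul 2).exp
  have d2 : DifferentiableAt ℝ (fun y => met G y u v) z :=
    ((h.target.diff_met hz).clm_apply (differentiableAt_const _)).clm_apply
      (differentiableAt_const _)
  rw [(d1.fun_mul d2.hasFDerivAt).fderiv]
  simp only [add_apply, smul_apply, smul_eq_mul, fderiv_clm_const₂ (h.target.diff_met hz)]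
  ring

/-- In the Koszul formula for G' the common factor e^{2ψ} drops out, and the three extra terms come
from its derivative. -/
lemma chr_eq (u v : E4) : chr G' z u v = chr G z u v + fderiv ℝ ψ z u • v + fderiv ℝ ψ z v • u
    - met G z u v • grad ψ G z := by
  refine h.source.met_ext hz fun w => ?_
  rw [h.source.koszul hz, h.met_eq z hz]
  simp only [map_sub, map_add, map_smul, sub_apply, add_apply, smul_apply, smul_eq_mul,
    h.met_grad hz, h.target.koszul hz, h.fderiv_met hz]
  rw [h.target.met_symm hz w u, h.target.met_symm hz w v]
  ring

lemma fderiv_chr (w u v : E4) : fderiv ℝ (chr G') z w u v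
    = fderiv ℝ (chr G) z w u v + fderiv ℝ (fderiv ℝ ψ) z w u • v
      + fderiv ℝ (fderiv ℝ ψ) z w v • u - fderiv ℝ (met G) z w u v • grad ψ G z
      - met G z u v • fderiv ℝ (grad ψ G) z w := by
  rw [← fderiv_clm_const₂ (h.source.diff_chr hz),
    fderiv_congr_of_isOpen h.target.isOpen (fun y hy => h.chr_eq hy u v) hz]
  have d1 : ∀ u, HasFDerivAt (fun y => fderiv ℝ ψ y u) ((fderiv ℝ (fderiv ℝ ψ) z).flip u) z := by
    intro u
    simpa using (h.diff_fderiv hz).hasFDerivAt.clm_apply (hasFDerivAt_const u z)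
  have d2 : DifferentiableAt ℝ (fun y => met G y u v) z :=
    ((h.target.diff_met hz).clm_apply (differentiableAt_const _)).clm_apply
      (differentiableAt_const _)
  have d3 : DifferentiableAt ℝ (fun y => chr G y u v) z :=
    ((h.target.diff_chr hz).clm_apply (differentiableAt_const _)).clm_apply
      (differentiableAt_const _)
  rw [(((d3.hasFDerivAt.fun_add ((d1 u).smul_const v)).fun_add ((d1 v).smul_const u)).fun_sub
    (d2.hasFDerivAt.fun_smul (h.diff_grad hz).hasFDerivAt)).fderiv]
  simp only [sub_apply, add_apply, smul_apply, ContinuousLinearMap.smulRight_apply,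
    ContinuousLinearMap.flip_apply, fderiv_clm_const₂ (h.target.diff_met hz),
    fderiv_clm_const₂ (h.target.diff_chr hz)]
  module

/-- The conformal change of the curvature. -/
lemma curv_eq (u v w : E4) : curv G' z u v w = curv G z u v w
    + met G z u w • schoutenChangeVec ψ G z v - met G z v w • schoutenChangeVec ψ G z u
    + schoutenChange ψ G z u w • v - schoutenChange ψ G z v w • u := by
  -- Partial derivatives of dψ and of grad ψ are traded for covariant ones, after which the
  -- remaining Christoffel terms cancel.
  have e1 : ∀ u v, fderiv ℝ (fderiv ℝ ψ) z u v = hess ψ G z u v + fderiv ℝ ψ z (chr G z u v) :=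
    fun u v => by rw [hess]; ring
  have e2 : ∀ u, fderiv ℝ (grad ψ G) z u = nablaGrad ψ G z u - chr G z u (grad ψ G z) :=
    fun u => by rw [nablaGrad]; abel
  simp only [curv, h.chr_eq hz, h.fderiv_chr hz, e1, e2, h.target.compat hz, schoutenChange,
    schoutenChangeVec, map_sub, map_add, map_smul, smul_eq_mul]
  simp only [h.hess_symm hz v u, h.target.met_symm hz v u,
    h.target.chr_symm hz v u, h.target.met_symm hz u (grad ψ G z),
    h.target.met_symm hz v (grad ψ G z),
    h.met_grad hz]
  rw [h.target.met_symm hz u (chr G z v w), h.target.met_symm hz v (chr G z u w)]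
  module

lemma invMetric_eq (a b : Fin 4) :
    invMetric G' z a b = Real.exp (-(2 * ψ z)) * invMetric G z a b := by
  have e : G' z = Real.exp (2 * ψ z) • G z := by
    ext a b
    have := h.met_eq z hz (bv a) (bv b)
    rwa [met_bv, met_bv] at this
  have e' : (G' z)⁻¹ = Real.exp (-(2 * ψ z)) • (G z)⁻¹ := by
    refine Matrix.inv_eq_left_inv ?_
    rw [e, Matrix.smul_mul, Matrix.mul_smul, Matrix.nonsing_inv_mul _ (h.target.det z hz),
      smul_smul, ← Real.exp_add]
    simp
  rw [invMetric, e']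
  rfl

lemma contr_eq (B : E4 → E4 → ℝ) : contr G' z B = Real.exp (-(2 * ψ z)) * contr G z B := by
  simp only [contr, h.invMetric_eq hz, Finset.mul_sum, mul_assoc]

/-- The trace of the formula for the curvature. The coefficient 2 is n - 2 for n = 4: the trace of g
gives 4, and two further terms each take away one. -/
lemma ric_eq (u w : E4) : ric G' z u w = ric G z u w + 2 * schoutenChange ψ G z u w
    + contr G z (schoutenChange ψ G z) * met G z u w := by
  have e1 : ∀ x y, met G' z (curv G' z u x w) y = Real.exp (2 * ψ z) *
      (met G z (curv G z u x w) y + met G z u w * schoutenChange ψ G z x y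
        - met G z x w * met G z (schoutenChangeVec ψ G z u) y
        + schoutenChange ψ G z u w * met G z x y
        - schoutenChange ψ G z x w * met G z u y) := by
    intro x y
    simp only [h.met_eq z hz, h.curv_eq hz, map_add, map_sub, map_smul, add_apply, sub_apply,
      smul_apply, smul_eq_mul, h.met_schoutenChangeVec hz]
    ring
  have l1 : IsLinearMap ℝ fun x => met G z x w := by constructor <;> intros <;> simp
  have l2 : IsLinearMap ℝ fun x => schoutenChange ψ G z x w := by
    constructor <;> intros <;> simp only [schoutenChange, hess, map_add, map_smul, add_apply,
      smul_apply, smul_eq_mul] <;> ring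
  simp only [ric, e1]
  rw [h.contr_eq hz, contr_mul, ← mul_assoc, ← Real.exp_add, contr_sub, contr_add, contr_sub,
    contr_add, contr_mul, contr_mul, h.target.contr_met hz, h.target.contr_met_right hz _ l1,
    h.target.contr_met_right hz _ l2, h.met_schoutenChangeVec hz, neg_add_cancel, Real.exp_zero]
  ring

lemma scalar_eq : contr G' z (ric G' z) = Real.exp (-(2 * ψ z)) *
    (contr G z (ric G z) + 6 * contr G z (schoutenChange ψ G z)) := by
  rw [h.contr_eq hz]
  have : ric G' z = fun u w => ric G z u w + 2 * schoutenChange ψ G z u w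
    + contr G z (schoutenChange ψ G z) * met G z u w := by
    funext u w
    exact h.ric_eq hz u w
  rw [this, contr_add, contr_add, contr_mul, contr_mul, h.target.contr_met hz]
  ring

/-- The conformal change of the Schouten tensor. -/
lemma sch_eq (u v : E4) : sch G' z u v = sch G z u v + schoutenChange ψ G z u v := by
  rw [h.source.sch_eq hz, h.target.sch_eq hz, h.scalar_eq hz, h.ric_eq hz, h.met_eq z hz]
  have : Real.exp (-(2 * ψ z)) * Real.exp (2 * ψ z) = 1 := by
    rw [← Real.exp_add]
    simp
  -- The trace part of the new Ricci tensor cancels against R/6, because the scalar curvature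
  -- changes by 2(n - 1) = 6 times the trace of `schoutenChange`.
  linear_combination (-1 / 12 * (contr G z (ric G z) + 6 * contr G z (schoutenChange ψ G z))
    * met G z u v) * this

/-- The Weyl tensor is conformally invariant. -/
lemma weylForm_eq (u v w x : E4) :
    weylForm G' z u v w x = Real.exp (2 * ψ z) * weylForm G z u v w x := by
  -- The curvature changes by the Kulkarni–Nomizu type product of g with `schoutenChange`, which is
  -- exactly the change of the Schouten terms subtracted in the Weyl tensor.
  simp only [weylForm, h.curv_eq hz, h.sch_eq hz, h.met_eq z hz, map_add, map_sub, map_smul,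
    add_apply, sub_apply, smul_apply, smul_eq_mul, h.met_schoutenChangeVec hz]
  rw [h.schoutenChange_symm hz x u, h.schoutenChange_symm hz x v]
  ring

lemma fderiv_hess (t u v : E4) : fderiv ℝ (fun y => hess ψ G y u v) z t
    = fderiv ℝ (fderiv ℝ (fderiv ℝ ψ)) z t u v - fderiv ℝ (fderiv ℝ ψ) z t (chr G z u v)
      - fderiv ℝ ψ z (fderiv ℝ (chr G) z t u v) := by
  have d3 : DifferentiableAt ℝ (fun y => chr G y u v) z :=
    ((h.target.diff_chr hz).clm_apply (differentiableAt_const _)).clm_apply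
      (differentiableAt_const _)
  unfold hess
  rw [fderiv_fun_sub (((h.diff_fderiv₂ hz).clm_apply (differentiableAt_const _)).clm_apply
    (differentiableAt_const _)) ((h.diff_fderiv hz).clm_apply d3), sub_apply,
    fderiv_clm_const₂ (h.diff_fderiv₂ hz), fderiv_clm_apply₁ (h.diff_fderiv hz) d3,
    fderiv_clm_const₂ (h.target.diff_chr hz)]
  ring

lemma fderiv_schoutenChange (t u v : E4) : fderiv ℝ (fun y => schoutenChange ψ G y u v) z t
    = - fderiv ℝ (fun y => hess ψ G y u v) z t
      + fderiv ℝ (fderiv ℝ ψ) z t u * fderiv ℝ ψ z v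
      + fderiv ℝ ψ z u * fderiv ℝ (fderiv ℝ ψ) z t v
      - 1 / 2 * (fderiv ℝ (fderiv ℝ ψ) z t (grad ψ G z)
        + fderiv ℝ ψ z (fderiv ℝ (grad ψ G) z t)) * met G z u v
      - 1 / 2 * fderiv ℝ ψ z (grad ψ G z) * fderiv ℝ (met G) z t u v := by
  have d1 : ∀ u, HasFDerivAt (fun y => fderiv ℝ ψ y u) ((fderiv ℝ (fderiv ℝ ψ) z).flip u) z := by
    intro u
    simpa using (h.diff_fderiv hz).hasFDerivAt.clm_apply (hasFDerivAt_const u z)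
  have d2 : DifferentiableAt ℝ (fun y => met G y u v) z :=
    ((h.target.diff_met hz).clm_apply (differentiableAt_const _)).clm_apply
      (differentiableAt_const _)
  have d3 : DifferentiableAt ℝ (fun y => hess ψ G y u v) z :=
    (((h.diff_fderiv₂ hz).clm_apply (differentiableAt_const _)).clm_apply
      (differentiableAt_const _)).sub ((h.diff_fderiv hz).clm_apply
      (((h.target.diff_chr hz).clm_apply (differentiableAt_const _)).clm_apply
        (differentiableAt_const _)))
  have d4 := (h.diff_fderiv hz).hasFDerivAt.clm_apply (h.diff_grad hz).hasFDerivAt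
  unfold schoutenChange
  rw [((d3.hasFDerivAt.fun_neg.fun_add ((d1 u).fun_mul (d1 v))).fun_sub
    ((d4.const_mul (1 / 2)).fun_mul d2.hasFDerivAt)).fderiv]
  simp only [sub_apply, add_apply, neg_apply, smul_apply, ContinuousLinearMap.flip_apply,
    ContinuousLinearMap.comp_apply, smul_eq_mul, fderiv_clm_const₂ (h.target.diff_met hz)]
  ring

lemma fderiv_sch (t u v : E4) : fderiv ℝ (sch G') z t u v
    = fderiv ℝ (sch G) z t u v + fderiv ℝ (fun y => schoutenChange ψ G y u v) z t := by
  have d1 : DifferentiableAt ℝ (fun y => sch G y u v) z :=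
    ((h.target.diff_sch hz).clm_apply (differentiableAt_const _)).clm_apply
      (differentiableAt_const _)
  have d2 : DifferentiableAt ℝ (fun y => sch G' y u v) z :=
    ((h.source.diff_sch hz).clm_apply (differentiableAt_const _)).clm_apply
      (differentiableAt_const _)
  have : fderiv ℝ (fun y => schoutenChange ψ G y u v) z
      = fderiv ℝ (fun y => sch G' y u v - sch G y u v) z :=
    fderiv_congr_of_isOpen h.target.isOpen (fun y hy => by rw [h.sch_eq hy]; ring) hz
  rw [this, fderiv_fun_sub d2 d1, sub_apply, fderiv_clm_const₂ (h.target.diff_sch hz),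
    fderiv_clm_const₂ (h.source.diff_sch hz)]
  ring

/-- The conformal change of the antisymmetrised derivative of the Schouten tensor. -/
lemma cot_eq (u v w : E4) :
    cot G' z u v w = cot G z u v w - 1 / 2 * weylForm G z u v w (grad ψ G z) := by
  have e1 : ∀ u v, fderiv ℝ (fderiv ℝ ψ) z u v = hess ψ G z u v + fderiv ℝ ψ z (chr G z u v) :=
    fun u v => by rw [hess]; ring
  have e2 : ∀ u, fderiv ℝ (grad ψ G) z u = nablaGrad ψ G z u - chr G z u (grad ψ G z) :=
    fun u => by rw [nablaGrad]; abel
  have e3 : fderiv ℝ (fderiv ℝ (fderiv ℝ ψ)) z v u w =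
      fderiv ℝ (fderiv ℝ (fderiv ℝ ψ)) z u v w := by
    rw [fderiv_fderiv_comm h.smooth_fderiv h.target.isOpen hz u v]
  have e4 : ∀ u, fderiv ℝ ψ z (nablaGrad ψ G z u) = hess ψ G z u (grad ψ G z) := by
    intro u
    rw [← h.met_grad hz, h.target.met_symm hz, h.met_nablaGrad hz]
  have e5 : ∀ u, met G z u (grad ψ G z) = fderiv ℝ ψ z u := by
    intro u
    rw [h.target.met_symm hz, h.met_grad hz]
  have e6 : ∀ u v w, hess ψ G z u (v + w) = hess ψ G z u v + hess ψ G z u w := by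
    intro u v w
    simp only [hess, map_add]
    ring
  have e7 : ∀ u v w, hess ψ G z u (v - w) = hess ψ G z u v - hess ψ G z u w := by
    intro u v w
    simp only [hess, map_sub]
    ring
  have e8 : ∀ (u v : E4) (c : ℝ), hess ψ G z u (c • v) = c * hess ψ G z u v := by
    intro u v c
    simp only [hess, map_smul, smul_eq_mul]
    ring
  -- Antisymmetrising ∇ Hess ψ gives the curvature applied to grad ψ, by the Ricci identity. The
  -- change of connection acting on the old Schouten tensor supplies the trace terms that complete
  -- it to the Weyl tensor, and all terms without curvature cancel.
  simp only [cot, weylForm, h.fderiv_sch hz, h.fderiv_schoutenChange hz, h.fderiv_hess hz]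
  simp only [e3, e1, e2, h.sch_eq hz, h.chr_eq hz, e5, h.target.compat hz, map_add, map_sub,
    map_smul, add_apply,
    sub_apply, smul_eq_mul, e4, schoutenChange, curv, e6, e7, e8]
  simp only [h.target.chr_symm hz v u, h.hess_symm hz v u, h.target.met_symm hz v u,
    h.target.sch_symm hz v u, h.target.sch_symm hz _ (grad ψ G z)]
  ring

end IsConformalOn

/-! ### The conformal change of `Λ` -/

namespace IsMetricOn

variable {G : E4 → Matrix (Fin 4) (Fin 4) ℝ} {U : Set E4} (h : IsMetricOn G U) {z : E4}
  (hz : z ∈ U)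
include h hz

omit h hz in
lemma _root_.ConformalConcomitant.weylForm_antisymm₁ (u v w x : E4) :
    weylForm G z u v w x = - weylForm G z v u w x := by
  rw [weylForm, weylForm, curv_antisymm, map_neg, neg_apply]
  ring

lemma weylForm_pair_symm (u v w x : E4) : weylForm G z u v w x = weylForm G z w x u v := by
  rw [weylForm, weylForm, h.curv_pair_symm hz, h.sch_symm hz x v, h.sch_symm hz v x,
    h.sch_symm hz x u, h.sch_symm hz v w, h.met_symm hz u w, h.met_symm hz v w,
    h.met_symm hz v x, h.met_symm hz u x, h.sch_symm hz u w]
  ring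

lemma weylForm_antisymm₂ (u v w x : E4) : weylForm G z u v w x = - weylForm G z u v x w := by
  rw [h.weylForm_pair_symm hz, weylForm_antisymm₁, h.weylForm_pair_symm hz]

/-- In dimension four the trace of the Schouten tensor is R/6, and the subtracted terms contract to
2L + (R/6) g, which is the Ricci tensor. -/
lemma weylForm_trace (u w : E4) : contr G z (fun x y => weylForm G z u x w y) = 0 := by
  have l1 : IsLinearMap ℝ fun x => met G z x w := by constructor <;> intros <;> simp
  have l2 : IsLinearMap ℝ fun x => sch G z x w := by constructor <;> intros <;> simp
  have e1 : contr G z (fun x y => sch G z y x) = 1 / 6 * contr G z (ric G z) := by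
    have : (fun x y => sch G z y x) = fun x y =>
        1 / 2 * (ric G z x y - 1 / 6 * contr G z (ric G z) * met G z x y) := by
      funext x y
      rw [h.sch_symm hz, h.sch_eq hz]
    rw [this, contr_mul, contr_sub, contr_mul, h.contr_met hz]
    ring
  have e2 : ∀ x y, weylForm G z u x w y = met G z (curv G z u x w) y
      - (met G z u w * sch G z y x - sch G z u y * met G z x w)
      - (sch G z u w * met G z x y - sch G z x w * met G z u y) := by
    intro x y
    rw [weylForm, h.sch_symm hz y u]
    ring
  have e3 : contr G z (fun x y => sch G z u y * met G z x w) = sch G z u w := by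
    rw [h.contr_swap hz, ← h.contr_met_right hz (sch G z u) (by constructor <;> intros <;> simp) w]
    congr 1
    funext x y
    rw [h.met_symm hz]
  simp only [e2]
  rw [contr_sub, contr_sub, contr_sub, contr_sub, contr_mul, contr_mul, e1, e3, h.contr_met hz,
    h.contr_met_right hz _ l2, ← ric, h.sch_eq hz]
  ring

/-- This is `quadratic_identity` for the mixed tensor C_{ab}{}^{cd}. It evaluates the term that
`cot_eq` adds to the numerator of Λ. -/
lemma contr_weylForm_weylForm (u s : E4) :
    contr G z (fun a a' => contr G z fun m m' => contr G z fun p p' =>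
      weylForm G z u a m p * weylForm G z m' p' a' s) = - (1 / 4) * weylSq G z * met G z u s := by
  let C : Fin 4 → Fin 4 → Fin 4 → Fin 4 → ℝ := fun a b c d =>
    weylForm G z (bv a) (bv b) (bv c) (bv d)
  -- With the second index pair raised, every contraction is a plain sum and the quadratic identity
  -- applies in any signature.
  let X : Fin 4 → Fin 4 → Fin 4 → Fin 4 → ℝ := fun a b c d =>
    ∑ c', ∑ d', invMetric G z c c' * (invMetric G z d d' * C a b c' d')
  have hX1 : ∀ a b c d, X a b c d = - X b a c d := by
    intro a b c d
    simp only [X, ← Finset.sum_neg_distrib]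
    refine Finset.sum_congr rfl fun c' _ => Finset.sum_congr rfl fun d' _ => ?_
    simp only [C]
    rw [weylForm_antisymm₁]
    ring
  have hX2 : ∀ a b c d, X a b c d = - X a b d c := by
    intro a b c d
    simp only [X, ← Finset.sum_neg_distrib]
    rw [Finset.sum_comm]
    refine Finset.sum_congr rfl fun c' _ => Finset.sum_congr rfl fun d' _ => ?_
    simp only [C]
    rw [h.weylForm_antisymm₂ hz]
    ring
  have hX3 : ∀ a c, ∑ b, X a b c b = 0 := by
    intro a c
    simp only [X]
    rw [Finset.sum_comm]
    refine Finset.sum_eq_zero fun c' _ => ?_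
    simp only [← Finset.mul_sum]
    have := h.weylForm_trace hz (bv a) (bv c')
    rw [contr] at this
    simp only [C, this, mul_zero]
  have hq := quadratic_identity X hX1 hX2 hX3
  have htr : weylSq G z = ∑ a, ∑ b, ∑ m, ∑ p, X a b m p * X m p a b := by
    rw [h.weylSq_eq hz]
    simp only [contr, X]
    simp only [Finset.mul_sum]
    simp only [Finset.sum_mul]
    refine Finset.sum_congr rfl fun a _ => ?_
    rw [Finset.sum_comm]
    refine Finset.sum_congr rfl fun b _ => ?_
    rw [sum_move₃]
    refine Finset.sum_congr rfl fun m _ => ?_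
    conv_lhs => enter [2, a']; rw [sum_move₃]
    rw [Finset.sum_comm]
    refine Finset.sum_congr rfl fun p _ => Finset.sum_congr rfl fun a' _ =>
      Finset.sum_congr rfl fun b' _ => Finset.sum_congr rfl fun c _ =>
      Finset.sum_congr rfl fun d _ => ?_
    simp only [C]
    rw [h.weylForm_pair_symm hz (bv m), h.inv_symm hz c m, h.inv_symm hz d p]
    ring
  have hY : ∀ m p a e, ∑ a', invMetric G z a a' * C m p a' e = ∑ f, X m p a f * G z f e := by
    intro m p a e
    simp only [X, Finset.sum_mul]
    rw [Finset.sum_comm]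
    refine Finset.sum_congr rfl fun a' _ => ?_
    rw [Finset.sum_comm]
    have : ∀ d', ∑ f, invMetric G z a a' * (invMetric G z f d' * C m p a' d') * G z f e
        = invMetric G z a a' * C m p a' d' * if d' = e then 1 else 0 := by
      intro d'
      rw [← h.sum_inv_mul hz, Finset.mul_sum]
      refine Finset.sum_congr rfl fun f _ => ?_
      rw [h.inv_symm hz f d']
      ring
    simp [this]
  have hq' : ∀ d f, ∑ a, ∑ m, ∑ p, X d a m p * X m p f a
      = if d = f then 1 / 4 * weylSq G z else 0 := fun d f => by rw [hq, htr]
  have hbasis : ∀ d e, contr G z (fun a a' => contr G z fun m m' => contr G z fun p p' =>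
      weylForm G z (bv d) a m p * weylForm G z m' p' a' (bv e))
      = - (1 / 4) * weylSq G z * met G z (bv d) (bv e) := by
    intro d e
    have h1 : contr G z (fun a a' => contr G z fun m m' => contr G z fun p p' =>
      weylForm G z (bv d) a m p * weylForm G z m' p' a' (bv e))
        = ∑ a, ∑ m, ∑ p, X d a m p * ∑ a', invMetric G z a a' * C m p a' e := by
      simp only [contr, X]
      simp only [Finset.mul_sum]
      simp only [Finset.sum_mul]
      refine Finset.sum_congr rfl fun a _ => ?_
      conv_lhs => enter [2, a']; rw [Finset.sum_comm]
      rw [Finset.sum_comm]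
      refine Finset.sum_congr rfl fun m _ => ?_
      conv_lhs => enter [2, a']; rw [sum_move₂]
      rw [Finset.sum_comm]
      refine Finset.sum_congr rfl fun p _ => Finset.sum_congr rfl fun a' _ =>
        Finset.sum_congr rfl fun c _ => Finset.sum_congr rfl fun d' _ => ?_
      rw [h.inv_symm hz c m, h.inv_symm hz d' p]
      ring
    have h2 : ∑ a, ∑ m, ∑ p, X d a m p * ∑ a', invMetric G z a a' * C m p a' e
        = - ∑ f, (∑ a, ∑ m, ∑ p, X d a m p * X m p f a) * G z f e := by
      simp only [hY, Finset.mul_sum, Finset.sum_mul, ← Finset.sum_neg_distrib]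
      conv_rhs => rw [← sum_move₃]
      refine Finset.sum_congr rfl fun a _ => Finset.sum_congr rfl fun m _ =>
        Finset.sum_congr rfl fun p _ => Finset.sum_congr rfl fun f _ => ?_
      -- The last two indices occur in the opposite order from the quadratic identity; this is the
      -- source of the minus sign.
      rw [hX2 m p a f]
      ring
    rw [h1, h2, met_bv]
    simp only [hq', ite_mul, zero_mul, Finset.sum_ite_eq, Finset.mem_univ, if_true]
    ring
  refine isLinearMap_ext (f := fun u => contr G z (fun a a' => contr G z fun m m' =>
      contr G z fun p p' => weylForm G z u a m p * weylForm G z m' p' a' s))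
    (g := fun u => - (1 / 4) * weylSq G z * met G z u s) ?_ ?_ (fun d => ?_) u
  · refine contr_isLinearMap fun _ _ => contr_isLinearMap fun _ _ => contr_isLinearMap fun _ _ => ?_
    constructor <;> intros <;> simp only [(weylForm_linear₁ _ _ _).map_add,
      (weylForm_linear₁ _ _ _).map_smul, smul_eq_mul] <;> ring
  · constructor <;> intros <;> simp <;> ring
  refine isLinearMap_ext (f := fun s => contr G z (fun a a' => contr G z fun m m' =>
      contr G z fun p p' => weylForm G z (bv d) a m p * weylForm G z m' p' a' s))
    (g := fun s => - (1 / 4) * weylSq G z * met G z (bv d) s) ?_ ?_ (hbasis d) s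
  · refine contr_isLinearMap fun _ _ => contr_isLinearMap fun _ _ => contr_isLinearMap fun _ _ => ?_
    constructor <;> intros <;> simp only [(weylForm_linear₄ _ _ _).map_add,
      (weylForm_linear₄ _ _ _).map_smul, smul_eq_mul] <;> ring
  · constructor <;> intros <;> simp <;> ring

end IsMetricOn

namespace IsConformalOn

variable {ψ : E4 → ℝ} {G G' : E4 → Matrix (Fin 4) (Fin 4) ℝ} {U : Set E4}
  (h : IsConformalOn ψ G' G U) {z : E4} (hz : z ∈ U)
include h hz

lemma weylSq_eq : weylSq G' z = Real.exp (-(2 * ψ z)) ^ 2 * weylSq G z := by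
  have e : Real.exp (-(2 * ψ z)) * Real.exp (2 * ψ z) = 1 := by rw [← Real.exp_add]; simp
  rw [h.source.weylSq_eq hz, h.target.weylSq_eq hz]
  have : ∀ a b c d a' b' c' d', weylForm G' z a b c d * weylForm G' z a' b' c' d'
      = Real.exp (2 * ψ z) ^ 2 * (weylForm G z a b c d * weylForm G z a' b' c' d') := by
    intros
    rw [h.weylForm_eq hz, h.weylForm_eq hz]
    ring
  simp only [this, h.contr_eq hz, contr_mul]
  generalize contr G z _ = W
  linear_combination (Real.exp (-(2 * ψ z)) ^ 2 * W *
    (1 + Real.exp (-(2 * ψ z)) * Real.exp (2 * ψ z))) * e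

lemma lamNum_eq (u : E4) : lamNum G' z u
    = Real.exp (-(2 * ψ z)) ^ 2 * (lamNum G z u + 1 / 8 * weylSq G z * fderiv ℝ ψ z u) := by
  have e : Real.exp (-(2 * ψ z)) * Real.exp (2 * ψ z) = 1 := by rw [← Real.exp_add]; simp
  have : ∀ u a m p m' p' a', weylForm G' z u a m p * cot G' z m' p' a'
      = Real.exp (2 * ψ z) * (weylForm G z u a m p * cot G z m' p' a'
        - 1 / 2 * (weylForm G z u a m p * weylForm G z m' p' a' (grad ψ G z))) := by
    intros
    rw [h.weylForm_eq hz, h.cot_eq hz]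
    ring
  unfold lamNum
  simp only [this, h.contr_eq hz, contr_mul, contr_sub]
  rw [h.target.contr_weylForm_weylForm hz, h.target.met_symm hz, h.met_grad hz]
  generalize contr G z _ = W
  linear_combination (Real.exp (-(2 * ψ z)) ^ 2 * (W + 1 / 8 * weylSq G z * fderiv ℝ ψ z u)) * e

/-- The conformal change of `Λ`. -/
lemma lam_eq (hW : weylSq G z ≠ 0) (d : Fin 4) :
    lam G' z d = lam G z d + fderiv ℝ ψ z (bv d) := by
  rw [h.source.lam_eq hz, h.target.lam_eq hz, h.lamNum_eq hz, h.weylSq_eq hz]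
  have := Real.exp_ne_zero (-(2 * ψ z))
  field_simp

end IsConformalOn

/-! ### The Weyl connection defined by `Λ` -/

/-- The connection coefficients `Γ^c_{ab} - Λ_a δ_b^c - Λ_b δ_a^c + g_{ab} g^{cd} Λ_d`. -/
def weylConn (G : E4 → Matrix (Fin 4) (Fin 4) ℝ) (z : E4) (c a b : Fin 4) : ℝ :=
  christoffel G z c a b - (lam G z a * delta b c + lam G z b * delta a c - G z b a * lamUp G z c)

/-- The covariant derivative defined by connection coefficients. -/
def connDeriv (Γ : E4 → Fin 4 → Fin 4 → Fin 4 → ℝ) {p q : ℕ}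
    (T : E4 → (Fin p → Fin 4) → (Fin q → Fin 4) → ℝ) (z : E4) (a : Fin 4)
    (A : Fin p → Fin 4) (B : Fin q → Fin 4) : ℝ :=
  pderiv a (fun y => T y A B) z
    + ∑ j : Fin p, ∑ c, Γ z (A j) a c * T z (Function.update A j c) B
    - ∑ j : Fin q, ∑ c, Γ z c a (B j) * T z A (Function.update B j c)

/-- The conformal pseudo-differential is the covariant derivative of the Weyl connection plus
`s Λ_a`. -/
lemma pseudoDiffComponents_eq (G : E4 → Matrix (Fin 4) (Fin 4) ℝ) {p q : ℕ}
    (hpq : (p, q) ≠ (0, 0)) (s : ℤ) (T : E4 → (Fin p → Fin 4) → (Fin q → Fin 4) → ℝ) (z : E4)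
    (a : Fin 4) (A : Fin p → Fin 4) (B : Fin q → Fin 4) :
    pseudoDiffComponents G s T z a A B
      = connDeriv (weylConn G) T z a A B + s * lam G z a * T z A B := by
  have hr : ((p : ℝ) + q) ≠ 0 := by
    have : p + q ≠ 0 := fun h => hpq (by
      have h1 : p = 0 := by omega
      have h2 : q = 0 := by omega
      rw [h1, h2])
    exact_mod_cast this
  have e1 : ∀ j : Fin p, ∑ c, coeffMbar G (p + q) s z (A j) a c * T z (Function.update A j c) B
      = s / (p + q) * lam G z a * T z A B
        + ∑ c, (weylConn G z (A j) a c - christoffel G z (A j) a c)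
          * T z (Function.update A j c) B := by
    intro j
    have : s / (p + q) * lam G z a * T z A B = ∑ c, s / (p + q) * lam G z a * delta c (A j)
        * T z (Function.update A j c) B := by
      simp [delta]
    rw [this, ← Finset.sum_add_distrib]
    refine Finset.sum_congr rfl fun c _ => ?_
    rw [coeffMbar, weylConn]
    push_cast
    rw [sub_div, div_self hr]
    ring
  have e2 : ∀ j : Fin q, ∑ c, coeffM G (p + q) s z c a (B j) * T z A (Function.update B j c)
      = s / (p + q) * lam G z a * T z A B
        - ∑ c, (weylConn G z c a (B j) - christoffel G z c a (B j))
          * T z A (Function.update B j c) := by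
    intro j
    have : s / (p + q) * lam G z a * T z A B = ∑ c, s / (p + q) * lam G z a * delta (B j) c
        * T z A (Function.update B j c) := by
      simp [delta]
    rw [this, ← Finset.sum_sub_distrib]
    refine Finset.sum_congr rfl fun c _ => ?_
    rw [coeffM, weylConn]
    push_cast
    rw [add_div, div_self hr]
    ring
  -- The p + q slots contribute s/(p + q) each, whether contravariant or covariant.
  have e3 : (s : ℝ) * lam G z a * T z A B
      = p * (s / (p + q) * lam G z a * T z A B) + q * (s / (p + q) * lam G z a * T z A B) := by
    rw [← add_mul]
    field_simp
  simp only [pseudoDiffComponents, covDeriv, connDeriv, e1, e2, e3, Finset.sum_add_distrib,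
    Finset.sum_sub_distrib, sub_mul, Finset.sum_const, Finset.card_univ, Fintype.card_fin,
    nsmul_eq_mul]
  ring

lemma sharp_apply (G : E4 → Matrix (Fin 4) (Fin 4) ℝ) (z : E4) (α : E4 →L[ℝ] ℝ) (c : Fin 4) :
    sharp G z α c = ∑ d, invMetric G z c d * α (bv d) := by
  simp [sharp, Pi.single_apply]

lemma sharp_linForm (G : E4 → Matrix (Fin 4) (Fin 4) ℝ) (z : E4) (c : Fin 4) :
    sharp G z (linForm (lam G z)) c = lamUp G z c := by
  simp only [sharp_apply, linForm_bv, lamUp]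

namespace IsConformalOn

variable {ψ : E4 → ℝ} {G G' : E4 → Matrix (Fin 4) (Fin 4) ℝ} {U : Set E4}
  (h : IsConformalOn ψ G' G U) {z : E4} (hz : z ∈ U)
include h hz

lemma lamUp_eq (hW : weylSq G z ≠ 0) (c : Fin 4) :
    lamUp G' z c = Real.exp (-(2 * ψ z)) * (lamUp G z c + grad ψ G z c) := by
  simp only [lamUp, h.lam_eq hz hW, h.invMetric_eq hz, grad, sharp_apply, ← Finset.sum_add_distrib,
    Finset.mul_sum]
  exact Finset.sum_congr rfl fun d _ => by ring

/-- The Weyl connection is conformally invariant. -/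
lemma weylConn_eq (hW : weylSq G z ≠ 0) (c a b : Fin 4) :
    weylConn G' z c a b = weylConn G z c a b := by
  have e : Real.exp (-(2 * ψ z)) * Real.exp (2 * ψ z) = 1 := by rw [← Real.exp_add]; simp
  have hG : G' z b a = Real.exp (2 * ψ z) * G z b a := by
    rw [← met_bv G', ← met_bv G, h.met_eq z hz]
  have hd : ∀ i j : Fin 4, bv i j = delta i j := by
    intro i j
    simp [delta, eq_comm]
  have hc : christoffel G' z c a b = christoffel G z c a b + fderiv ℝ ψ z (bv a) * delta b c
      + fderiv ℝ ψ z (bv b) * delta a c - G z b a * grad ψ G z c := by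
    rw [← chr_bv, ← chr_bv, h.chr_eq hz, met_bv, h.target.symm z hz a b, ← hd, ← hd]
    rfl
  rw [weylConn, weylConn, hc, hG, h.lam_eq hz hW, h.lam_eq hz hW, h.lamUp_eq hz hW]
  linear_combination (G z b a * (lamUp G z c + grad ψ G z c)) * e

/-- Conformal covariance of the pseudo-differential in coordinates. -/
lemma pseudoDiffComponents_eq (hW : weylSq G z ≠ 0) {p q : ℕ} (hpq : (p, q) ≠ (0, 0)) (s : ℤ)
    {T T' : E4 → (Fin p → Fin 4) → (Fin q → Fin 4) → ℝ}
    (hT : ∀ A B, ContDiffOn ℝ ∞ (fun z => T z A B) U)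
    (hT' : ∀ y ∈ U, ∀ A B, T' y A B = Real.exp (-(s * ψ y)) * T y A B)
    (a : Fin 4) (A : Fin p → Fin 4) (B : Fin q → Fin 4) :
    pseudoDiffComponents G' s T' z a A B
      = Real.exp (-(s * ψ z)) * pseudoDiffComponents G s T z a A B := by
  -- The derivative of the weight factor produces -s dψ T, which the shift of s Λ by s dψ
  -- compensates.
  have hp : pderiv a (fun y => T' y A B) z = Real.exp (-(s * ψ z)) *
      (pderiv a (fun y => T y A B) z - s * fderiv ℝ ψ z (bv a) * T z A B) := by
    rw [pderiv_congr h.target.isOpen (fun y hy => hT' y hy A B) hz]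
    have d1 : HasFDerivAt (fun y => Real.exp (-(s * ψ y)))
        (Real.exp (-(s * ψ z)) • -((s : ℝ) • fderiv ℝ ψ z)) z :=
      ((h.diff hz).hasFDerivAt.const_mul (s : ℝ)).fun_neg.exp
    have d2 := (ContDiffOn.differentiableAt_of_isOpen (hT A B) h.target.isOpen hz).hasFDerivAt
    simp only [pderiv]
    rw [(d1.fun_mul d2).fderiv]
    simp only [add_apply, smul_apply, neg_apply, smul_eq_mul]
    ring
  rw [ConformalConcomitant.pseudoDiffComponents_eq G' hpq,
    ConformalConcomitant.pseudoDiffComponents_eq G hpq, connDeriv, connDeriv, hp]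
  simp only [hT' z hz, h.weylConn_eq hz hW, h.lam_eq hz hW, mul_left_comm _ (Real.exp _),
    ← Finset.mul_sum]
  ring

end IsConformalOn

/-! ### Naturality of Λ and of the Weyl connection. -/

namespace IsIsometryOn

variable {φ : E4 → E4} {G G' : E4 → Matrix (Fin 4) (Fin 4) ℝ} {U U' : Set E4}
  (h : IsIsometryOn φ G' U' G U) {y : E4} (hy : y ∈ U')
include h hy

omit h hy in
lemma _root_.ConformalConcomitant.lamNum_isLinearMap (G : E4 → Matrix (Fin 4) (Fin 4) ℝ) (z : E4) :
    IsLinearMap ℝ (lamNum G z) := by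
  refine contr_isLinearMap fun _ _ => contr_isLinearMap fun _ _ => contr_isLinearMap fun _ _ => ?_
  constructor <;> intros <;> simp only [(weylForm_linear₁ _ _ _).map_add,
    (weylForm_linear₁ _ _ _).map_smul, smul_eq_mul] <;> ring

omit h hy in
lemma _root_.ConformalConcomitant.IsMetricOn.linForm_lam (h : IsMetricOn G U) {z : E4} (hz : z ∈ U)
    (u : E4) : linForm (lam G z) u = 8 * lamNum G z u / weylSq G z := by
  rw [IsLinearMap.sum_smul (lamNum_isLinearMap G z) u, linForm_apply, Finset.mul_sum,
    Finset.sum_div]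
  refine Finset.sum_congr rfl fun d _ => ?_
  rw [h.lam_eq hz, smul_eq_mul]
  ring

lemma linForm_lam_eq (u : E4) :
    linForm (lam G' y) u = linForm (lam G (φ y)) (fderiv ℝ φ y u) := by
  rw [h.source.linForm_lam hy, h.target.linForm_lam (h.mapsTo hy), h.lamNum_eq hy, h.weylSq_eq hy]

lemma sharp_lam_eq : fderiv ℝ φ y (sharp G' y (linForm (lam G' y)))
    = sharp G (φ y) (linForm (lam G (φ y))) := by
  refine h.target.met_ext (h.mapsTo hy) fun w => ?_
  obtain ⟨w, rfl⟩ := h.fderiv_surjective hy w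
  rw [← h.met_eq y hy, h.source.met_sharp hy, h.target.met_sharp (h.mapsTo hy),
    h.linForm_lam_eq hy]

omit h hy in
lemma _root_.ConformalConcomitant.IsMetricOn.bilinVec_weylConn (h : IsMetricOn G U) {z : E4}
    (hz : z ∈ U) (u v : E4) : bilinVec (weylConn G z) u v = chr G z u v
      - (linForm (lam G z) u • v + linForm (lam G z) v • u
        - met G z u v • sharp G z (linForm (lam G z))) := by
  refine isLinearMap_ext (f := fun u => bilinVec (weylConn G z) u v) (g := fun u => chr G z u v
      - (linForm (lam G z) u • v + linForm (lam G z) v • u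
        - met G z u v • sharp G z (linForm (lam G z)))) ?_ ?_ (fun a => ?_) u
  · constructor <;> intros <;> simp only [map_add, map_smul, add_apply, smul_apply]
  · constructor <;> intros <;> simp only [map_add, map_smul, add_apply, smul_apply, smul_eq_mul]
      <;> module
  refine isLinearMap_ext (f := fun v => bilinVec (weylConn G z) (bv a) v)
    (g := fun v => chr G z (bv a) v
      - (linForm (lam G z) (bv a) • v + linForm (lam G z) v • bv a
        - met G z (bv a) v • sharp G z (linForm (lam G z)))) ?_ ?_ (fun b => ?_) v
  · constructor <;> intros <;> simp only [map_add, map_smul]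
  · constructor <;> intros <;> simp only [map_add, map_smul, smul_eq_mul] <;> module
  ext c
  have hd : ∀ i j : Fin 4, delta i j = bv i j := by
    intro i j
    simp [delta, eq_comm]
  rw [bilinVec_bv, weylConn, ← sharp_linForm, ← chr_bv, hd, hd, ← h.symm z hz a b, ← met_bv G,
    ← linForm_bv (lam G z) a, ← linForm_bv (lam G z) b]
  rfl

/-- The transformation law of the Weyl connection. -/
lemma fderiv_weylConn (u v : E4) : fderiv ℝ φ y (bilinVec (weylConn G' y) u v)
    = bilinVec (weylConn G (φ y)) (fderiv ℝ φ y u) (fderiv ℝ φ y v)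
      + fderiv ℝ (fderiv ℝ φ) y u v := by
  rw [h.source.bilinVec_weylConn hy, h.target.bilinVec_weylConn (h.mapsTo hy)]
  simp only [map_sub, map_add, map_smul, h.fderiv_chr hy, h.sharp_lam_eq hy, h.linForm_lam_eq hy,
    h.met_eq y hy]
  abel

end IsIsometryOn

/-! ### Covariant derivatives of tensors under coordinate changes -/

section Slots

variable {ι : Type*} [Fintype ι] [DecidableEq ι]

/-- Exchanging the summation index with the i-th entry of the multi-index is an involution. It moves
the connection from the transition matrices to the tensor components. -/
lemma sum_update_swap (i : ι) (F : (ι → Fin 4) → Fin 4 → ℝ) :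
    ∑ K : ι → Fin 4, ∑ l, F (Function.update K i l) (K i) = ∑ K : ι → Fin 4, ∑ c, F K c := by
  rw [← Fintype.sum_prod_type', ← Fintype.sum_prod_type']
  let σ : (ι → Fin 4) × Fin 4 → (ι → Fin 4) × Fin 4 := fun x => (Function.update x.1 i x.2, x.1 i)
  have hσ : Function.Involutive σ := by
    rintro ⟨K, l⟩
    simp [σ]
  exact Equiv.sum_comp hσ.toPerm (fun x => F x.1 x.2)

/-- The covariant derivative of a tensor transforms tensorially, for tensors with an arbitrary
family of slots: in slot `i` the components change by the matrices `P i`, and the connection acts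
by `Ω i` and `Ω' i`. -/
lemma slot_deriv {J : E4 →L[ℝ] E4} {φ : E4 → E4} {y : E4} (hφ : HasFDerivAt φ J y)
    {T T' : E4 → (ι → Fin 4) → ℝ} (hT : ∀ K, DifferentiableAt ℝ (fun z => T z K) (φ y))
    {P : E4 → ι → Fin 4 → Fin 4 → ℝ} (hP : ∀ i k b, DifferentiableAt ℝ (fun z => P z i k b) y)
    (hTT : ∀ᶠ x in nhds y, ∀ B, T' x B = ∑ K : ι → Fin 4, (∏ i, P x i (K i) (B i)) * T (φ x) K)
    {Ω Ω' : ι → Fin 4 → Fin 4 → Fin 4 → ℝ} (a : Fin 4)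
    (hΩ : ∀ i k b, pderiv a (fun z => P z i k b) y
      = ∑ m, J (bv a) m * ∑ l, Ω i m k l * P y i l b - ∑ c, P y i k c * Ω' i a c b)
    (B : ι → Fin 4) :
    pderiv a (fun x => T' x B) y + ∑ i, ∑ c, Ω' i a c (B i) * T' y (Function.update B i c)
      = ∑ m, J (bv a) m * ∑ K : ι → Fin 4, (∏ i, P y i (K i) (B i)) *
        (pderiv m (fun x => T x K) (φ y)
          + ∑ i, ∑ c, Ω i m c (K i) * T (φ y) (Function.update K i c)) := by
  have hTy : ∀ B, T' y B = ∑ K : ι → Fin 4, (∏ i, P y i (K i) (B i)) * T (φ y) K := hTT.self_of_nhds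
  -- Leibniz rule: either the tensor is differentiated, along φ, or exactly one of the transition
  -- matrices.
  have hd : pderiv a (fun x => T' x B) y = ∑ K : ι → Fin 4,
      ((∏ i, P y i (K i) (B i)) * (∑ m, J (bv a) m * pderiv m (fun x => T x K) (φ y))
        + ∑ i, pderiv a (fun z => P z i (K i) (B i)) y
          * (∏ j ∈ Finset.univ.erase i, P y j (K j) (B j)) * T (φ y) K) := by
    have e1 : pderiv a (fun x => T' x B) y
        = pderiv a (fun x => ∑ K : ι → Fin 4, (∏ i, P x i (K i) (B i)) * T (φ x) K) y := by
      unfold pderiv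
      rw [Filter.EventuallyEq.fderiv_eq (hTT.mono fun x hx => hx B)]
    have e2 : ∀ K : ι → Fin 4, HasFDerivAt (fun x => T (φ x) K)
        ((fderiv ℝ (fun z => T z K) (φ y)).comp J) y := fun K =>
      HasFDerivAt.comp y (hT K).hasFDerivAt hφ
    have e3 : ∀ K : ι → Fin 4, HasFDerivAt (fun x => ∏ i, P x i (K i) (B i))
        (∑ i, (∏ j ∈ Finset.univ.erase i, P y j (K j) (B j)) •
          fderiv ℝ (fun z => P z i (K i) (B i)) y) y := fun K =>
      HasFDerivAt.finsetProd fun i _ => (hP i _ _).hasFDerivAt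
    have e4 : ∀ K : ι → Fin 4, fderiv ℝ (fun z => T z K) (φ y) (J (bv a))
        = ∑ m, J (bv a) m * pderiv m (fun x => T x K) (φ y) := by
      intro K
      conv_lhs => rw [← sum_bv (J (bv a))]
      simp [pderiv]
    rw [e1, pderiv, (HasFDerivAt.fun_sum fun K _ => (e3 K).fun_mul (e2 K)).fderiv]
    simp only [sum_apply, add_apply, smul_apply, smul_eq_mul, ContinuousLinearMap.comp_apply, e4,
      Finset.mul_sum]
    refine Finset.sum_congr rfl fun K _ => ?_
    congr 1
    exact Finset.sum_congr rfl fun i _ => by rw [pderiv]; ring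
  have hprod : ∀ (i : ι) (K B : ι → Fin 4), P y i (K i) (B i)
      * ∏ j ∈ Finset.univ.erase i, P y j (K j) (B j) = ∏ j, P y j (K j) (B j) :=
    fun i K B => Finset.mul_prod_erase _ (fun j => P y j (K j) (B j)) (Finset.mem_univ i)
  have herase : ∀ (i : ι) (K B : ι → Fin 4) (c : Fin 4),
      ∏ j ∈ Finset.univ.erase i, P y j (K j) (Function.update B i c j)
        = ∏ j ∈ Finset.univ.erase i, P y j (K j) (B j) := fun i K B c =>
    Finset.prod_congr rfl fun j hj => by rw [Function.update_of_ne (Finset.ne_of_mem_erase hj)]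
  have herase' : ∀ (i : ι) (K B : ι → Fin 4) (c : Fin 4),
      ∏ j ∈ Finset.univ.erase i, P y j (Function.update K i c j) (B j)
        = ∏ j ∈ Finset.univ.erase i, P y j (K j) (B j) := fun i K B c =>
    Finset.prod_congr rfl fun j hj => by rw [Function.update_of_ne (Finset.ne_of_mem_erase hj)]
  have h1 : ∀ i, ∑ c, Ω' i a c (B i) * T' y (Function.update B i c)
      = ∑ K : ι → Fin 4, (∑ c, P y i (K i) c * Ω' i a c (B i))
        * (∏ j ∈ Finset.univ.erase i, P y j (K j) (B j)) * T (φ y) K := by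
    intro i
    simp only [hTy, Finset.mul_sum, Finset.sum_mul]
    rw [Finset.sum_comm]
    refine Finset.sum_congr rfl fun K _ => Finset.sum_congr rfl fun c _ => ?_
    rw [← hprod i, herase, Function.update_self]
    ring
  have h2 : ∀ i, ∑ K : ι → Fin 4, (∑ m, J (bv a) m * ∑ l, Ω i m (K i) l * P y i l (B i))
        * (∏ j ∈ Finset.univ.erase i, P y j (K j) (B j)) * T (φ y) K
      = ∑ K : ι → Fin 4, ∑ m, J (bv a) m * ((∏ j, P y j (K j) (B j)) *
        ∑ c, Ω i m c (K i) * T (φ y) (Function.update K i c)) := by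
    intro i
    have : ∀ m, ∑ K : ι → Fin 4, ∑ l, Ω i m (K i) l * P y i l (B i)
        * (∏ j ∈ Finset.univ.erase i, P y j (K j) (B j)) * T (φ y) K
        = ∑ K : ι → Fin 4, ∑ c, (∏ j, P y j (K j) (B j)) *
          (Ω i m c (K i) * T (φ y) (Function.update K i c)) := by
      intro m
      rw [← sum_update_swap i]
      refine Finset.sum_congr rfl fun K _ => Finset.sum_congr rfl fun l _ => ?_
      rw [← hprod i, herase']
      simp only [Function.update_self]
      ring
    simp only [Finset.mul_sum, Finset.sum_mul] at this ⊢
    rw [Finset.sum_comm]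
    conv_rhs => rw [Finset.sum_comm]
    refine Finset.sum_congr rfl fun m _ => ?_
    have hm := congrArg (fun t => J (bv a) m * t) (this m)
    simp only [Finset.mul_sum] at hm
    rw [← hm]
    exact Finset.sum_congr rfl fun K _ => Finset.sum_congr rfl fun l _ => by ring
  rw [hd]
  -- The part of the matrix derivatives involving Ω' cancels the connection term on the left; the
  -- part involving Ω becomes the connection term on the right by `h2`.
  simp only [hΩ, sub_mul, Finset.sum_add_distrib, Finset.sum_sub_distrib, h1]
  rw [Finset.sum_comm (f := fun K i => (∑ c, P y i (K i) c * Ω' i a c (B i))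
        * (∏ j ∈ Finset.univ.erase i, P y j (K j) (B j)) * T (φ y) K),
    Finset.sum_comm (f := fun K i => (∑ m, J (bv a) m * ∑ l, Ω i m (K i) l * P y i l (B i))
        * (∏ j ∈ Finset.univ.erase i, P y j (K j) (B j)) * T (φ y) K)]
  simp only [h2, mul_add, Finset.sum_add_distrib, add_assoc, sub_add_cancel]
  congr 1
  · simp only [Finset.mul_sum]
    rw [Finset.sum_comm]
    exact Finset.sum_congr rfl fun m _ => Finset.sum_congr rfl fun K _ => by ring
  · simp only [Finset.mul_sum]
    conv_lhs => enter [2, i]; rw [Finset.sum_comm]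
    rw [Finset.sum_comm]
    refine Finset.sum_congr rfl fun m _ => ?_
    rw [Finset.sum_comm]

end Slots

/-- The components of the pullback of a tensor by a linear isomorphism. -/
def pullbackComponents (J : E4 →L[ℝ] E4) {p q : ℕ} (t : (Fin p → Fin 4) → (Fin q → Fin 4) → ℝ)
    (A : Fin p → Fin 4) (B : Fin q → Fin 4) : ℝ :=
  ∑ I : Fin p → Fin 4, ∑ K : Fin q → Fin 4,
    (∏ i, J.inverse (bv (I i)) (A i)) * (∏ j, J (bv (B j)) (K j)) * t I K

lemma sum_sum_elim {p q : ℕ} (F : (Fin p → Fin 4) → (Fin q → Fin 4) → ℝ) :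
    ∑ I, ∑ K, F I K = ∑ L : Fin p ⊕ Fin q → Fin 4, F (L ∘ Sum.inl) (L ∘ Sum.inr) := by
  rw [← Fintype.sum_prod_type']
  exact (Equiv.sum_comp (Equiv.sumArrowEquivProdArrow (Fin p) (Fin q) (Fin 4))
    (fun x => F x.1 x.2)).symm

lemma update_comp_inl {p q : ℕ} (L : Fin p ⊕ Fin q → Fin 4) (x : Fin p ⊕ Fin q) (c : Fin 4) :
    Function.update L x c ∘ Sum.inl = Sum.elim (fun i => Function.update (L ∘ Sum.inl) i c)
      (fun _ => L ∘ Sum.inl) x := by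
  cases x <;> ext i <;> simp [Function.update_apply]

lemma update_comp_inr {p q : ℕ} (L : Fin p ⊕ Fin q → Fin 4) (x : Fin p ⊕ Fin q) (c : Fin 4) :
    Function.update L x c ∘ Sum.inr = Sum.elim (fun _ => L ∘ Sum.inr)
      (fun j => Function.update (L ∘ Sum.inr) j c) x := by
  cases x <;> ext i <;> simp [Function.update_apply]

/-- The action of connection coefficients on the slots of a mixed tensor. -/
def slotConn (Γ : Fin 4 → Fin 4 → Fin 4 → ℝ) {p q : ℕ} :
    Fin p ⊕ Fin q → Fin 4 → Fin 4 → Fin 4 → ℝ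
  | Sum.inl _, a, c, b => Γ b a c
  | Sum.inr _, a, c, b => - Γ c a b

lemma connDeriv_eq_slot (Γ : E4 → Fin 4 → Fin 4 → Fin 4 → ℝ) {p q : ℕ}
    (T : E4 → (Fin p → Fin 4) → (Fin q → Fin 4) → ℝ) (z : E4) (a : Fin 4)
    (L : Fin p ⊕ Fin q → Fin 4) :
    connDeriv Γ T z a (L ∘ Sum.inl) (L ∘ Sum.inr)
      = pderiv a (fun y => T y (L ∘ Sum.inl) (L ∘ Sum.inr)) z
        + ∑ i, ∑ c, slotConn (Γ z) i a c (L i) * T z (Function.update L i c ∘ Sum.inl)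
          (Function.update L i c ∘ Sum.inr) := by
  simp only [connDeriv, update_comp_inl, update_comp_inr, Fintype.sum_sum_type, slotConn,
    Sum.elim_inl, Sum.elim_inr, neg_mul, Finset.sum_neg_distrib, Function.comp_apply]
  ring

/-! ### Coordinate invariance for mixed tensors. -/

namespace IsIsometryOn

variable {φ : E4 → E4} {G G' : E4 → Matrix (Fin 4) (Fin 4) ℝ} {U U' : Set E4}
  (h : IsIsometryOn φ G' U' G U) {y : E4} (hy : y ∈ U')
include h hy

/-- The derivative of a local isometry as an equivalence. -/
lemma exists_equiv : ∃ e : E4 ≃L[ℝ] E4, (e : E4 →L[ℝ] E4) = fderiv ℝ φ y := by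
  refine ⟨(LinearEquiv.ofBijective (fderiv ℝ φ y).toLinearMap
    ⟨h.fderiv_injective hy, h.fderiv_surjective hy⟩).toContinuousLinearEquiv, ?_⟩
  ext v
  rfl

lemma fderiv_inverse (v : E4) : fderiv ℝ φ y ((fderiv ℝ φ y).inverse v) = v := by
  obtain ⟨e, he⟩ := h.exists_equiv hy
  rw [← he, ContinuousLinearMap.inverse_equiv]
  simp

lemma diff_inverse : DifferentiableAt ℝ (fun y => (fderiv ℝ φ y).inverse) y := by
  obtain ⟨e, he⟩ := h.exists_equiv hy
  have := (contDiffAt_map_inverse (𝕜 := ℝ) (n := 1) e).differentiableAt (by simp)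
  rw [he] at this
  exact this.comp y (h.diff_fderiv hy)

/-- Differentiate dφ ∘ dφ⁻¹ = 1 and eliminate the second derivative of φ by the transformation law
of the Weyl connection. This is what the contravariant slots need. -/
lemma fderiv_inverse_apply (t v : E4) : fderiv ℝ (fun y => (fderiv ℝ φ y).inverse) y t v
    = (fderiv ℝ φ y).inverse (bilinVec (weylConn G (φ y)) (fderiv ℝ φ y t) v)
      - bilinVec (weylConn G' y) t ((fderiv ℝ φ y).inverse v) := by
  have d1 : DifferentiableAt ℝ (fun y => (fderiv ℝ φ y).inverse v) y :=
    (h.diff_inverse hy).clm_apply (differentiableAt_const _)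
  have e1 := fderiv_clm_apply₁ (h.diff_fderiv hy) d1 t
  rw [fderiv_congr_of_isOpen h.source.isOpen (fun y hy => h.fderiv_inverse hy v) hy,
    fderiv_clm_apply₁ (h.diff_inverse hy) (differentiableAt_const _)] at e1
  simp only [fderiv_fun_const, Pi.zero_apply, zero_apply, map_zero, zero_add] at e1
  have e2 := h.fderiv_weylConn hy t ((fderiv ℝ φ y).inverse v)
  rw [h.fderiv_inverse hy] at e2
  apply h.fderiv_injective hy
  rw [map_sub, h.fderiv_inverse hy, e2]
  rw [eq_comm, add_eq_zero_iff_eq_neg] at e1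
  rw [e1]
  abel

/-- Coordinate invariance of the conformal pseudo-differential. -/
lemma pseudoDiffComponents_eq {p q : ℕ} (hpq : (p, q) ≠ (0, 0)) (s : ℤ)
    {T T' : E4 → (Fin p → Fin 4) → (Fin q → Fin 4) → ℝ}
    (hT : ∀ A B, ContDiffOn ℝ ∞ (fun z => T z A B) U)
    (hTT : ∀ y ∈ U', ∀ A B, T' y A B = pullbackComponents (fderiv ℝ φ y) (T (φ y)) A B)
    (a : Fin 4) (A : Fin p → Fin 4) (B : Fin q → Fin 4) :
    pseudoDiffComponents G' s T' y a A B = ∑ m, fderiv ℝ φ y (bv a) m *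
      pullbackComponents (fderiv ℝ φ y) (pseudoDiffComponents G s T (φ y) m) A B := by
  let P : E4 → Fin p ⊕ Fin q → Fin 4 → Fin 4 → ℝ := fun y x k b =>
    Sum.elim (fun _ => (fderiv ℝ φ y).inverse (bv k) b) (fun _ => fderiv ℝ φ y (bv b) k) x
  have hpull : ∀ y (t : (Fin p → Fin 4) → (Fin q → Fin 4) → ℝ) (L : Fin p ⊕ Fin q → Fin 4),
      pullbackComponents (fderiv ℝ φ y) t (L ∘ Sum.inl) (L ∘ Sum.inr)
      = ∑ K : Fin p ⊕ Fin q → Fin 4, (∏ i, P y i (K i) (L i)) *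
        t (K ∘ Sum.inl) (K ∘ Sum.inr) := by
    intro y t L
    rw [pullbackComponents, sum_sum_elim]
    simp only [P, Fintype.prod_sum_type, Sum.elim_inl, Sum.elim_inr, Function.comp_apply]
  -- The hypotheses of `slot_deriv`: the law for dφ⁻¹ handles contravariant slots, and the law of
  -- the connection itself handles covariant ones.
  have dP : ∀ i k b, DifferentiableAt ℝ (fun z => P z i k b) y ∧ pderiv a (fun z => P z i k b) y
      = ∑ m, fderiv ℝ φ y (bv a) m * ∑ l, slotConn (weylConn G (φ y)) i m k l * P y i l b
        - ∑ c, P y i k c * slotConn (weylConn G' y) i a c b := by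
    have hproj : ∀ (f : E4 → E4) (b : Fin 4), DifferentiableAt ℝ f y →
        DifferentiableAt ℝ (fun z => f z b) y ∧ pderiv a (fun z => f z b) y
          = fderiv ℝ f y (bv a) b := by
      intro f b hf
      have := ((EuclideanSpace.proj b : E4 →L[ℝ] ℝ).hasFDerivAt (x := f y)).comp y hf.hasFDerivAt
      exact ⟨this.differentiableAt, by rw [pderiv]; exact congrArg (fun l => l (bv a)) this.fderiv⟩
    have hexp : ∀ (X : Fin 4 → Fin 4 → Fin 4 → ℝ) (u v : E4) (k : Fin 4),
        bilinVec X u v k = ∑ m, u m * ∑ l, X k m l * v l := by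
      intro X u v k
      rw [bilinVec_apply]
      simp only [Finset.mul_sum]
      exact Finset.sum_congr rfl fun m _ => Finset.sum_congr rfl fun l _ => by ring
    rintro (i | j) k b
    · have d1 : DifferentiableAt ℝ (fun y => (fderiv ℝ φ y).inverse (bv k)) y :=
        (h.diff_inverse hy).clm_apply (differentiableAt_const _)
      obtain ⟨h1, h2⟩ := hproj _ b d1
      refine ⟨h1, h2.trans ?_⟩
      rw [fderiv_clm_apply₁ (h.diff_inverse hy) (differentiableAt_const _)]
      simp only [fderiv_fun_const, Pi.zero_apply, zero_apply, map_zero, zero_add,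
        h.fderiv_inverse_apply hy, PiLp.sub_apply]
      congr 1
      · rw [← sum_bv (bilinVec (weylConn G (φ y)) _ _)]
        simp only [map_sum, map_smul, WithLp.ofLp_sum, Finset.sum_apply, WithLp.ofLp_smul,
          Pi.smul_apply, smul_eq_mul, hexp, P, slotConn, Sum.elim_inl, bv_apply]
        simp only [mul_ite, mul_one, mul_zero, Finset.sum_ite_eq', Finset.mem_univ, if_true,
          Finset.sum_mul, Finset.mul_sum]
        rw [Finset.sum_comm]
        exact Finset.sum_congr rfl fun m _ => Finset.sum_congr rfl fun l _ => by ring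
      · rw [hexp]
        simp only [bv_apply, P, slotConn, Sum.elim_inl, ite_mul, one_mul, zero_mul,
          Finset.sum_ite_eq', Finset.mem_univ, if_true]
        exact Finset.sum_congr rfl fun m _ => by ring
    · have d1 : DifferentiableAt ℝ (fun y => fderiv ℝ φ y (bv b)) y :=
        (h.diff_fderiv hy).clm_apply (differentiableAt_const _)
      obtain ⟨h1, h2⟩ := hproj _ k d1
      refine ⟨h1, h2.trans ?_⟩
      rw [fderiv_clm_apply₁ (h.diff_fderiv hy) (differentiableAt_const _)]
      simp only [fderiv_fun_const, Pi.zero_apply, zero_apply, map_zero, zero_add]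
      rw [← sub_eq_iff_eq_add'.2 (h.fderiv_weylConn hy (bv a) (bv b)), PiLp.sub_apply, hexp,
        ← sum_bv (bilinVec (weylConn G' y) _ _)]
      simp only [map_sum, map_smul, WithLp.ofLp_sum, Finset.sum_apply, WithLp.ofLp_smul,
        Pi.smul_apply, smul_eq_mul, bilinVec_bv, P, slotConn, Sum.elim_inr, neg_mul, mul_neg,
        Finset.sum_neg_distrib, sub_neg_eq_add]
      rw [sub_eq_add_neg, add_comm]
      congr 1
      exact Finset.sum_congr rfl fun m _ => by ring
  have key := slot_deriv (h.diff hy).hasFDerivAt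
    (T := fun z L => T z (L ∘ Sum.inl) (L ∘ Sum.inr))
    (T' := fun z L => T' z (L ∘ Sum.inl) (L ∘ Sum.inr)) (P := P)
    (fun K => ContDiffOn.differentiableAt_of_isOpen (hT _ _) h.target.isOpen (h.mapsTo hy))
    (fun i k b => (dP i k b).1)
    (Filter.eventually_of_mem (h.source.isOpen.mem_nhds hy) fun x hx L => by
      rw [hTT x hx, hpull])
    a (fun i k b => (dP i k b).2) (Sum.elim A B)
  simp only [← connDeriv_eq_slot] at key
  have hA : Sum.elim A B ∘ Sum.inl = A := rfl
  have hB : Sum.elim A B ∘ Sum.inr = B := rfl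
  simp only [← hpull _ (connDeriv (weylConn G) T (φ y) _), hA, hB] at key
  -- Since Λ transforms as a covector, the remaining term s Λ_a T is pulled back in the same way.
  have hlam : lam G' y a = ∑ m, fderiv ℝ φ y (bv a) m * lam G (φ y) m := by
    rw [← linForm_bv (lam G' y), h.linForm_lam_eq hy, linForm_apply]
    exact Finset.sum_congr rfl fun m _ => by ring
  have hadd : ∀ (t t' : (Fin p → Fin 4) → (Fin q → Fin 4) → ℝ) (c : ℝ),
      pullbackComponents (fderiv ℝ φ y) (fun I K => t I K + c * t' I K) A B
      = pullbackComponents (fderiv ℝ φ y) t A B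
        + c * pullbackComponents (fderiv ℝ φ y) t' A B := by
    intro t t' c
    simp only [pullbackComponents, mul_add, Finset.sum_add_distrib, Finset.mul_sum]
    congr 1
    exact Finset.sum_congr rfl fun m _ => Finset.sum_congr rfl fun l _ => by ring
  rw [ConformalConcomitant.pseudoDiffComponents_eq G' hpq, key, hlam, hTT y hy, Finset.mul_sum,
    Finset.sum_mul, ← Finset.sum_add_distrib]
  refine Finset.sum_congr rfl fun m _ => ?_
  have : pseudoDiffComponents G s T (φ y) m = fun I K => connDeriv (weylConn G) T (φ y) m I K
      + s * lam G (φ y) m * T (φ y) I K := by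
    funext I K
    rw [ConformalConcomitant.pseudoDiffComponents_eq G hpq]
  rw [this, hadd]
  ring

end IsIsometryOn

/-! ### Tensors in charts -/

lemma multilinear_expand {V W : Type*} [AddCommGroup V] [Module ℝ V] [AddCommGroup W] [Module ℝ W]
    {p q : ℕ} (F : MultilinearMap ℝ (fun _ : Fin p => V) (MultilinearMap ℝ (fun _ : Fin q => W) ℝ))
    (a : Fin p → Fin 4 → ℝ) (c : Fin 4 → V) (b : Fin q → Fin 4 → ℝ) (v : Fin 4 → W) :
    F (fun i => ∑ k, a i k • c k) (fun j => ∑ k, b j k • v k)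
      = ∑ I : Fin p → Fin 4, ∑ K : Fin q → Fin 4, (∏ i, a i (I i)) * (∏ j, b j (K j))
        * F (fun i => c (I i)) (fun j => v (K j)) := by
  rw [MultilinearMap.map_sum F, sum_apply]
  refine Finset.sum_congr rfl fun I _ => ?_
  rw [MultilinearMap.map_smul_univ, smul_apply, MultilinearMap.map_sum,
    Finset.smul_sum]
  refine Finset.sum_congr rfl fun K _ => ?_
  rw [MultilinearMap.map_smul_univ, smul_eq_mul, smul_eq_mul, mul_assoc]

section Chart

variable {M : Type u} [TopologicalSpace M] [ChartedSpace E4 M]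

lemma ofComponents_apply {p q : ℕ} (e : OpenPartialHomeomorph M E4) (x : M)
    (t : (Fin p → Fin 4) → (Fin q → Fin 4) → ℝ)
    (α : Fin p → Module.Dual ℝ (TangentSpace (𝓡 4) x)) (Y : Fin q → TangentSpace (𝓡 4) x) :
    ofComponents e x t α Y = ∑ I : Fin p → Fin 4, ∑ K : Fin q → Fin 4,
      (∏ i, α i (coordVector e x (I i))) * (∏ j, chartDeriv e x (Y j) (K j)) * t I K := by
  simp only [ofComponents, sum_apply, smul_apply, basisTensor,
    MultilinearMap.smulRight_apply, MultilinearMap.compLinearMap_apply,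
    MultilinearMap.mkPiAlgebra_apply, Module.Dual.eval_apply, smul_eq_mul]
  refine Finset.sum_congr rfl fun I _ => Finset.sum_congr rfl fun K _ => ?_
  rw [mul_comm]
  rfl

lemma coordCovector_apply (e : OpenPartialHomeomorph M E4) (x : M) (i : Fin 4)
    (v : TangentSpace (𝓡 4) x) : coordCovector e x i v = chartDeriv e x v i := rfl

variable [IsManifold (𝓡 4) ∞ M] {e : OpenPartialHomeomorph M E4} (he : e ∈ atlas E4 M)
include he

lemma mdifferentiable_chart : e.MDifferentiable (𝓡 4) (𝓡 4) :=
  haveI : IsManifold (𝓡 4) 1 M := IsManifold.of_le (n := ∞) (by simp)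
  mdifferentiable_of_mem_atlas he

variable {x : M} (hx : x ∈ e.source)
include hx

lemma exists_chartEquiv : ∃ D : TangentSpace (𝓡 4) x ≃L[ℝ] E4,
    (D : TangentSpace (𝓡 4) x →L[ℝ] E4) = chartDeriv e x :=
  ⟨(mdifferentiable_chart he).mfderiv hx, rfl⟩

lemma chartDeriv_coordVector (i : Fin 4) : chartDeriv e x (coordVector e x i) = bv i := by
  obtain ⟨D, hD⟩ := exists_chartEquiv he hx
  rw [coordVector, ← hD, ContinuousLinearMap.inverse_equiv]
  exact D.apply_symm_apply _

lemma chartDeriv_injective : Function.Injective (chartDeriv e x) := by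
  obtain ⟨D, hD⟩ := exists_chartEquiv he hx
  rw [← hD]
  exact D.injective

lemma sum_coordVector (v : TangentSpace (𝓡 4) x) :
    v = ∑ i, chartDeriv e x v i • coordVector e x i := by
  apply chartDeriv_injective he hx
  rw [map_sum]
  simp only [map_smul, chartDeriv_coordVector he hx]
  exact (sum_bv _).symm

lemma sum_coordCovector (α : Module.Dual ℝ (TangentSpace (𝓡 4) x)) :
    α = ∑ i, α (coordVector e x i) • coordCovector e x i := by
  ext v
  conv_lhs => rw [sum_coordVector he hx v]
  simp only [map_sum, map_smul, LinearMap.sum_apply, LinearMap.smul_apply, smul_eq_mul,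
    coordCovector_apply, mul_comm]

lemma ofComponents_coord {p q : ℕ} (t : (Fin p → Fin 4) → (Fin q → Fin 4) → ℝ)
    (A : Fin p → Fin 4) (B : Fin q → Fin 4) :
    ofComponents e x t (fun i => coordCovector e x (A i)) (fun j => coordVector e x (B j))
      = t A B := by
  rw [ofComponents_apply]
  simp only [coordCovector_apply, chartDeriv_coordVector he hx, bv_apply]
  have h1 : ∀ I : Fin p → Fin 4, (∏ i, if A i = I i then (1 : ℝ) else 0)
      = if A = I then 1 else 0 := by
    intro I
    rw [Fintype.prod_ite_zero]
    simp [funext_iff]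
  have h2 : ∀ K : Fin q → Fin 4, (∏ j, if K j = B j then (1 : ℝ) else 0)
      = if B = K then 1 else 0 := by
    intro K
    rw [Fintype.prod_ite_zero]
    simp [funext_iff, eq_comm]
  simp [h1, h2]

end Chart

/-! ### Components of tensors under linear isomorphisms of tangent spaces. -/

section Transfer

variable {M N : Type u} [TopologicalSpace M] [ChartedSpace E4 M] [IsManifold (𝓡 4) ∞ M]
  [TopologicalSpace N] [ChartedSpace E4 N] [IsManifold (𝓡 4) ∞ N]
  {e : OpenPartialHomeomorph M E4} (he : e ∈ atlas E4 M)
  {e' : OpenPartialHomeomorph N E4} (he' : e' ∈ atlas E4 N)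
  {x : M} (hx : x ∈ e.source) {y : N} (hy : y ∈ e'.source)
  {L : TangentSpace (𝓡 4) x ≃L[ℝ] TangentSpace (𝓡 4) y} {J : E4 →L[ℝ] E4}
  (hJ : ∀ v, J (chartDeriv e x v) = chartDeriv e' y (L v))
include he he' hx hy hJ

lemma transfer_coordVector (b : Fin 4) :
    L (coordVector e x b) = ∑ k, J (bv b) k • coordVector e' y k := by
  rw [sum_coordVector he' hy (L (coordVector e x b)), ← hJ, chartDeriv_coordVector he hx]

/-- J is L conjugated by the chart derivatives, hence invertible. -/
lemma transfer_inverse (w : TangentSpace (𝓡 4) y) :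
    J.inverse (chartDeriv e' y w) = chartDeriv e x (L.symm w) := by
  obtain ⟨D, hD⟩ := exists_chartEquiv he hx
  obtain ⟨D', hD'⟩ := exists_chartEquiv he' hy
  have : J = (((D.symm.trans L).trans D' : E4 ≃L[ℝ] E4) : E4 →L[ℝ] E4) := by
    ext1 v
    have := hJ (D.symm v)
    rw [← hD, ← hD'] at this
    simpa using this
  rw [this, ContinuousLinearMap.inverse_equiv, ← hD, ← hD']
  simp

lemma transfer_coordCovector (a : Fin 4) :
    coordCovector e x a ∘ₗ L.symm.toLinearMap
      = ∑ k, J.inverse (bv k) a • coordCovector e' y k := by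
  rw [sum_coordCovector he' hy (coordCovector e x a ∘ₗ _)]
  refine Finset.sum_congr rfl fun k _ => ?_
  rw [← chartDeriv_coordVector he' hy k, transfer_inverse he he' hx hy hJ]
  rfl

/-- The components of a tensor pulled back along a linear isomorphism of tangent spaces. -/
lemma transfer_components {p q : ℕ} (Φ : TensorAt p q y) (A : Fin p → Fin 4) (B : Fin q → Fin 4) :
    Φ (fun i => coordCovector e x (A i) ∘ₗ L.symm.toLinearMap)
        (fun j => L (coordVector e x (B j)))
      = pullbackComponents J (fun I K => Φ (fun i => coordCovector e' y (I i))
        (fun j => coordVector e' y (K j))) A B := by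
  simp only [transfer_coordVector he he' hx hy hJ, transfer_coordCovector he he' hx hy hJ]
  rw [multilinear_expand]
  rfl

/-- Pulling back components corresponds to pulling back tensors. -/
lemma ofComponents_pullback {p q : ℕ} (t : (Fin p → Fin 4) → (Fin q → Fin 4) → ℝ)
    (α : Fin p → Module.Dual ℝ (TangentSpace (𝓡 4) y)) (Y : Fin q → TangentSpace (𝓡 4) x) :
    ofComponents e x (pullbackComponents J t) (fun i => α i ∘ₗ L.toLinearMap) Y
      = ofComponents e' y t α (fun j => L (Y j)) := by
  have h1 : ∀ A B, pullbackComponents J t A B = ofComponents e' y t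
      (fun i => coordCovector e x (A i) ∘ₗ L.symm.toLinearMap)
      (fun j => L (coordVector e x (B j))) := by
    intro A B
    rw [transfer_components he he' hx hy hJ]
    simp only [ofComponents_coord he' hy]
  have h2 : α = fun i => ∑ k, α i (L (coordVector e x k)) •
      (coordCovector e x k ∘ₗ L.symm.toLinearMap) := by
    funext i
    ext w
    conv_lhs => rw [← L.apply_symm_apply w, sum_coordVector he hx (L.symm w)]
    simp only [map_sum, map_smul, LinearMap.sum_apply, LinearMap.smul_apply, smul_eq_mul,
      LinearMap.comp_apply, coordCovector_apply, mul_comm]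
    rfl
  have h3 : (fun j => L (Y j)) = fun j => ∑ k, chartDeriv e x (Y j) k • L (coordVector e x k) := by
    funext j
    conv_lhs => rw [sum_coordVector he hx (Y j)]
    simp only [map_sum, map_smul]
  rw [ofComponents_apply, h3]
  conv_rhs => rw [h2]
  rw [multilinear_expand]
  simp only [h1]
  rfl

end Transfer

lemma pullbackComponents_succ {p q : ℕ} (J : E4 →L[ℝ] E4)
    (t : Fin 4 → (Fin p → Fin 4) → (Fin q → Fin 4) → ℝ) (A : Fin p → Fin 4)
    (B : Fin (q + 1) → Fin 4) :
    pullbackComponents J (fun I K => t (K 0) I fun j => K j.succ) A B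
      = ∑ m, J (bv (B 0)) m * pullbackComponents J (t m) A fun j => B j.succ := by
  simp only [pullbackComponents, Finset.mul_sum]
  rw [Finset.sum_comm]
  conv_rhs => enter [2, m]; rw [Finset.sum_comm]
  rw [← Fintype.sum_prod_type' (f := fun (m : Fin 4) (K : Fin q → Fin 4) =>
    ∑ I : Fin p → Fin 4, J (bv (B 0)) m * ((∏ i, J.inverse (bv (I i)) (A i)) *
      (∏ j : Fin q, J (bv (B j.succ)) (K j)) * t m I K))]
  refine (Fintype.sum_equiv (Fin.consEquiv fun _ => Fin 4) _ _ fun x => ?_).symm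
  refine Finset.sum_congr rfl fun I _ => ?_
  simp [Fin.consEquiv, Fin.prod_univ_succ]
  ring

/-! ### Metrics and tensor fields in charts -/

lemma IsMetricOn.mono {G : E4 → Matrix (Fin 4) (Fin 4) ℝ} {U V : Set E4} (h : IsMetricOn G U)
    (hV : IsOpen V) (hVU : V ⊆ U) : IsMetricOn G V where
  isOpen := hV
  symm z hz := h.symm z (hVU hz)
  det z hz := h.det z (hVU hz)
  smooth a b := (h.smooth a b).mono hVU

section Chart

variable {M : Type u} [TopologicalSpace M] [ChartedSpace E4 M] (g : PseudoRiemannianMetric M)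

lemma PseudoRiemannianMetric.components_apply {e : OpenPartialHomeomorph M E4} {x : M}
    (hx : x ∈ e.source) (a b : Fin 4) : g.components e (e x) a b
      = g.form x (coordVector e x a) (coordVector e x b) := by
  simp only [PseudoRiemannianMetric.components, bilinComponents, Matrix.of_apply]
  rw [e.left_inv hx]

lemma components_apply {p q : ℕ} (K : (x : M) → TensorAt p q x) {e : OpenPartialHomeomorph M E4}
    {x : M} (hx : x ∈ e.source) (A : Fin p → Fin 4) (B : Fin q → Fin 4) :
    components e K (e x) A B
      = K x (fun i => coordCovector e x (A i)) (fun j => coordVector e x (B j)) := by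
  simp only [components]
  rw [e.left_inv hx]

variable [IsManifold (𝓡 4) ∞ M] {e : OpenPartialHomeomorph M E4} (he : e ∈ atlas E4 M)
include he

lemma PseudoRiemannianMetric.met_components {x : M} (hx : x ∈ e.source)
    (v w : TangentSpace (𝓡 4) x) :
    met (g.components e) (e x) (chartDeriv e x v) (chartDeriv e x w) = g.form x v w := by
  conv_rhs => rw [sum_coordVector he hx v, sum_coordVector he hx w]
  simp only [met, bilin_apply, map_sum, map_smul, LinearMap.sum_apply, LinearMap.smul_apply,
    smul_eq_mul, g.components_apply hx, Finset.mul_sum]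
  rw [Finset.sum_comm]
  exact Finset.sum_congr rfl fun a _ => Finset.sum_congr rfl fun b _ => by ring

lemma PseudoRiemannianMetric.isMetricOn_components : IsMetricOn (g.components e) e.target where
  isOpen := e.open_target
  symm z hz a b := g.symm _ _ _
  smooth a b := g.smooth e he a b
  det z hz := by
    obtain ⟨x, hx, rfl⟩ : ∃ x ∈ e.source, e x = z := ⟨e.symm z, e.map_target hz, e.right_inv hz⟩
    rw [isUnit_iff_ne_zero]
    intro h0
    obtain ⟨v, hv, h1⟩ := Matrix.exists_mulVec_eq_zero_iff.2 h0
    apply hv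
    -- A kernel vector of the Gram matrix is the coordinate array of a tangent vector orthogonal to
    -- all others.
    have h2 : ∑ b, v b • coordVector e x b = 0 := by
      refine (g.nondegenerate x).2 _ fun w => ?_
      rw [sum_coordVector he hx w]
      simp only [map_sum, map_smul, LinearMap.sum_apply, LinearMap.smul_apply, smul_eq_mul]
      simp_rw [← g.components_apply hx]
      simp only [Finset.mul_sum]
      rw [Finset.sum_comm]
      refine Finset.sum_eq_zero fun a _ => ?_
      have h3 : ∑ b, g.components e (e x) a b * v b = 0 := congrFun h1 a
      rw [← mul_zero (chartDeriv e x w a), ← h3, Finset.mul_sum]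
      exact Finset.sum_congr rfl fun b _ => by ring
    have h3 := congrArg (chartDeriv e x) h2
    simp only [map_sum, map_smul, chartDeriv_coordVector he hx, map_zero] at h3
    funext i
    have h4 := congrArg (fun w : E4 => w i) h3
    simpa [bv_apply, Pi.single_apply] using h4

end Chart

/-! ### Local isometries and pullbacks expressed in charts. -/

section Isometry

variable {M N : Type u} [TopologicalSpace M] [ChartedSpace E4 M] [IsManifold (𝓡 4) ∞ M]
  [TopologicalSpace N] [ChartedSpace E4 N] [IsManifold (𝓡 4) ∞ N]

/-- The expression of a map in charts. -/
def chartRep (e : OpenPartialHomeomorph M E4) (e' : OpenPartialHomeomorph N E4) (φ : M → N) :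
    E4 → E4 := fun z => e' (φ (e.symm z))

/-- The domain of the expression of a map in charts. -/
def chartDom (e : OpenPartialHomeomorph M E4) (e' : OpenPartialHomeomorph N E4) (φ : M → N) :
    Set E4 := e.target ∩ e.symm ⁻¹' (φ ⁻¹' e'.source)

variable {e : OpenPartialHomeomorph M E4} (he : e ∈ atlas E4 M)
  {e' : OpenPartialHomeomorph N E4} (he' : e' ∈ atlas E4 N)
  {φ : M → N} (hφ : IsLocalDiffeomorph (𝓡 4) (𝓡 4) ∞ φ)

omit [IsManifold (𝓡 4) ∞ M] [IsManifold (𝓡 4) ∞ N] in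
include hφ in
lemma isOpen_chartDom : IsOpen (chartDom e e' φ) :=
  e.symm.continuousOn.isOpen_inter_preimage e.open_target
    (e'.open_source.preimage hφ.contMDiff.continuous)

include he he' hφ in
lemma contDiffOn_chartRep : ContDiffOn ℝ ∞ (chartRep e e' φ) (chartDom e e' φ) := by
  rw [← contMDiffOn_iff_contDiffOn]
  have h1 := contMDiffOn_symm_of_mem_maximalAtlas
    (IsManifold.subset_maximalAtlas (I := 𝓡 4) (n := ∞) he)
  have h2 := contMDiffOn_of_mem_maximalAtlas
    (IsManifold.subset_maximalAtlas (I := 𝓡 4) (n := ∞) he')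
  have h3 := hφ.contMDiff.comp_contMDiffOn h1
  exact h2.comp (h3.mono Set.inter_subset_left) fun z hz => hz.2

include he he' hφ in
-- The chain rule for `chartRep e e' φ ∘ e = e' ∘ φ` near x.
lemma fderiv_chartRep {x : M} (hx : x ∈ e.source) (hy : φ x ∈ e'.source)
    (v : TangentSpace (𝓡 4) x) : fderiv ℝ (chartRep e e' φ) (e x) (chartDeriv e x v)
      = chartDeriv e' (φ x) (mfderiv (𝓡 4) (𝓡 4) φ x v) := by
  have hz : e x ∈ chartDom e e' φ := ⟨e.map_source hx, by simpa [e.left_inv hx] using hy⟩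
  have d1 := ContDiffOn.differentiableAt_of_isOpen (contDiffOn_chartRep he he' hφ)
    (isOpen_chartDom hφ) hz
  have d2 : MDifferentiableAt (𝓡 4) (𝓡 4) e x := (mdifferentiable_chart he).mdifferentiableAt hx
  have d3 : MDifferentiableAt (𝓡 4) (𝓡 4) e' (φ x) :=
    (mdifferentiable_chart he').mdifferentiableAt hy
  have d4 : MDifferentiableAt (𝓡 4) (𝓡 4) φ x :=
    hφ.contMDiff.mdifferentiableAt (by simp)
  have heq : chartRep e e' φ ∘ e =ᶠ[nhds x] e' ∘ φ :=
    Filter.eventuallyEq_of_mem (e.open_source.mem_nhds hx) fun z hz => by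
      simp [chartRep, e.left_inv hz]
  have h1 := mfderiv_comp x (I := 𝓡 4) (I' := 𝓡 4) (I'' := 𝓡 4) (g := chartRep e e' φ) (f := e)
    d1.mdifferentiableAt d2
  have h2 := mfderiv_comp x (I := 𝓡 4) (I' := 𝓡 4) (I'' := 𝓡 4) d3 d4
  rw [heq.mfderiv_eq, h2, mfderiv_eq_fderiv] at h1
  exact (congrArg (fun l => l v) h1).symm

/-- `φ` is a local isometry. -/
def IsLocalIsometry (g : PseudoRiemannianMetric M) (h : PseudoRiemannianMetric N) (φ : M → N) :
    Prop :=
  ∀ (x : M) (v w : TangentSpace (𝓡 4) x),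
    g.form x v w = h.form (φ x) (mfderiv (𝓡 4) (𝓡 4) φ x v) (mfderiv (𝓡 4) (𝓡 4) φ x w)

variable {g : PseudoRiemannianMetric M} {h : PseudoRiemannianMetric N}
  (hgh : IsLocalIsometry g h φ)

include he he' hφ hgh in
lemma isIsometryOn_chartRep : IsIsometryOn (chartRep e e' φ) (g.components e) (chartDom e e' φ)
    (h.components e') e'.target where
  source := (g.isMetricOn_components he).mono (isOpen_chartDom hφ) Set.inter_subset_left
  target := h.isMetricOn_components he'
  smooth := contDiffOn_chartRep he he' hφ
  mapsTo z hz := e'.map_source hz.2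
  met_eq z hz u v := by
    obtain ⟨x, hx, rfl⟩ : ∃ x ∈ e.source, e x = z :=
      ⟨e.symm z, e.map_target hz.1, e.right_inv hz.1⟩
    have hy : φ x ∈ e'.source := by simpa [e.left_inv hx] using hz.2
    obtain ⟨D, hD⟩ := exists_chartEquiv he hx
    obtain ⟨u, rfl⟩ : ∃ v, chartDeriv e x v = u := ⟨D.symm u, by rw [← hD]; simp⟩
    obtain ⟨v, rfl⟩ : ∃ w, chartDeriv e x w = v := ⟨D.symm v, by rw [← hD]; simp⟩
    rw [fderiv_chartRep he he' hφ hx hy, fderiv_chartRep he he' hφ hx hy,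
      g.met_components he hx, chartRep, e.left_inv hx, h.met_components he' hy]
    exact hgh x _ _

/-- The tensor field `K` is the pullback of `K'` along `φ`. -/
def IsPullback {p q : ℕ} (φ : M → N) (K : (x : M) → TensorAt p q x)
    (K' : (y : N) → TensorAt p q y) : Prop :=
  ∀ (x : M) (α : Fin p → Module.Dual ℝ (TangentSpace (𝓡 4) (φ x)))
    (Y : Fin q → TangentSpace (𝓡 4) x),
    K x (fun i => α i ∘ₗ (mfderiv (𝓡 4) (𝓡 4) φ x).toLinearMap) Y =
      K' (φ x) α (fun j => mfderiv (𝓡 4) (𝓡 4) φ x (Y j))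

variable {p q : ℕ} {K : (x : M) → TensorAt p q x} {K' : (y : N) → TensorAt p q y}
  (hK : IsPullback φ K K')

include he he' hφ hK in
lemma components_pullback {z : E4} (hz : z ∈ chartDom e e' φ) (A : Fin p → Fin 4)
    (B : Fin q → Fin 4) : components e K z A B
      = pullbackComponents (fderiv ℝ (chartRep e e' φ) z)
        (components e' K' (chartRep e e' φ z)) A B := by
  obtain ⟨x, hx, rfl⟩ : ∃ x ∈ e.source, e x = z :=
    ⟨e.symm z, e.map_target hz.1, e.right_inv hz.1⟩
  have hy : φ x ∈ e'.source := by simpa [e.left_inv hx] using hz.2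
  let L := hφ.mfderivToContinuousLinearEquiv (by simp) x
  have hL : ∀ v, L v = mfderiv (𝓡 4) (𝓡 4) φ x v := fun v => rfl
  have hJ : ∀ v, fderiv ℝ (chartRep e e' φ) (e x) (chartDeriv e x v) = chartDeriv e' (φ x) (L v) :=
    fderiv_chartRep he he' hφ hx hy
  have h1 : components e' K' (chartRep e e' φ (e x)) = fun I J =>
      K' (φ x) (fun i => coordCovector e' (φ x) (I i)) (fun j => coordVector e' (φ x) (J j)) := by
    funext I J
    rw [chartRep, e.left_inv hx, components_apply K' hy]
  rw [h1, ← transfer_components he he' hx hy hJ, components_apply K hx]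
  -- The covectors are transported by the inverse of dφ, so that pulling them back returns the
  -- coordinate covectors at x.
  have h2 := hK x (fun i => coordCovector e x (A i) ∘ₗ L.symm.toLinearMap)
    (fun j => coordVector e x (B j))
  simp only [← hL] at h2 ⊢
  rw [← h2]
  congr 2
  funext i
  ext v
  simp only [LinearMap.comp_apply]
  exact congrArg _ (L.symm_apply_apply v).symm

variable (hK' : ∀ A B, ContDiffOn ℝ ∞ (fun z => components e' K' z A B) e'.target)

include he he' hφ hgh hK hK' in
lemma pseudoDiffComponents_pullback (hpq : (p, q) ≠ (0, 0)) (s : ℤ) {z : E4}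
    (hz : z ∈ chartDom e e' φ) :
    (fun A (B : Fin (q + 1) → Fin 4) => pseudoDiffComponents (g.components e) s (components e K) z
        (B 0) A fun j => B j.succ)
      = pullbackComponents (fderiv ℝ (chartRep e e' φ) z) fun A B =>
        pseudoDiffComponents (h.components e') s (components e' K') (chartRep e e' φ z)
          (B 0) A fun j => B j.succ := by
  funext A B
  rw [(isIsometryOn_chartRep he he' hφ hgh).pseudoDiffComponents_eq hz hpq s hK'
    (fun y hy => components_pullback he he' hφ hK hy), pullbackComponents_succ]

end Isometry

/-! ### Chart independence, smoothness, naturality and covariance on manifolds. -/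

section Main

variable {M N : Type u} [TopologicalSpace M] [ChartedSpace E4 M] [IsManifold (𝓡 4) ∞ M]
  [TopologicalSpace N] [ChartedSpace E4 N] [IsManifold (𝓡 4) ∞ N]

omit [IsManifold (𝓡 4) ∞ M] in
lemma isLocalDiffeomorph_id : IsLocalDiffeomorph (𝓡 4) (𝓡 4) ∞ (id : M → M) :=
  (Diffeomorph.refl (𝓡 4) M ∞).isLocalDiffeomorph

omit [IsManifold (𝓡 4) ∞ M] in
lemma isLocalIsometry_id (g : PseudoRiemannianMetric M) : IsLocalIsometry g g id := by
  intro x v w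
  simp only [mfderiv_id]
  rfl

omit [IsManifold (𝓡 4) ∞ M] in
lemma isPullback_id {p q : ℕ} (K : (x : M) → TensorAt p q x) : IsPullback id K K := by
  intro x α Y
  simp only [mfderiv_id]
  rfl

omit [ChartedSpace E4 M] [IsManifold (𝓡 4) ∞ M] in
lemma mem_chartDom_id {e e' : OpenPartialHomeomorph M E4} {x : M} (hx : x ∈ e.source)
    (hx' : x ∈ e'.source) : e x ∈ chartDom e e' id :=
  ⟨e.map_source hx, by simpa [e.left_inv hx] using hx'⟩

/-- `weylScalar` is defined in the preferred chart of each point; the identity, a local isometry,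
carries the condition to every chart of the atlas. -/
lemma NondegenerateMetric.weylSq_ne_zero (g : NondegenerateMetric M)
    {e : OpenPartialHomeomorph M E4} (he : e ∈ atlas E4 M) {z : E4} (hz : z ∈ e.target) :
    weylSq (g.components e) z ≠ 0 := by
  obtain ⟨x, hx, rfl⟩ : ∃ x ∈ e.source, e x = z := ⟨e.symm z, e.map_target hz, e.right_inv hz⟩
  rw [(isIsometryOn_chartRep he (chart_mem_atlas E4 x) isLocalDiffeomorph_id
    (isLocalIsometry_id g.toPseudoRiemannianMetric)).weylSq_eq
    (mem_chartDom_id hx (mem_chart_source E4 x)), chartRep, e.left_inv hx]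
  exact g.weylScalar_ne_zero x

/-- The components of the conformal pseudo-differential in an arbitrary chart. -/
lemma components_pseudoDiff (g : NondegenerateMetric M) {p q : ℕ} (hpq : (p, q) ≠ (0, 0)) (s : ℤ)
    {K : (x : M) → TensorAt p q x} (hK : IsSmoothTensorField K)
    {e : OpenPartialHomeomorph M E4} (he : e ∈ atlas E4 M) {z : E4} (hz : z ∈ e.target)
    (A : Fin p → Fin 4) (B : Fin (q + 1) → Fin 4) :
    components e (pseudoDiff g s K) z A B
      = pseudoDiffComponents (g.components e) s (components e K) z (B 0) A fun j => B j.succ := by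
  obtain ⟨x, hx, rfl⟩ : ∃ x ∈ e.source, e x = z := ⟨e.symm z, e.map_target hz, e.right_inv hz⟩
  have hx' := mem_chart_source E4 x
  have he' := chart_mem_atlas E4 x
  -- Chart independence is naturality under the identity map, read in `e` on one side and in the
  -- preferred chart of x on the other.
  have h1 := pseudoDiffComponents_pullback he he' isLocalDiffeomorph_id
    (isLocalIsometry_id g.toPseudoRiemannianMetric) (isPullback_id K) (hK _ he') hpq s
    (mem_chartDom_id hx hx')
  refine Eq.trans ?_ (congrFun (congrFun h1 A) B).symm
  rw [components_apply _ hx, pseudoDiff, chartRep, e.left_inv hx]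
  have hJ : ∀ v, fderiv ℝ (chartRep e (chartAt E4 x) id) (e x) (chartDeriv e x v)
      = chartDeriv (chartAt E4 x) x (ContinuousLinearEquiv.refl ℝ (TangentSpace (𝓡 4) x) v) := by
    intro v
    have := fderiv_chartRep he he' (isLocalDiffeomorph_id (M := M)) hx hx' v
    rw [this, mfderiv_id]
    rfl
  have h2 := ofComponents_pullback he he' hx hx' hJ
    (fun A (B : Fin (q + 1) → Fin 4) => pseudoDiffComponents (g.components (chartAt E4 x)) s
      (components (chartAt E4 x) K) (chartAt E4 x x) (B 0) A fun j => B j.succ)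
    (fun i => coordCovector e x (A i)) (fun j => coordVector e x (B j))
  refine Eq.trans h2.symm ?_
  exact ofComponents_coord he hx _ A B

/-- The chart used to define `pseudoDiff` varies with the point, so smoothness is read off only
after passing to one fixed chart. -/
lemma isSmoothTensorField_pseudoDiff (g : NondegenerateMetric M) {p q : ℕ}
    (hpq : (p, q) ≠ (0, 0)) (s : ℤ) {K : (x : M) → TensorAt p q x} (hK : IsSmoothTensorField K) :
    IsSmoothTensorField (pseudoDiff g s K) := by
  intro e he A B
  refine ContDiffOn.congr ?_ fun z hz => components_pseudoDiff g hpq s hK he hz A B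
  have hG := g.isMetricOn_components he
  have hl := hG.smooth_lam fun z hz => g.weylSq_ne_zero he hz
  have hu : ∀ c, ContDiffOn ℝ ∞ (fun z => lamUp (g.components e) z c) e.target := fun c =>
    ContDiffOn.sum fun d _ => (hG.smooth_inv _ _).mul (hl d)
  refine ((hG.smooth_covDeriv (hK e he) _ _ _).add (ContDiffOn.sum fun j _ =>
    ContDiffOn.sum fun c _ => ContDiffOn.mul ?_ (hK e he _ _))).add (ContDiffOn.sum fun j _ =>
    ContDiffOn.sum fun c _ => ContDiffOn.mul ?_ (hK e he _ _))
  · exact (((contDiffOn_const.mul (hl _)).mul contDiffOn_const).sub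
      ((hl _).mul contDiffOn_const)).add ((hG.smooth _ _).mul (hu _))
  · exact (((contDiffOn_const.mul (hl _)).mul contDiffOn_const).add
      ((hl _).mul contDiffOn_const)).sub ((hG.smooth _ _).mul (hu _))

/-- The conformal pseudo-differential is natural under local isometries. -/
lemma isPullback_pseudoDiff (g : NondegenerateMetric M) (h : NondegenerateMetric N) {p q : ℕ}
    (hpq : (p, q) ≠ (0, 0)) (s : ℤ) {φ : M → N} (hφ : IsLocalDiffeomorph (𝓡 4) (𝓡 4) ∞ φ)
    (hgh : IsLocalIsometry g.toPseudoRiemannianMetric h.toPseudoRiemannianMetric φ)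
    {K : (x : M) → TensorAt p q x} {K' : (y : N) → TensorAt p q y} (hK : IsPullback φ K K')
    (hK' : IsSmoothTensorField K') : IsPullback φ (pseudoDiff g s K) (pseudoDiff h s K') := by
  intro x α Y
  have hx := mem_chart_source E4 x
  have he := chart_mem_atlas E4 x
  have hy := mem_chart_source E4 (φ x)
  have he' := chart_mem_atlas E4 (φ x)
  have hz : chartAt E4 x x ∈ chartDom (chartAt E4 x) (chartAt E4 (φ x)) φ :=
    ⟨(chartAt E4 x).map_source hx, by simp⟩
  have h1 := pseudoDiffComponents_pullback he he' hφ hgh hK (hK' _ he') hpq s hz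
  have hJ := fderiv_chartRep he he' hφ hx hy
  have h2 := ofComponents_pullback (L := hφ.mfderivToContinuousLinearEquiv (by simp) x)
    he he' hx hy hJ (fun A (B : Fin (q + 1) → Fin 4) =>
      pseudoDiffComponents (h.components (chartAt E4 (φ x))) s
      (components (chartAt E4 (φ x)) K') (chartAt E4 (φ x) (φ x)) (B 0) A fun j => B j.succ) α Y
  have h3 : chartRep (chartAt E4 x) (chartAt E4 (φ x)) φ (chartAt E4 x x)
      = chartAt E4 (φ x) (φ x) := by
    rw [chartRep, (chartAt E4 x).left_inv hx]
  refine Eq.trans ?_ h2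
  rw [pseudoDiff, h1, h3]
  rfl

/-- The conformal pseudo-differential is conformally covariant. -/
lemma pseudoDiff_conformal (g g' : NondegenerateMetric M) {p q : ℕ}
    (hpq : (p, q) ≠ (0, 0)) (s : ℤ) {Θ : M → ℝ} (hΘ : ContMDiff (𝓡 4) 𝓘(ℝ, ℝ) ∞ Θ)
    (hpos : ∀ x, 0 < Θ x)
    (hg : ∀ (x : M) (v w : TangentSpace (𝓡 4) x), g.form x v w = Θ x ^ 2 * g'.form x v w)
    {K K' : (x : M) → TensorAt p q x} (hK : IsSmoothTensorField K)
    (hKK : ∀ x, K' x = Θ x ^ s • K x) (x : M) :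
    pseudoDiff g' s K' x = Θ x ^ s • pseudoDiff g s K x := by
  have hx := mem_chart_source E4 x
  have he := chart_mem_atlas E4 x
  set e := chartAt E4 x with he_def
  have hG := g.isMetricOn_components he
  have hG' := g'.isMetricOn_components he
  -- The sign reflects g̃ = Θ⁻² g: the rescaled metric is `g'`, and e^{-sψ} = Θ^s is the weight of
  -- K.
  let ψ : E4 → ℝ := fun z => - Real.log (Θ (e.symm z))
  have hψ : ContDiffOn ℝ ∞ ψ e.target := by
    have h1 := hΘ.comp_contMDiffOn (contMDiffOn_symm_of_mem_maximalAtlas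
      (IsManifold.subset_maximalAtlas (I := 𝓡 4) (n := ∞) he))
    rw [contMDiffOn_iff_contDiffOn] at h1
    exact (h1.log fun z _ => (hpos _).ne').neg
  have hexp : ∀ z, Real.exp (- ψ z) = Θ (e.symm z) := fun z => by
    simp only [ψ, neg_neg, Real.exp_log (hpos _)]
  have hexp' : ∀ z, Real.exp (- (s * ψ z)) = Θ (e.symm z) ^ s := fun z => by
    rw [← hexp, ← Real.rpow_intCast, ← Real.exp_mul]
    ring_nf
  have hc : IsConformalOn ψ (g'.components e) (g.components e) e.target :=
    { source := hG'
      target := hG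
      smooth := hψ
      met_eq := by
        intro z hz u v
        have h1 : ∀ a b, g.components e z a b
            = Real.exp (- ψ z) ^ 2 * g'.components e z a b := fun a b => by
          rw [hexp]
          exact hg _ _ _
        have h2 : Real.exp (2 * ψ z) * Real.exp (-ψ z) ^ 2 = 1 := by
          rw [← Real.exp_nat_mul, ← Real.exp_add]
          simp
        simp only [met, bilin_apply, h1, Finset.mul_sum]
        refine Finset.sum_congr rfl fun a _ => Finset.sum_congr rfl fun b _ => ?_
        linear_combination (-(g'.components e z a b * (u a * v b))) * h2 }
  have h1 := fun a A B => hc.pseudoDiffComponents_eq (e.map_source hx)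
    (g.weylSq_ne_zero he (e.map_source hx)) hpq s (T := components e K)
    (T' := components e K') (hK e he) (fun z hz A B => by
      rw [hexp', components, hKK]
      rfl) a A B
  have h2 : ∀ (t : (Fin p → Fin 4) → (Fin (q + 1) → Fin 4) → ℝ) (c : ℝ),
      ofComponents e x (fun A B => c * t A B) = c • ofComponents e x t := by
    intro t c
    simp only [ofComponents, Finset.smul_sum, smul_smul]
  simp only [pseudoDiff, ← he_def, h1, h2, hexp', e.left_inv hx]

end Main

end ConformalConcomitant

end

theorem mainTheorem3 (p q : ℕ) (hpq : (p, q) ≠ (0, 0)) (s : ℤ)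
    (K : TensorAssignment.{u} p q) (hK : IsMetricConcomitant K) :
    IsMetricConcomitant (pseudoDiffOf s K) ∧
      ∀ (M : Type u) [TopologicalSpace M] [ChartedSpace E4 M] [IsManifold (𝓡 4) ∞ M]
        [T2Space M] [SecondCountableTopology M],
        IsConformallyCovariant K s M → IsConformallyCovariant (pseudoDiffOf s K) s M := by
  refine ⟨⟨?_, ?_⟩, ?_⟩
  · intro M _ _ _ _ _ g
    exact isSmoothTensorField_pseudoDiff g hpq s (hK.smooth M g)
  · intro M N _ _ _ _ _ _ _ _ _ _ g h φ hφ hgh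
    exact isPullback_pseudoDiff g h hpq s hφ hgh (hK.natural M N g h φ hφ hgh) (hK.smooth N h)
  · intro M _ _ _ _ _ hc g g' Θ hΘ hpos hg x
    exact pseudoDiff_conformal g g' hpq s hΘ hpos hg (hK.smooth M g) (hc g g' Θ hΘ hpos hg) x
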